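/- Let $(M,g)$ be a Riemannian manifold and let $L$ be a submanifold of $M$ (possibly only immersed, by a smooth isometric immersion), with the induced Riemannian metric $\langle\cdot,\cdot\rangle$ and its Levi-Civita connection $\nabla$. Let $\pi:T^\perp L\to L$ be the normal bundle with the induced fibre metric $\langle\cdot,\cdot\rangle^\perp$ and the normal connection $\nabla^\perp$ (the normal component of the Levi-Civita connection of $M$). Let $$R^\perp(X,Y)\xi=\nabla^\perp_X\nabla^\perp_Y\xi-\nabla^\perp_Y\nabla^\perp_X\xi-\nabla^\perp_{[X,Y]}\xi$$ be the curvature of $\nabla^\perp$, and let $\hat R$ be its adjoint, defined by $\langle\hat R(\xi,\eta)X,Y\rangle=\langle R^\perp(X,Y)\xi,\eta\rangle^\perp$. Let $K:T(T^\perp L)\to T^\perp L$ be the connection map of $\nabla^\perp$: on the tangent spaces of the fibres it is the canonical isomorphism, and $K(\xi_*X)=\nabla^\perp_X\xi$ for sections $\xi$. For a vector field $X$ on $L$ and a section $\eta$ of $T^\perp L$ let $X^h$ and $\eta^v$ be the horizontal and vertical lifts, that is, $\pi_*X^h=X$, $KX^h=0$, $\pi_*\eta^v=0$, $K\eta^v=\eta$;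 the same notation is used for lifts of single vectors. Let $\Theta$ be the vertical vector field with $K\Theta_\theta=\theta$. All manifolds, maps, vector fields and sections are smooth. For $p\in\mathbb R$ and $q\ge 0$ let $h_{p,q}$ be the Riemannian metric on the manifold $T^\perp L$ given, for $A,B\in T_\theta(T^\perp L)$, by $$h_{p,q}(A,B)=\langle\pi_*A,\pi_*B\rangle+\omega_\theta^p\left(\langle KA,KB\rangle^\perp+q\langle KA,\theta\rangle^\perp\langle KB,\theta\rangle^\perp\right),\qquad \omega_\theta=\frac1{1+\langle\theta,\theta\rangle^\perp}.$$ Then the Levi-Civita connection $\tilde\nabla$ of $h_{p,q}$ is given as follows: for all vector fields $X,Y$ on $L$, all sections $\xi,\eta$ of $T^\perp L$ and all $\theta\in T^\perp L$, $$(\tilde\nabla_{X^h}Y^h)_\theta=(\nabla_XY)^h_\theta-\tfrac12\left(R^\perp(X,Y)\theta\right)^v_\theta,$$ $$(\tilde\nabla_{X^h}\eta^v)_\theta=\tfrac12\omega_\theta^p\left(\hat R(\theta,\eta)X\right)^h_\theta+(\nabla^\perp_X\eta)^v_\theta,$$ $$(\tilde\nabla_{\eta^v}Y^h)_\theta=\tfrac12\omega_\theta^p\left(\hat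 R(\theta,\eta)Y\right)^h_\theta,$$ $$(\tilde\nabla_{\xi^v}\eta^v)_\theta=-p\,\omega_\theta\left(\langle\xi,\theta\rangle^\perp\eta^v+\langle\eta,\theta\rangle^\perp\xi^v\right)_\theta+\left(\nu_\theta\langle\xi,\theta\rangle^\perp\langle\eta,\theta\rangle^\perp+\mu_\theta\langle\xi,\eta\rangle^\perp\right)\Theta_\theta,$$ where $$\nu_\theta=\frac{pq\,\omega_\theta}{q\langle\theta,\theta\rangle^\perp+1},\qquad \mu_\theta=\frac{q+p\,\omega_\theta}{q\langle\theta,\theta\rangle^\perp+1}.$$ In particular, every fibre $T_x^\perp L$, $x\in L$, is a totally geodesic submanifold of $(T^\perp L,h_{p,q})$, i.e. its second fundamental form vanishes. -/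

import Mathlib

open Bundle Set Filter
open scoped Manifold ContDiff Topology

set_option linter.unusedSectionVars false

noncomputable section

namespace NormalBundleGeometry

section Aux

variable {E : Type*} [NormedAddCommGroup E] [NormedSpace ℝ E] [FiniteDimensional ℝ E]
  {M : Type*} [TopologicalSpace M] [ChartedSpace E M]

instance instFiniteDimensionalTangentSpace (x : M) :
    FiniteDimensional ℝ (TangentSpace 𝓘(ℝ, E) x) :=
  inferInstanceAs (FiniteDimensional ℝ E)

theorem contMDiffAt_clm_of_apply
    {EB : Type*} [NormedAddCommGroup EB] [NormedSpace ℝ EB]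
    {B : Type*} [TopologicalSpace B] [ChartedSpace EB B]
    {F : Type*} [NormedAddCommGroup F] [NormedSpace ℝ F]
    {n : WithTop ℕ∞} {φ : B → E →L[ℝ] F} {x₀ : B}
    (h : ∀ v, ContMDiffAt 𝓘(ℝ, EB) 𝓘(ℝ, F) n (fun x => φ x v) x₀) :
    ContMDiffAt 𝓘(ℝ, EB) 𝓘(ℝ, E →L[ℝ] F) n φ x₀ := by
  let b := Module.finBasis ℝ E
  let T : (Fin (Module.finrank ℝ E) → F) →L[ℝ] (E →L[ℝ] F) :=
    ∑ i, (ContinuousLinearMap.smulRightL ℝ E F (LinearMap.toContinuousLinearMap (b.coord i))).comp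
      (ContinuousLinearMap.proj i)
  have hT : φ = fun x => T (fun i => φ x (b i)) := by
    funext x
    ext v
    simp only [T, sum_apply, ContinuousLinearMap.comp_apply,
      ContinuousLinearMap.smulRightL_apply_apply, ContinuousLinearMap.proj_apply,
      ContinuousLinearMap.smulRight_apply, LinearMap.coe_toContinuousLinearMap',
      Module.Basis.coord_apply]
    conv_lhs => rw [← b.sum_repr v, map_sum]
    simp
  rw [hT]
  exact T.contMDiff.contMDiffAt.comp x₀ (contMDiffAt_pi_space.2 fun i => h (b i))

/-- In coordinates: if `e : T ≃ E`, `df : T' → T` is injective with coordinate expression `A`, and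
`H` is the coordinate expression of the inner product on `T`, then the orthogonal projection onto
`(range df)ᗮ` is smooth in `A` and `H`. -/
theorem projection_coord
    {T : Type*} [NormedAddCommGroup T] [InnerProductSpace ℝ T] [FiniteDimensional ℝ T]
    {EL : Type*} [NormedAddCommGroup EL] [NormedSpace ℝ EL] [FiniteDimensional ℝ EL]
    (ei : E →L[ℝ] T) (e : T →L[ℝ] E) (hei : ∀ v, ei (e v) = v)
    (df : EL →L[ℝ] T) (hdf : Function.Injective df)
    (H : E →L[ℝ] E →L[ℝ] ℝ) (hH : ∀ v w, H v w = inner ℝ (ei v) (ei w))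
    (A : EL →L[ℝ] E) (hA : ∀ u, A u = e (df u)) :
    let S : E →L[ℝ] (EL →L[ℝ] ℝ) := (ContinuousLinearMap.precomp ℝ A).comp H
    (S.comp A).IsInvertible ∧
    e.comp (((LinearMap.range (df : EL →ₗ[ℝ] T))ᗮ.starProjection).comp ei) =
      e.comp ei - A.comp (((S.comp A).inverse).comp S) := by
  intro S
  have hS : ∀ v u, S v u = inner ℝ (ei v) (df u) := by
    intro v u
    simp [S, hH, hA, hei]
  have hinj : Function.Injective (S.comp A) := by
    rw [injective_iff_map_eq_zero]
    intro u hu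
    have h1 : S (A u) u = 0 := by
      have := congrArg (fun φ : EL →L[ℝ] ℝ => φ u) hu
      simpa using this
    rw [hS, hA, hei, inner_self_eq_zero] at h1
    exact hdf (by simpa using h1)
  have hfin : Module.finrank ℝ EL = Module.finrank ℝ (EL →L[ℝ] ℝ) := by
    rw [← (LinearMap.toContinuousLinearMap (𝕜 := ℝ) (E := EL) (F' := ℝ)).finrank_eq]
    exact (Subspace.dual_finrank_eq (K := ℝ) (V := EL)).symm
  let G : EL ≃L[ℝ] (EL →L[ℝ] ℝ) :=
    (LinearEquiv.ofInjectiveOfFinrankEq (S.comp A : EL →ₗ[ℝ] (EL →L[ℝ] ℝ)) hinj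
      hfin).toContinuousLinearEquiv
  have hG : (G : EL →L[ℝ] (EL →L[ℝ] ℝ)) = S.comp A := by
    ext u v
    rfl
  refine ⟨⟨G, hG⟩, ?_⟩
  rw [← hG, ContinuousLinearMap.inverse_equiv]
  ext w
  have key : (LinearMap.range (df : EL →ₗ[ℝ] T)).starProjection (ei w) = df (G.symm (S w)) := by
    apply Submodule.eq_starProjection_of_mem_orthogonal
    · exact ⟨_, rfl⟩
    · rw [Submodule.mem_orthogonal']
      rintro _ ⟨u, rfl⟩
      have h2 : S (A (G.symm (S w))) u = S w u := by
        have h3 : S.comp A (G.symm (S w)) = S w := by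
          rw [← hG]; exact G.apply_symm_apply _
        exact congrArg (fun φ : EL →L[ℝ] ℝ => φ u) h3
      rw [hS, hS, hA, hei] at h2
      rw [inner_sub_left]
      change inner ℝ (ei w) (df u) - inner ℝ (df (G.symm (S w))) (df u) = 0
      rw [h2, sub_self]
  simp [Submodule.starProjection_orthogonal, key, hA]

end Aux

section Immersion

variable
  (EL : Type*) [NormedAddCommGroup EL] [NormedSpace ℝ EL] [FiniteDimensional ℝ EL]
  (L : Type*) [TopologicalSpace L] [ChartedSpace EL L] [IsManifold 𝓘(ℝ, EL) ∞ L]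
  [RiemannianBundle (fun x : L => TangentSpace 𝓘(ℝ, EL) x)]
  (EM : Type*) [NormedAddCommGroup EM] [NormedSpace ℝ EM] [FiniteDimensional ℝ EM]
  (M : Type*) [TopologicalSpace M] [ChartedSpace EM M] [IsManifold 𝓘(ℝ, EM) ∞ M]
  [RiemannianBundle (fun x : M => TangentSpace 𝓘(ℝ, EM) x)]

/-- A smooth isometric immersion `L → M` of Riemannian manifolds, that is, `L` is an (immersed)
submanifold of `M` with the induced Riemannian metric. -/
structure IsometricImmersion where
  toFun : L → M
  contMDiff : ContMDiff 𝓘(ℝ, EL) 𝓘(ℝ, EM) ∞ toFun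
  inner_mfderiv : ∀ (x : L) (u v : TangentSpace 𝓘(ℝ, EL) x),
    inner ℝ (mfderiv 𝓘(ℝ, EL) 𝓘(ℝ, EM) toFun x u) (mfderiv 𝓘(ℝ, EL) 𝓘(ℝ, EM) toFun x v) =
      inner ℝ u v

namespace IsometricImmersion

variable {EL L EM M} (f : IsometricImmersion EL L EM M)

/-- The differential of the immersion. -/
def d (x : L) : TangentSpace 𝓘(ℝ, EL) x →L[ℝ] TangentSpace 𝓘(ℝ, EM) (f.toFun x) :=
  mfderiv 𝓘(ℝ, EL) 𝓘(ℝ, EM) f.toFun x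

theorem d_injective (x : L) : Function.Injective (f.d x) := by
  rw [injective_iff_map_eq_zero]
  intro u hu
  have h := f.inner_mfderiv x u u
  change inner ℝ (f.d x u) (f.d x u) = _ at h
  rw [hu, inner_zero_left] at h
  exact inner_self_eq_zero.1 h.symm

/-- The normal space `(T_x L)ᗮ ⊆ T_{f x} M`. -/
def normalSubmodule (x : L) : Submodule ℝ (TangentSpace 𝓘(ℝ, EM) (f.toFun x)) :=
  (LinearMap.range (f.d x : TangentSpace 𝓘(ℝ, EL) x →ₗ[ℝ] TangentSpace 𝓘(ℝ, EM) (f.toFun x)))ᗮ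

/-- The fibre of the normal bundle at `x`, with the fibre metric induced from `M`. -/
def NormalSpace (x : L) : Type _ := f.normalSubmodule x

instance (x : L) : NormedAddCommGroup (f.NormalSpace x) :=
  inferInstanceAs (NormedAddCommGroup (f.normalSubmodule x))

instance (x : L) : InnerProductSpace ℝ (f.NormalSpace x) :=
  inferInstanceAs (InnerProductSpace ℝ (f.normalSubmodule x))

instance (x : L) : FiniteDimensional ℝ (f.NormalSpace x) :=
  inferInstanceAs (FiniteDimensional ℝ (f.normalSubmodule x))

/-- The inclusion of the normal space into the tangent space of `M`. -/
def incl (x : L) : f.NormalSpace x →L[ℝ] TangentSpace 𝓘(ℝ, EM) (f.toFun x) :=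
  (f.normalSubmodule x).subtypeL

/-- The orthogonal projection of the tangent space of `M` onto the normal space. -/
def proj (x : L) : TangentSpace 𝓘(ℝ, EM) (f.toFun x) →L[ℝ] f.NormalSpace x :=
  (f.normalSubmodule x).orthogonalProjectionOnto

theorem proj_incl (x : L) (v : f.NormalSpace x) : f.proj x (f.incl x v) = v :=
  Submodule.orthogonalProjectionOnto_mem_subspace_eq_self (K := f.normalSubmodule x) v

theorem finrank_normalSpace (x : L) :
    Module.finrank ℝ (f.NormalSpace x) = Module.finrank ℝ EM - Module.finrank ℝ EL := by
  have h1 := Submodule.finrank_add_finrank_orthogonal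
    (LinearMap.range (f.d x : TangentSpace 𝓘(ℝ, EL) x →ₗ[ℝ] TangentSpace 𝓘(ℝ, EM) (f.toFun x)))
  have h2 := LinearMap.finrank_range_of_inj
    (f := (f.d x : TangentSpace 𝓘(ℝ, EL) x →ₗ[ℝ] TangentSpace 𝓘(ℝ, EM) (f.toFun x)))
    (f.d_injective x)
  have h3 : Module.finrank ℝ (TangentSpace 𝓘(ℝ, EL) x) = Module.finrank ℝ EL := rfl
  have h4 : Module.finrank ℝ (TangentSpace 𝓘(ℝ, EM) (f.toFun x)) = Module.finrank ℝ EM := rfl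
  change _ + Module.finrank ℝ (f.NormalSpace x) = _ at h1
  omega

end IsometricImmersion

/-- The model fibre `ℝ^(dim M - dim L)` of the normal bundle. -/
abbrev NormalModel : Type :=
  EuclideanSpace ℝ (Fin (Module.finrank ℝ EM - Module.finrank ℝ EL))

end Immersion

section Bundle

variable
  {EL : Type*} [NormedAddCommGroup EL] [NormedSpace ℝ EL] [FiniteDimensional ℝ EL]
  {L : Type*} [TopologicalSpace L] [ChartedSpace EL L] [IsManifold 𝓘(ℝ, EL) ∞ L]
  [RiemannianBundle (fun x : L => TangentSpace 𝓘(ℝ, EL) x)]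
  {EM : Type*} [NormedAddCommGroup EM] [NormedSpace ℝ EM] [FiniteDimensional ℝ EM]
  {M : Type*} [TopologicalSpace M] [ChartedSpace EM M] [IsManifold 𝓘(ℝ, EM) ∞ M]
  [RiemannianBundle (fun x : M => TangentSpace 𝓘(ℝ, EM) x)]

namespace IsometricImmersion

variable (f : IsometricImmersion EL L EM M)

/-- The preferred trivialization of `TM` around `f x₀`. -/
abbrev triv (x₀ : L) : Trivialization EM (TotalSpace.proj : TangentBundle 𝓘(ℝ, EM) M → M) :=
  trivializationAt EM (TangentSpace 𝓘(ℝ, EM) : M → Type _) (f.toFun x₀)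

/-- The orthogonal projection onto the normal space at `x`, in the trivialization at `x₀`. -/
def projCoord (x₀ x : L) : EM →L[ℝ] EM :=
  ((f.triv x₀).continuousLinearMapAt ℝ (f.toFun x)).comp
    (((f.incl x).comp (f.proj x)).comp ((f.triv x₀).symmL ℝ (f.toFun x)))

theorem contMDiffAt_projCoord
    [IsContMDiffRiemannianBundle 𝓘(ℝ, EM) ∞ EM (fun x : M => TangentSpace 𝓘(ℝ, EM) x)]
    (x₀ : L) {x₁ : L} (hx₁ : f.toFun x₁ ∈ (f.triv x₀).baseSet) :
    ContMDiffAt 𝓘(ℝ, EL) 𝓘(ℝ, EM →L[ℝ] EM) ∞ (f.projCoord x₀) x₁ := by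
  let e := f.triv x₀
  let e' := trivializationAt EL (TangentSpace 𝓘(ℝ, EL) : L → Type _) x₁
  let ei (x : L) : EM →L[ℝ] TangentSpace 𝓘(ℝ, EM) (f.toFun x) := e.symmL ℝ (f.toFun x)
  let ec (x : L) : TangentSpace 𝓘(ℝ, EM) (f.toFun x) →L[ℝ] EM :=
    e.continuousLinearMapAt ℝ (f.toFun x)
  let df (x : L) : EL →L[ℝ] TangentSpace 𝓘(ℝ, EM) (f.toFun x) := (f.d x).comp (e'.symmL ℝ x)
  let A (x : L) : EL →L[ℝ] EM := (ec x).comp (df x)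
  let H (x : L) : EM →L[ℝ] EM →L[ℝ] ℝ :=
    (ContinuousLinearMap.precomp ℝ (ei x)).comp ((innerSL ℝ).comp (ei x))
  let S (x : L) : EM →L[ℝ] (EL →L[ℝ] ℝ) := (ContinuousLinearMap.precomp ℝ (A x)).comp (H x)
  have hfc : ContinuousAt f.toFun x₁ := f.contMDiff.continuous.continuousAt
  have hU : ∀ᶠ x in 𝓝 x₁, f.toFun x ∈ e.baseSet :=
    hfc.eventually_mem (e.open_baseSet.mem_nhds hx₁)
  have hU' : ∀ᶠ x in 𝓝 x₁, x ∈ e'.baseSet :=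
    e'.open_baseSet.mem_nhds (mem_baseSet_trivializationAt _ _ _)
  have main : ∀ x, f.toFun x ∈ e.baseSet → x ∈ e'.baseSet →
      ((S x).comp (A x)).IsInvertible ∧ f.projCoord x₀ x =
        ContinuousLinearMap.id ℝ EM - (A x).comp ((((S x).comp (A x)).inverse).comp (S x)) := by
    intro x hx hx'
    have hsurj : Function.Surjective (e'.symmL ℝ x) := fun u =>
      ⟨e'.continuousLinearMapAt ℝ x u, e'.symmL_continuousLinearMapAt hx' u⟩
    have hinj : Function.Injective (e'.symmL ℝ x) :=
      Function.LeftInverse.injective (e'.continuousLinearMapAt_symmL hx')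
    have h := projection_coord (ei x) (ec x) (fun v => e.symmL_continuousLinearMapAt hx v)
      (df x) ((f.d_injective x).comp hinj) (H x) (fun v w => rfl) (A x) (fun u => rfl)
    refine ⟨h.1, ?_⟩
    have hid : (ec x).comp (ei x) = ContinuousLinearMap.id ℝ EM := by
      ext v
      exact e.continuousLinearMapAt_symmL hx v
    have hrange : LinearMap.range (df x : EL →ₗ[ℝ] TangentSpace 𝓘(ℝ, EM) (f.toFun x)) =
        LinearMap.range
          (f.d x : TangentSpace 𝓘(ℝ, EL) x →ₗ[ℝ] TangentSpace 𝓘(ℝ, EM) (f.toFun x)) := by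
      apply SetLike.coe_injective
      change Set.range ((f.d x) ∘ (e'.symmL ℝ x)) = Set.range (f.d x)
      exact hsurj.range_comp _
    have h2 := h.2
    rw [hid] at h2
    rw [← h2, projCoord]
    congr 2
    ext v
    simp only [hrange]
    rfl
  have hsec : ∀ v, ContMDiffAt 𝓘(ℝ, EL) (𝓘(ℝ, EM).prod 𝓘(ℝ, EM)) ∞
      (fun x => (⟨f.toFun x, ei x v⟩ : TangentBundle 𝓘(ℝ, EM) M)) x₁ := by
    intro v
    refine (Trivialization.contMDiffAt_iff (e := e) ?_).2 ⟨f.contMDiff.contMDiffAt, ?_⟩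
    · exact e.mem_source.2 hx₁
    · refine contMDiffAt_const (c := v) |>.congr_of_eventuallyEq ?_
      filter_upwards [hU] with x hx
      have := e.continuousLinearMapAt_symmL (R := ℝ) hx v
      rwa [Trivialization.continuousLinearMapAt_apply, Trivialization.coe_linearMapAt_of_mem _ hx]
        at this
  have hH : ContMDiffAt 𝓘(ℝ, EL) 𝓘(ℝ, EM →L[ℝ] EM →L[ℝ] ℝ) ∞ H x₁ := by
    refine contMDiffAt_clm_of_apply fun v => contMDiffAt_clm_of_apply fun w => ?_
    exact ContMDiffAt.inner_bundle (E := fun x : M => TangentSpace 𝓘(ℝ, EM) x) (hsec v) (hsec w)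
  have hA : ContMDiffAt 𝓘(ℝ, EL) 𝓘(ℝ, EL →L[ℝ] EM) ∞ A x₁ := by
    refine contMDiffAt_clm_of_apply fun v => ?_
    have h1 : ContMDiffAt 𝓘(ℝ, EL) (𝓘(ℝ, EL).prod 𝓘(ℝ, EL)) ∞
        (fun x => (⟨x, e'.symmL ℝ x v⟩ : TangentBundle 𝓘(ℝ, EL) L)) x₁ := by
      refine (Trivialization.contMDiffAt_iff (e := e') ?_).2 ⟨contMDiffAt_id, ?_⟩
      · exact e'.mem_source.2 (mem_baseSet_trivializationAt _ _ _)
      · refine contMDiffAt_const (c := v) |>.congr_of_eventuallyEq ?_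
        filter_upwards [hU'] with x hx
        have := e'.continuousLinearMapAt_symmL (R := ℝ) hx v
        rwa [Trivialization.continuousLinearMapAt_apply,
          Trivialization.coe_linearMapAt_of_mem _ hx] at this
    have h2 : ContMDiff 𝓘(ℝ, EL).tangent 𝓘(ℝ, EM).tangent ∞
        (tangentMap 𝓘(ℝ, EL) 𝓘(ℝ, EM) f.toFun) :=
      f.contMDiff.contMDiff_tangentMap le_rfl
    have h3 := h2.contMDiffAt.comp x₁ h1
    have h4 := ((Trivialization.contMDiffAt_iff (e := e) (e.mem_source.2 hx₁)).1 h3).2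
    refine h4.congr_of_eventuallyEq ?_
    filter_upwards [hU] with x hx
    change e.continuousLinearMapAt ℝ (f.toFun x) _ = _
    rw [Trivialization.continuousLinearMapAt_apply, Trivialization.coe_linearMapAt_of_mem _ hx]
    rfl
  have hS : ContMDiffAt 𝓘(ℝ, EL) 𝓘(ℝ, EM →L[ℝ] (EL →L[ℝ] ℝ)) ∞ S x₁ := by
    refine contMDiffAt_clm_of_apply fun v => ?_
    have h1 : ContMDiffAt 𝓘(ℝ, EL) 𝓘(ℝ, EM →L[ℝ] ℝ) ∞ (fun x => H x v) x₁ :=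
      hH.clm_apply contMDiffAt_const
    exact h1.clm_comp hA
  have hSA := hS.clm_comp hA
  have hinv : ContMDiffAt 𝓘(ℝ, EL) 𝓘(ℝ, (EL →L[ℝ] ℝ) →L[ℝ] EL) ∞
      (fun x => ((S x).comp (A x)).inverse) x₁ :=
    ((main x₁ hx₁ (mem_baseSet_trivializationAt _ _ _)).1.contDiffAt_map_inverse
      (n := ∞)).contMDiffAt.comp x₁ hSA
  have hQ : ContMDiffAt 𝓘(ℝ, EL) 𝓘(ℝ, EM →L[ℝ] EM) ∞
      (fun x => ContinuousLinearMap.id ℝ EM - (A x).comp ((((S x).comp (A x)).inverse).comp (S x)))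
      x₁ := contMDiffAt_const.sub (hA.clm_comp (hinv.clm_comp hS))
  refine hQ.congr_of_eventuallyEq ?_
  filter_upwards [hU, hU'] with x hx hx'
  exact (main x hx hx').2

variable [IsContMDiffRiemannianBundle 𝓘(ℝ, EM) ∞ EM (fun x : M => TangentSpace 𝓘(ℝ, EM) x)]

/-- A linear isomorphism of the normal space at `x₀` with the model fibre. -/
def modelIso (x₀ : L) : f.NormalSpace x₀ ≃L[ℝ] NormalModel EL EM :=
  ContinuousLinearEquiv.ofFinrankEq (by rw [f.finrank_normalSpace, finrank_euclideanSpace_fin])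

/-- Read a vector of the model of `TM` in the normal space at `x₀`. -/
def toModel (x₀ : L) : EM →L[ℝ] NormalModel EL EM :=
  ((f.modelIso x₀ : f.NormalSpace x₀ →L[ℝ] NormalModel EL EM).comp (f.proj x₀)).comp
    ((f.triv x₀).symmL ℝ (f.toFun x₀))

/-- Send the model fibre to the normal space at `x₀`, read in the model of `TM`. -/
def ofModel (x₀ : L) : NormalModel EL EM →L[ℝ] EM :=
  ((f.triv x₀).continuousLinearMapAt ℝ (f.toFun x₀)).comp
    ((f.incl x₀).comp ((f.modelIso x₀).symm : NormalModel EL EM →L[ℝ] f.NormalSpace x₀))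

/-- The fibre map of the local trivialization of the normal bundle around `x₀`: read a normal
vector in the trivialization of `TM`, and project it to the normal space at `x₀`. -/
def fibreMap (x₀ x : L) : f.NormalSpace x →L[ℝ] NormalModel EL EM :=
  (f.toModel x₀).comp (((f.triv x₀).continuousLinearMapAt ℝ (f.toFun x)).comp (f.incl x))

/-- Project the normal space at `x₀` to the normal space at `x` in the trivialization of `TM`. -/
def fibreSection (x₀ x : L) : NormalModel EL EM →L[ℝ] f.NormalSpace x :=
  ((f.proj x).comp ((f.triv x₀).symmL ℝ (f.toFun x))).comp (f.ofModel x₀)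

/-- The composition of `fibreSection` and `fibreMap`. -/
def fibreEndo (x₀ x : L) : NormalModel EL EM →L[ℝ] NormalModel EL EM :=
  (f.toModel x₀).comp ((f.projCoord x₀ x).comp (f.ofModel x₀))

theorem fibreMap_fibreSection (x₀ x : L) (w : NormalModel EL EM) :
    f.fibreMap x₀ x (f.fibreSection x₀ x w) = f.fibreEndo x₀ x w := rfl

theorem fibreEndo_self (x₀ : L) : f.fibreEndo x₀ x₀ = 1 := by
  have hx : f.toFun x₀ ∈ (f.triv x₀).baseSet := mem_baseSet_trivializationAt _ _ _
  ext1 w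
  simp only [fibreEndo, toModel, ofModel, projCoord, ContinuousLinearMap.comp_apply]
  rw [(f.triv x₀).symmL_continuousLinearMapAt hx, (f.triv x₀).symmL_continuousLinearMapAt hx,
    f.proj_incl, f.proj_incl]
  simp

/-- The domain of the local trivialization around `x₀`. -/
def trivDomain (x₀ : L) : Set L :=
  {x | f.toFun x ∈ (f.triv x₀).baseSet ∧ IsUnit (f.fibreEndo x₀ x)}

theorem mem_trivDomain (x₀ : L) : x₀ ∈ f.trivDomain x₀ :=
  ⟨mem_baseSet_trivializationAt _ _ _, by rw [f.fibreEndo_self]; exact isUnit_one⟩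

theorem contMDiffAt_fibreEndo (x₀ : L) {x₁ : L} (hx₁ : f.toFun x₁ ∈ (f.triv x₀).baseSet) :
    ContMDiffAt 𝓘(ℝ, EL) 𝓘(ℝ, NormalModel EL EM →L[ℝ] NormalModel EL EM) ∞
      (f.fibreEndo x₀) x₁ :=
  contMDiffAt_const.clm_comp ((f.contMDiffAt_projCoord x₀ hx₁).clm_comp contMDiffAt_const)

theorem isOpen_trivDomain (x₀ : L) : IsOpen (f.trivDomain x₀) := by
  rw [isOpen_iff_mem_nhds]
  rintro x ⟨hx, hu⟩
  have h1 : ∀ᶠ y in 𝓝 x, f.toFun y ∈ (f.triv x₀).baseSet :=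
    f.contMDiff.continuous.continuousAt.eventually_mem ((f.triv x₀).open_baseSet.mem_nhds hx)
  have h2 : ∀ᶠ y in 𝓝 x, IsUnit (f.fibreEndo x₀ y) :=
    (f.contMDiffAt_fibreEndo x₀ hx).continuousAt.eventually_mem
      (Units.isOpen.mem_nhds hu)
  filter_upwards [h1, h2] with y hy hy'
  exact ⟨hy, hy'⟩

/-- The inverse of `fibreMap` on the domain of the local trivialization. -/
def fibreInv (x₀ x : L) : NormalModel EL EM →L[ℝ] f.NormalSpace x :=
  (f.fibreSection x₀ x).comp (Ring.inverse (f.fibreEndo x₀ x))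

theorem fibreMap_fibreInv {x₀ x : L} (hx : x ∈ f.trivDomain x₀) (w : NormalModel EL EM) :
    f.fibreMap x₀ x (f.fibreInv x₀ x w) = w := by
  change (f.fibreEndo x₀ x * Ring.inverse (f.fibreEndo x₀ x)) w = w
  rw [Ring.mul_inverse_cancel _ hx.2]
  rfl

theorem fibreMap_injective {x₀ x : L} (hx : x ∈ f.trivDomain x₀) :
    Function.Injective (f.fibreMap x₀ x) := by
  have hs : Function.Surjective (f.fibreMap x₀ x) := fun w => ⟨_, f.fibreMap_fibreInv hx w⟩
  have hd : Module.finrank ℝ (f.NormalSpace x) = Module.finrank ℝ (NormalModel EL EM) := by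
    rw [f.finrank_normalSpace, finrank_euclideanSpace_fin]
  exact (LinearMap.injective_iff_surjective_of_finrank_eq_finrank
    (f := (f.fibreMap x₀ x : f.NormalSpace x →ₗ[ℝ] NormalModel EL EM)) hd).2 hs

theorem fibreInv_fibreMap {x₀ x : L} (hx : x ∈ f.trivDomain x₀) (v : f.NormalSpace x) :
    f.fibreInv x₀ x (f.fibreMap x₀ x v) = v :=
  f.fibreMap_injective hx (f.fibreMap_fibreInv hx _)

/-- The local trivialization of the normal bundle around `x₀`. -/
def pretriv (x₀ : L) : Pretrivialization (NormalModel EL EM)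
    (π (NormalModel EL EM) f.NormalSpace) where
  toFun p := (p.1, f.fibreMap x₀ p.1 p.2)
  invFun p := ⟨p.1, f.fibreInv x₀ p.1 p.2⟩
  source := π (NormalModel EL EM) f.NormalSpace ⁻¹' f.trivDomain x₀
  target := f.trivDomain x₀ ×ˢ univ
  map_source' p hp := ⟨hp, trivial⟩
  map_target' p hp := hp.1
  left_inv' := by
    rintro ⟨x, v⟩ hp
    exact congrArg (TotalSpace.mk x) (f.fibreInv_fibreMap hp v)
  right_inv' := by
    rintro ⟨x, w⟩ hp
    exact congrArg (Prod.mk x) (f.fibreMap_fibreInv hp.1 w)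
  open_target := (f.isOpen_trivDomain x₀).prod isOpen_univ
  baseSet := f.trivDomain x₀
  open_baseSet := f.isOpen_trivDomain x₀
  source_eq := rfl
  target_eq := rfl
  proj_toFun _ _ := rfl

/-- The coordinate change between two local trivializations of the normal bundle. -/
def coordChange (x₀ x₁ x : L) : NormalModel EL EM →L[ℝ] NormalModel EL EM :=
  (f.toModel x₁).comp
    ((((f.triv x₀).coordChangeL ℝ (f.triv x₁) (f.toFun x) : EM →L[ℝ] EM)).comp
      ((f.projCoord x₀ x).comp ((f.ofModel x₀).comp (Ring.inverse (f.fibreEndo x₀ x)))))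

theorem contMDiffOn_coordChange (x₀ x₁ : L) :
    ContMDiffOn 𝓘(ℝ, EL) 𝓘(ℝ, NormalModel EL EM →L[ℝ] NormalModel EL EM) ∞
      (f.coordChange x₀ x₁) (f.trivDomain x₀ ∩ f.trivDomain x₁) := by
  rintro x ⟨⟨hx, hu⟩, ⟨hx', -⟩⟩
  apply ContMDiffAt.contMDiffWithinAt
  have h1 : ContMDiffAt 𝓘(ℝ, EL) 𝓘(ℝ, EM →L[ℝ] EM) ∞
      (fun y => ((f.triv x₀).coordChangeL ℝ (f.triv x₁) (f.toFun y) : EM →L[ℝ] EM)) x :=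
    (contMDiffAt_coordChangeL (n := ∞) (IB := 𝓘(ℝ, EM)) hx hx').comp x f.contMDiff.contMDiffAt
  have h2 : ContMDiffAt 𝓘(ℝ, EL) 𝓘(ℝ, NormalModel EL EM →L[ℝ] NormalModel EL EM) ∞
      (fun y => Ring.inverse (f.fibreEndo x₀ y)) x := by
    obtain ⟨u, hu⟩ := hu
    have h3 := contDiffAt_ringInverse ℝ (n := ∞) u
    rw [hu] at h3
    exact h3.contMDiffAt.comp x (f.contMDiffAt_fibreEndo x₀ hx)
  exact contMDiffAt_const.clm_comp (h1.clm_comp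
    ((f.contMDiffAt_projCoord x₀ hx).clm_comp (contMDiffAt_const.clm_comp h2)))

theorem coordChange_apply {x₀ x₁ x : L} (hx : x ∈ f.trivDomain x₀ ∩ f.trivDomain x₁)
    (w : NormalModel EL EM) :
    f.coordChange x₀ x₁ x w = (f.pretriv x₁ ⟨x, (f.pretriv x₀).symm x w⟩).2 := by
  rw [(f.pretriv x₀).mk_symm hx.1]
  change f.coordChange x₀ x₁ x w = f.fibreMap x₁ x (f.fibreInv x₀ x w)
  simp only [coordChange, fibreMap, fibreInv, fibreSection, projCoord,
    ContinuousLinearMap.comp_apply]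
  congr 1
  rw [ContinuousLinearEquiv.coe_coe, Trivialization.coordChangeL_apply _ _ ⟨hx.1.1, hx.2.1⟩]
  have h1 := fun u => (f.triv x₀).symmL_continuousLinearMapAt (R := ℝ) hx.1.1 u
  rw [← Trivialization.symmL_apply (R := ℝ) _ hx.1.1, h1, Trivialization.continuousLinearMapAt_apply,
    Trivialization.coe_linearMapAt_of_mem _ hx.2.1]

/-- The normal bundle, as a smooth vector bundle glued from the local trivializations
`pretriv`. -/
def vectorPrebundle : VectorPrebundle ℝ (NormalModel EL EM) f.NormalSpace where
  pretrivializationAtlas := Set.range f.pretriv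
  pretrivialization_linear' := by
    rintro _ ⟨x₀, rfl⟩
    exact ⟨fun x _ => (f.fibreMap x₀ x : f.NormalSpace x →ₗ[ℝ] NormalModel EL EM).isLinear⟩
  pretrivializationAt := f.pretriv
  mem_base_pretrivializationAt := f.mem_trivDomain
  pretrivialization_mem_atlas x := ⟨x, rfl⟩
  exists_coordChange := by
    rintro _ ⟨x₀, rfl⟩ _ ⟨x₁, rfl⟩
    exact ⟨f.coordChange x₀ x₁, (f.contMDiffOn_coordChange x₀ x₁).continuousOn,
      fun x hx w => f.coordChange_apply hx w⟩
  totalSpaceMk_isInducing x := by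
    let φ : f.NormalSpace x ≃ₗ[ℝ] NormalModel EL EM :=
      LinearEquiv.ofBijective (f.fibreMap x x : f.NormalSpace x →ₗ[ℝ] NormalModel EL EM)
        ⟨f.fibreMap_injective (f.mem_trivDomain x),
          fun w => ⟨_, f.fibreMap_fibreInv (f.mem_trivDomain x) w⟩⟩
    exact Topology.isInducing_const_prod.2 φ.toContinuousLinearEquiv.toHomeomorph.isInducing

instance : f.vectorPrebundle.IsContMDiff 𝓘(ℝ, EL) ∞ where
  exists_contMDiffCoordChange := by
    rintro _ ⟨x₀, rfl⟩ _ ⟨x₁, rfl⟩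
    exact ⟨f.coordChange x₀ x₁, f.contMDiffOn_coordChange x₀ x₁,
      fun x hx w => f.coordChange_apply hx w⟩

instance : TopologicalSpace (TotalSpace (NormalModel EL EM) f.NormalSpace) :=
  f.vectorPrebundle.totalSpaceTopology

instance : FiberBundle (NormalModel EL EM) f.NormalSpace :=
  f.vectorPrebundle.toFiberBundle

instance : VectorBundle ℝ (NormalModel EL EM) f.NormalSpace :=
  f.vectorPrebundle.toVectorBundle

instance : ContMDiffVectorBundle ∞ (NormalModel EL EM) f.NormalSpace 𝓘(ℝ, EL) :=
  f.vectorPrebundle.contMDiffVectorBundle 𝓘(ℝ, EL)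

/-- The total space of the normal bundle. -/
abbrev NormalBundle : Type _ := TotalSpace (NormalModel EL EM) f.NormalSpace

/-- The covariant derivative along `f` of a vector field `s` of `M` along `f`, i.e. the pullback
of the connection `cov` by `f`. In terms of the local frame `e_i` of `TM` given by the
trivialization at `f x`, if `s = ∑ i, σ i • e_i ∘ f` near `x`, then its derivative in the
direction `u` is `∑ i, dσ i (u) • e_i + σ i x • ∇_{df u} e_i`. -/
def pullbackDerivative
    (cov : CovariantDerivative 𝓘(ℝ, EM) EM (TangentSpace 𝓘(ℝ, EM) : M → Type _))
    (s : ∀ x : L, TangentSpace 𝓘(ℝ, EM) (f.toFun x)) (x : L) :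
    TangentSpace 𝓘(ℝ, EL) x →L[ℝ] TangentSpace 𝓘(ℝ, EM) (f.toFun x) :=
  ((f.triv x).symmL ℝ (f.toFun x)).comp
      (mvfderiv 𝓘(ℝ, EL) (fun y => (f.triv x ⟨f.toFun y, s y⟩).2) x) +
    (cov (FiberBundle.extend EM (s x)) (f.toFun x)).comp (f.d x)

/-- The normal connection `∇ᗮ` induced by the connection `cov` of `M`: the normal component of the
derivative in `M` of a section of the normal bundle. As for `CovariantDerivative`, the value
`normalConnection cov ξ x u` is `(∇ᗮ_u ξ) x`. -/
def normalConnection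
    (cov : CovariantDerivative 𝓘(ℝ, EM) EM (TangentSpace 𝓘(ℝ, EM) : M → Type _))
    (ξ : ∀ x : L, f.NormalSpace x) (x : L) : TangentSpace 𝓘(ℝ, EL) x →L[ℝ] f.NormalSpace x :=
  (f.proj x).comp (f.pullbackDerivative cov (fun y => f.incl y (ξ y)) x)

end IsometricImmersion

end Bundle

section LeviCivita

variable {E : Type*} [NormedAddCommGroup E] [NormedSpace ℝ E]
  {H : Type*} [TopologicalSpace H] {I : ModelWithCorners ℝ E H}
  {N : Type*} [TopologicalSpace N] [ChartedSpace H N] [IsManifold I ∞ N]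

/-- `cov` is the Levi-Civita connection of the Riemannian metric `g`: it is smooth, torsion free,
and compatible with `g`. -/
structure IsLeviCivita (g : ∀ x : N, TangentSpace I x → TangentSpace I x → ℝ)
    (cov : CovariantDerivative I E (TangentSpace I : N → Type _)) : Prop where
  smooth : CovariantDerivative.ContMDiffCovariantDerivative cov ∞
  torsion_free : ∀ (X Y : ∀ x : N, TangentSpace I x) (x : N),
    MDifferentiableAt I I.tangent (fun y => (⟨y, X y⟩ : TangentBundle I N)) x →
    MDifferentiableAt I I.tangent (fun y => (⟨y, Y y⟩ : TangentBundle I N)) x →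
    cov Y x (X x) - cov X x (Y x) = VectorField.mlieBracket I X Y x
  metric : ∀ (Y Z : ∀ x : N, TangentSpace I x) (x : N) (u : TangentSpace I x),
    MDifferentiableAt I I.tangent (fun y => (⟨y, Y y⟩ : TangentBundle I N)) x →
    MDifferentiableAt I I.tangent (fun y => (⟨y, Z y⟩ : TangentBundle I N)) x →
    mvfderiv I (fun y => g y (Y y) (Z y)) x u = g x (cov Y x u) (Z x) + g x (Y x) (cov Z x u)

/-- A submanifold with underlying set `S` and tangent spaces `T n`, for `n ∈ S`, is totally
geodesic with respect to the Levi-Civita connection `cov` of the ambient manifold: its second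
fundamental form vanishes, i.e. the derivative of a vector field tangent to the submanifold in a
direction tangent to the submanifold is tangent to the submanifold. -/
def IsTotallyGeodesic (cov : CovariantDerivative I E (TangentSpace I : N → Type _))
    (S : Set N) (T : ∀ n : N, Submodule ℝ (TangentSpace I n)) : Prop :=
  ∀ n ∈ S, ∀ a ∈ T n, ∀ B : (∀ m : N, TangentSpace I m),
    MDifferentiableAt I I.tangent (fun m => (⟨m, B m⟩ : TangentBundle I N)) n →
    (∀ᶠ m in 𝓝[S] n, B m ∈ T m) → cov B n a ∈ T n

end LeviCivita

section TotalSpaceGeometry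

variable
  {E : Type*} [NormedAddCommGroup E] [NormedSpace ℝ E] [FiniteDimensional ℝ E]
  {B : Type*} [TopologicalSpace B] [ChartedSpace E B] [IsManifold 𝓘(ℝ, E) ∞ B]
  {F : Type*} [NormedAddCommGroup F] [NormedSpace ℝ F]
  {V : B → Type*} [TopologicalSpace (TotalSpace F V)]
  [∀ x, NormedAddCommGroup (V x)] [∀ x, InnerProductSpace ℝ (V x)] [FiberBundle F V]

/-- The differential of the bundle projection `π`. -/
def dProj (θ : TotalSpace F V) :
    TangentSpace (𝓘(ℝ, E).prod 𝓘(ℝ, F)) θ →L[ℝ] TangentSpace 𝓘(ℝ, E) θ.proj :=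
  mfderiv (𝓘(ℝ, E).prod 𝓘(ℝ, F)) 𝓘(ℝ, E) (TotalSpace.proj : TotalSpace F V → B) θ

variable (E) in
/-- The vertical lift to `θ` of a vector `w` of the same fibre: the velocity at `t = 0` of the
curve `t ↦ θ + t w`. -/
def vLift (θ : TotalSpace F V) (w : V θ.proj) : TangentSpace (𝓘(ℝ, E).prod 𝓘(ℝ, F)) θ :=
  mfderiv 𝓘(ℝ, ℝ) (𝓘(ℝ, E).prod 𝓘(ℝ, F))
    (fun t : ℝ => (⟨θ.proj, θ.2 + t • w⟩ : TotalSpace F V)) 0 (1 : ℝ)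

/-- The canonical vertical vector field `Θ`. -/
def canonicalField (θ : TotalSpace F V) : TangentSpace (𝓘(ℝ, E).prod 𝓘(ℝ, F)) θ :=
  vLift E θ θ.2

section Connection

variable (D : (∀ x, V x) → ∀ x, TangentSpace 𝓘(ℝ, E) x →L[ℝ] V x)

/-- The horizontal lift to `θ` of a tangent vector `u` of the base, with respect to the connection
`D`: it is `ξ_* u - (D_u ξ)^v` for any local section `ξ` through `θ` (here the one which is
constant in the preferred trivialization). -/
def hLift (θ : TotalSpace F V) (u : TangentSpace 𝓘(ℝ, E) θ.proj) :
    TangentSpace (𝓘(ℝ, E).prod 𝓘(ℝ, F)) θ :=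
  let ξ : ∀ x, V x := FiberBundle.extend F θ.2
  let ξu : TangentSpace (𝓘(ℝ, E).prod 𝓘(ℝ, F)) θ :=
    mfderiv 𝓘(ℝ, E) (𝓘(ℝ, E).prod 𝓘(ℝ, F)) (fun x => (⟨x, ξ x⟩ : TotalSpace F V)) θ.proj u
  ξu - vLift E θ (D ξ θ.proj u)

/-- The connection map `K`: the vertical part `A - (π_* A)^h` of `A`, identified with a vector of
the fibre by means of the vertical lift. -/
def connectionMap (θ : TotalSpace F V) (A : TangentSpace (𝓘(ℝ, E).prod 𝓘(ℝ, F)) θ) :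
    V θ.proj :=
  Function.invFun (vLift E θ) (A - hLift D θ (dProj θ A))

/-- The curvature tensor `R(u, v) w = D_u D_v w - D_v D_u w - D_[u, v] w` of the connection `D` at
`x` (the vectors are extended to local fields, of which the result is independent). -/
def curvature (x : B) (u v : TangentSpace 𝓘(ℝ, E) x) (w : V x) : V x :=
  let X : ∀ y : B, TangentSpace 𝓘(ℝ, E) y := FiberBundle.extend E u
  let Y : ∀ y : B, TangentSpace 𝓘(ℝ, E) y := FiberBundle.extend E v
  let ξ : ∀ y : B, V y := FiberBundle.extend F w
  D (fun y => D ξ y (Y y)) x u - D (fun y => D ξ y (X y)) x v -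
    D ξ x (VectorField.mlieBracket 𝓘(ℝ, E) X Y x)

/-- The function `ω(θ) = 1 / (1 + ⟨θ, θ⟩)`. -/
def omega (θ : TotalSpace F V) : ℝ := 1 / (1 + inner ℝ θ.2 θ.2)

variable [RiemannianBundle (fun x : B => TangentSpace 𝓘(ℝ, E) x)]

/-- The adjoint `R̂` of the curvature tensor, characterized by
`⟨R̂(ξ, η) u, v⟩ = ⟨R(u, v) ξ, η⟩` for all `v`. -/
def curvatureAdjoint (x : B) (ξ η : V x) (u : TangentSpace 𝓘(ℝ, E) x) :
    TangentSpace 𝓘(ℝ, E) x :=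
  ∑ i, (inner ℝ (curvature (F := F) D x u (stdOrthonormalBasis ℝ (TangentSpace 𝓘(ℝ, E) x) i) ξ)
    η : ℝ) • stdOrthonormalBasis ℝ (TangentSpace 𝓘(ℝ, E) x) i

/-- The generalized Cheeger-Gromoll metric `h_{p,q}` on the total space. -/
def cheegerGromoll (p q : ℝ) (θ : TotalSpace F V)
    (A C : TangentSpace (𝓘(ℝ, E).prod 𝓘(ℝ, F)) θ) : ℝ :=
  inner ℝ (dProj θ A) (dProj θ C) +
    omega θ ^ p * (inner ℝ (connectionMap D θ A) (connectionMap D θ C) +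
      q * inner ℝ (connectionMap D θ A) θ.2 * inner ℝ (connectionMap D θ C) θ.2)

end Connection

end TotalSpaceGeometry

end NormalBundleGeometry

end

open NormalBundleGeometry

noncomputable section

namespace NormalBundleGeometry

set_option linter.unusedSectionVars false

/-! ### Lie brackets as commutators of derivations on vector-valued functions. -/

section Bracket

variable {E : Type*} [NormedAddCommGroup E] [NormedSpace ℝ E] [CompleteSpace E]
  {H : Type*} [TopologicalSpace H] {I : ModelWithCorners ℝ E H} [I.Boundaryless]
  {N : Type*} [TopologicalSpace N] [ChartedSpace H N] [IsManifold I 2 N]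
  {G : Type*} [NormedAddCommGroup G] [NormedSpace ℝ G]

/-! The connection of `h_{p,q}` is determined by the Koszul formula (`IsLeviCivita.koszul`), which
needs two inputs: the brackets of horizontal and vertical lifts, and the derivatives of the products
of lifts. Since a tangent vector of the total space is determined by `π_*` and `K`, and `h_{p,q}` is
nondegenerate for `q ≥ 0`, it suffices to test each formula against lifts (`eq_of_cheegerGromoll`).

The only properties of the normal connection that matter are that it is a covariant derivative,
compatible with the fibre metric, and sufficiently regular. These are collected in
`IsMetricConnection`, and the geometry is done for any vector bundle with such a connection `D`. The
brackets are `[X^h, Y^h] = [X, Y]^h - (R(X, Y)θ)^v`, `[X^h, η^v] = (D_X η)^v` and `[ξ^v, η^v] = 0`.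
They are found by letting the brackets act on functions: the chart of the base composed with `π`
detects `π_*`, and the fibrewise linear functions `θ ↦ ⟨ζ, θ⟩` detect `K`, because their derivative
along `A` is `⟨D_{π_* A} ζ, θ⟩ + ⟨ζ, K A⟩` (`mvfderiv_pairing`). Metricity of `D` also makes `⟨θ,
θ⟩`, hence `ω`, constant in horizontal directions.

With these inputs, the Koszul formula on three horizontal lifts reduces to the one of the base; with
two horizontal lifts and one vertical lift, only a curvature term or a `D`-derivative survives; with
three vertical lifts only the derivatives of `ω^p(⟨·,·⟩ + q⟨·,θ⟩⟨·,θ⟩)` remain, and solving for the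
`Θ` component produces `ν` and `μ`. The fibres are totally geodesic because `∇_{η^v} Y^h` is
horizontal and horizontal fields are orthogonal to the fibres.

It remains to show that the normal connection is such a `D` (`isMetricConnection_normalConnection`).
It is the orthogonal projection of the derivative along the immersion, and that derivative inherits
its metric property from the Levi-Civita connection of `M` (`derivAlong_metric`). -/

theorem fderiv_lieBracket {g : E → G} {V W : E → E} {z : E} (hg : ContDiffAt ℝ 2 g z)
    (hV : DifferentiableAt ℝ V z) (hW : DifferentiableAt ℝ W z) :
    fderiv ℝ g z (VectorField.lieBracket ℝ V W z) =
      fderiv ℝ (fun y => fderiv ℝ g y (W y)) z (V z) -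
        fderiv ℝ (fun y => fderiv ℝ g y (V y)) z (W z) := by
  have h1 : DifferentiableAt ℝ (fderiv ℝ g) z :=
    (hg.fderiv_right (m := 1) (by norm_num)).differentiableAt (by norm_num)
  have hs : IsSymmSndFDerivAt ℝ g z := hg.isSymmSndFDerivAt (by simp)
  rw [fderiv_clm_apply h1 hW, fderiv_clm_apply h1 hV]
  simp only [VectorField.lieBracket_eq, add_apply,
    ContinuousLinearMap.comp_apply, ContinuousLinearMap.flip_apply, map_sub]
  rw [hs (V z) (W z)]
  abel

/-- The bracket is defined by pulling fields back to the chart, so the identity reduces there to the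
symmetry of the second derivative. Values in a normed space `G` are allowed so that a chart of the
base can itself serve as the test function, which recovers a whole tangent vector at once. -/
theorem mvfderiv_mlieBracket {g : N → G} {X Y : ∀ y : N, TangentSpace I y} {x : N}
    (hg : ContMDiffAt I 𝓘(ℝ, G) 2 g x)
    (hX : MDifferentiableAt I I.tangent (fun y => (⟨y, X y⟩ : TangentBundle I N)) x)
    (hY : MDifferentiableAt I I.tangent (fun y => (⟨y, Y y⟩ : TangentBundle I N)) x) :
    mvfderiv I g x (VectorField.mlieBracket I X Y x) =
      mvfderiv I (fun y => mvfderiv I g y (Y y)) x (X x) -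
        mvfderiv I (fun y => mvfderiv I g y (X y)) x (Y x) := by
  let φ := extChartAt I x
  let g' : E → G := g ∘ φ.symm
  -- The expression of a field `Z` in the chart centred at `x`.
  let loc (Z : ∀ y : N, TangentSpace I y) : E → E :=
    VectorField.mpullbackWithin 𝓘(ℝ, E) I φ.symm Z (range I)
  have hr : range I = univ := I.range_eq_univ
  have hloc_diff : ∀ Z : ∀ y : N, TangentSpace I y,
      MDifferentiableAt I I.tangent (fun y => (⟨y, Z y⟩ : TangentBundle I N)) x →
      DifferentiableAt ℝ (loc Z) (φ x) := by
    intro Z hZ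
    have h1 : DifferentiableWithinAt ℝ (loc Z) (φ.symm ⁻¹' univ ∩ range I) (φ x) :=
      (mdifferentiableWithinAt_univ.2 hZ).differentiableWithinAt_mpullbackWithin_vectorField
    rwa [hr, preimage_univ, univ_inter, differentiableWithinAt_univ] at h1
  have hg' : ContDiffAt ℝ 2 g' (φ x) := by
    have h1 : ContMDiffAt 𝓘(ℝ, E) I 2 φ.symm (φ x) :=
      (contMDiffOn_extChartAt_symm x).contMDiffAt (extChartAt_target_mem_nhds x)
    exact (ContMDiffAt.comp_of_eq hg h1 (extChartAt_to_inv x)).contDiffAt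
  have hgn : ∀ᶠ z in 𝓝 (φ x), MDifferentiableAt I 𝓘(ℝ, G) g (φ.symm z) := by
    have h1 : ∀ᶠ y in 𝓝 x, MDifferentiableAt I 𝓘(ℝ, G) g y :=
      (contMDiffAt_iff_contMDiffAt_nhds (by simp)).1 hg |>.mono fun y hy => hy.mdifferentiableAt (by norm_num)
    have h2 := continuousAt_extChartAt_symm (I := I) x
    rw [ContinuousAt, extChartAt_to_inv] at h2
    exact h2.eventually h1
  have hloc : ∀ Z : ∀ y : N, TangentSpace I y, ∀ᶠ z in 𝓝 (φ x),
      mvfderiv I g (φ.symm z) (Z (φ.symm z)) = fderiv ℝ g' z (loc Z z) := by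
    intro Z
    filter_upwards [hgn, extChartAt_target_mem_nhds (I := I) x] with z hz hzt
    have h1 : MDifferentiableAt 𝓘(ℝ, E) I φ.symm z := by
      have := mdifferentiableWithinAt_extChartAt_symm (I := I) hzt
      rwa [hr, mdifferentiableWithinAt_univ] at this
    have h2 := mfderiv_comp z hz h1
    rw [mfderiv_eq_fderiv] at h2
    have h3 : (mfderiv 𝓘(ℝ, E) I φ.symm z) (loc Z z) = Z (φ.symm z) := by
      have h4 := isInvertible_mfderivWithin_extChartAt_symm (I := I) hzt
      have h5 : loc Z z = (mfderivWithin 𝓘(ℝ, E) I φ.symm (range I) z).inverse (Z (φ.symm z)) := rfl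
      rw [h5]
      have h6 : mfderiv 𝓘(ℝ, E) I φ.symm z = mfderivWithin 𝓘(ℝ, E) I φ.symm (range I) z := by
        rw [hr, mfderivWithin_univ]
      rw [h6]
      exact congrArg (fun T => T (Z (φ.symm z))) h4.self_comp_inverse
    change _ = fderiv ℝ (g ∘ φ.symm) z (loc Z z)
    rw [h2, ← h3]
    rfl
  -- The tangent space at `x` is modelled on the preferred chart at `x`, whose derivative at its own
  -- centre is the identity; hence no coordinate change appears there.
  have hpt : ∀ Z : ∀ y : N, TangentSpace I y, loc Z (φ x) = Z x := by
    intro Z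
    have h1 := mfderivWithin_range_extChartAt_symm (I := I) (x := x)
    change (mfderivWithin 𝓘(ℝ, E) I φ.symm (range I) (φ x)).inverse (Z (φ.symm (φ x))) = Z x
    rw [h1, extChartAt_to_inv]
    change (ContinuousLinearMap.id ℝ E).inverse (Z x) = Z x
    rw [ContinuousLinearMap.inverse_id]
    rfl
  have hd : ∀ f : N → G, MDifferentiableAt I 𝓘(ℝ, G) f x → ∀ v : TangentSpace I x,
      mvfderiv I f x v = fderiv ℝ (f ∘ φ.symm) (φ x) v := by
    intro f hf v
    rw [hf.mvfderiv, hr, fderivWithin_univ]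
    rfl
  have hder : ∀ Z : ∀ y : N, TangentSpace I y,
      MDifferentiableAt I I.tangent (fun y => (⟨y, Z y⟩ : TangentBundle I N)) x →
      ∀ v : TangentSpace I x, mvfderiv I (fun y => mvfderiv I g y (Z y)) x v =
        fderiv ℝ (fun z => fderiv ℝ g' z (loc Z z)) (φ x) v := by
    intro Z hZ v
    have hdiff : DifferentiableAt ℝ (fun z => fderiv ℝ g' z (loc Z z)) (φ x) :=
      ((hg'.fderiv_right (m := 1) (by norm_num)).differentiableAt (by norm_num)).clm_apply
        (hloc_diff Z hZ)
    have h1 : MDifferentiableAt I 𝓘(ℝ, G) (fun y => mvfderiv I g y (Z y)) x := by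
      have h2 : MDifferentiableAt I 𝓘(ℝ, G) ((fun z => fderiv ℝ g' z (loc Z z)) ∘ φ) x :=
        (hdiff.mdifferentiableAt).comp x (mdifferentiableAt_extChartAt (mem_chart_source H x))
      refine h2.congr_of_eventuallyEq ?_
      filter_upwards [(continuousAt_extChartAt (I := I) x).eventually (hloc Z),
        extChartAt_source_mem_nhds (I := I) x] with y hy hys
      have h3 : φ.symm (φ y) = y := φ.left_inv hys
      change mvfderiv I g (φ.symm (φ y)) (Z (φ.symm (φ y))) = _ at hy
      rwa [h3] at hy
    rw [hd _ h1]
    congr 1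
    exact Filter.EventuallyEq.fderiv_eq (hloc Z)
  rw [hder X hX, hder Y hY, hd g (hg.mdifferentiableAt (by norm_num))]
  have h1 : VectorField.mlieBracket I X Y x = VectorField.lieBracket ℝ (loc X) (loc Y) (φ x) := by
    rw [← VectorField.mlieBracketWithin_univ, VectorField.mlieBracketWithin_apply,
      mfderiv_extChartAt_self]
    change (ContinuousLinearMap.id ℝ E).inverse
      (VectorField.lieBracketWithin ℝ (loc X) (loc Y) (φ.symm ⁻¹' univ ∩ range I) (φ x)) = _
    rw [ContinuousLinearMap.inverse_id, hr, preimage_univ, univ_inter,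
      VectorField.lieBracketWithin_univ]
    rfl
  rw [h1]
  have h2 := fderiv_lieBracket hg' (hloc_diff X hX) (hloc_diff Y hY)
  rw [hpt X, hpt Y] at h2
  exact h2

end Bracket

/-! ### The Koszul formula. -/

section Koszul

variable {E : Type*} [NormedAddCommGroup E] [NormedSpace ℝ E]
  {H : Type*} [TopologicalSpace H] {I : ModelWithCorners ℝ E H}
  {N : Type*} [TopologicalSpace N] [ChartedSpace H N] [IsManifold I ∞ N]

/-- Metric compatibility expands the three derivatives and vanishing torsion the three brackets;
everything cancels except two copies of `g (∇_A B) C`. Pointwise differentiability suffices, so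
local extensions of vectors can be used as test fields. -/
theorem IsLeviCivita.koszul {g : ∀ x : N, TangentSpace I x → TangentSpace I x → ℝ}
    {cov : CovariantDerivative I E (TangentSpace I : N → Type _)} (h : IsLeviCivita g cov)
    {x : N} (hsub : ∀ a b c, g x (a - b) c = g x a c - g x b c) (hsymm : ∀ a b, g x a b = g x b a)
    {A B C : ∀ y : N, TangentSpace I y}
    (hA : MDifferentiableAt I I.tangent (fun y => (⟨y, A y⟩ : TangentBundle I N)) x)
    (hB : MDifferentiableAt I I.tangent (fun y => (⟨y, B y⟩ : TangentBundle I N)) x)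
    (hC : MDifferentiableAt I I.tangent (fun y => (⟨y, C y⟩ : TangentBundle I N)) x) :
    2 * g x (cov B x (A x)) (C x) =
      mvfderiv I (fun y => g y (B y) (C y)) x (A x) +
        mvfderiv I (fun y => g y (A y) (C y)) x (B x) -
        mvfderiv I (fun y => g y (A y) (B y)) x (C x) +
        g x (VectorField.mlieBracket I A B x) (C x) -
        g x (VectorField.mlieBracket I A C x) (B x) -
        g x (VectorField.mlieBracket I B C x) (A x) := by
  rw [h.metric B C x _ hB hC, h.metric A C x _ hA hC, h.metric A B x _ hA hB,
    ← h.torsion_free A B x hA hB, ← h.torsion_free A C x hA hC, ← h.torsion_free B C x hB hC,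
    hsub, hsub, hsub, hsymm (B x), hsymm (A x), hsymm (A x)]
  ring

end Koszul

/-! ### The splitting of the tangent spaces of the total space. -/

section VerticalHorizontal

variable
  {E : Type*} [NormedAddCommGroup E] [NormedSpace ℝ E] [FiniteDimensional ℝ E]
  {B : Type*} [TopologicalSpace B] [ChartedSpace E B] [IsManifold 𝓘(ℝ, E) ∞ B]
  {F : Type*} [NormedAddCommGroup F] [NormedSpace ℝ F] [FiniteDimensional ℝ F]
  {V : B → Type*} [TopologicalSpace (TotalSpace F V)]
  [∀ x, NormedAddCommGroup (V x)] [∀ x, InnerProductSpace ℝ (V x)] [FiberBundle F V]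
  [VectorBundle ℝ F V] [ContMDiffVectorBundle ∞ F V 𝓘(ℝ, E)]


theorem mdifferentiableAt_fibre_line (θ : TotalSpace F V) (w : V θ.proj) (t : ℝ) :
    MDifferentiableAt 𝓘(ℝ, ℝ) (𝓘(ℝ, E).prod 𝓘(ℝ, F))
      (fun t : ℝ => (⟨θ.proj, θ.2 + t • w⟩ : TotalSpace F V)) t := by
  rw [mdifferentiableAt_totalSpace]
  refine ⟨mdifferentiableAt_const, ?_⟩
  let φ := (trivializationAt F V θ.proj).continuousLinearMapAt ℝ θ.proj
  have h : (fun t : ℝ => (trivializationAt F V θ.proj ⟨θ.proj, θ.2 + t • w⟩).2) =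
      fun t : ℝ => φ θ.2 + t • φ w := by
    funext t
    rw [← map_smul, ← map_add]
    simp [φ, Trivialization.continuousLinearMapAt_apply, Trivialization.linearMapAt_apply,
      mem_baseSet_trivializationAt]
  simp only [h]
  apply DifferentiableAt.mdifferentiableAt
  fun_prop

variable {G : Type*} [NormedAddCommGroup G] [NormedSpace ℝ G]

/-- The derivative of a function in a vertical direction is its derivative along the fibre. -/
theorem mfderiv_vLift {H' E' N : Type*} [NormedAddCommGroup E'] [NormedSpace ℝ E']
    [TopologicalSpace H'] {I' : ModelWithCorners ℝ E' H'} [TopologicalSpace N] [ChartedSpace H' N]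
    {g : TotalSpace F V → N} {θ : TotalSpace F V}
    (hg : MDifferentiableAt (𝓘(ℝ, E).prod 𝓘(ℝ, F)) I' g θ) (w : V θ.proj) :
    mfderiv (𝓘(ℝ, E).prod 𝓘(ℝ, F)) I' g θ (vLift E θ w) =
      mfderiv 𝓘(ℝ, ℝ) I' (fun t : ℝ => g ⟨θ.proj, θ.2 + t • w⟩) 0 (1 : ℝ) := by
  have h0 : (⟨θ.proj, θ.2 + (0 : ℝ) • w⟩ : TotalSpace F V) = θ := by simp
  have := mfderiv_comp_apply_of_eq (0 : ℝ) hg (mdifferentiableAt_fibre_line (E := E) θ w 0) h0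
    (1 : ℝ)
  exact this.symm

theorem mvfderiv_vLift {g : TotalSpace F V → G} {θ : TotalSpace F V}
    (hg : MDifferentiableAt (𝓘(ℝ, E).prod 𝓘(ℝ, F)) 𝓘(ℝ, G) g θ) {w : V θ.proj} {c : G}
    (h : HasDerivAt (fun t : ℝ => g ⟨θ.proj, θ.2 + t • w⟩) c 0) :
    mvfderiv (𝓘(ℝ, E).prod 𝓘(ℝ, F)) g θ (vLift E θ w) = c := by
  have h1 := mfderiv_vLift hg w
  rw [mfderiv_eq_fderiv, h.hasFDerivAt.fderiv] at h1
  refine Eq.trans h1 ?_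
  change (ContinuousLinearMap.toSpanSingleton ℝ c) 1 = c
  simp

/-- The derivative of a function in the direction of the image of a tangent vector by a section. -/
theorem mvfderiv_section {g : TotalSpace F V → G} {θ : TotalSpace F V} {ξ : ∀ x, V x}
    (hξ : ξ θ.proj = θ.2)
    (hg : MDifferentiableAt (𝓘(ℝ, E).prod 𝓘(ℝ, F)) 𝓘(ℝ, G) g θ)
    (hd : MDifferentiableAt 𝓘(ℝ, E) (𝓘(ℝ, E).prod 𝓘(ℝ, F))
      (fun x => (⟨x, ξ x⟩ : TotalSpace F V)) θ.proj) (u : TangentSpace 𝓘(ℝ, E) θ.proj) :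
    mvfderiv (𝓘(ℝ, E).prod 𝓘(ℝ, F)) g θ
      (mfderiv 𝓘(ℝ, E) (𝓘(ℝ, E).prod 𝓘(ℝ, F)) (fun x => (⟨x, ξ x⟩ : TotalSpace F V)) θ.proj u) =
      mvfderiv 𝓘(ℝ, E) (fun x => g ⟨x, ξ x⟩) θ.proj u := by
  have h0 : (⟨θ.proj, ξ θ.proj⟩ : TotalSpace F V) = θ := by rw [hξ]
  have := mfderiv_comp_apply_of_eq θ.proj hg hd h0 u
  exact this.symm

theorem dProj_vLift (θ : TotalSpace F V) (w : V θ.proj) : dProj θ (vLift E θ w) = 0 := by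
  have h := mfderiv_vLift (mdifferentiableAt_proj (IB := 𝓘(ℝ, E)) V (p := θ)) w
  refine Eq.trans h ?_
  change mfderiv 𝓘(ℝ, ℝ) 𝓘(ℝ, E) (fun _ => θ.proj) 0 (1 : ℝ) = 0
  rw [mfderiv_const]
  rfl

theorem dProj_section {θ : TotalSpace F V} {ξ : ∀ x, V x} (hξ : ξ θ.proj = θ.2)
    (hd : MDifferentiableAt 𝓘(ℝ, E) (𝓘(ℝ, E).prod 𝓘(ℝ, F))
      (fun x => (⟨x, ξ x⟩ : TotalSpace F V)) θ.proj) (u : TangentSpace 𝓘(ℝ, E) θ.proj) :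
    dProj θ (mfderiv 𝓘(ℝ, E) (𝓘(ℝ, E).prod 𝓘(ℝ, F)) (fun x => (⟨x, ξ x⟩ : TotalSpace F V))
      θ.proj u) = u := by
  have h0 : (⟨θ.proj, ξ θ.proj⟩ : TotalSpace F V) = θ := by rw [hξ]
  have := mfderiv_comp_apply_of_eq θ.proj (mdifferentiableAt_proj (IB := 𝓘(ℝ, E)) V (p := θ)) hd
    h0 u
  refine this.symm.trans ?_
  change mfderiv 𝓘(ℝ, E) 𝓘(ℝ, E) id θ.proj u = u
  rw [mfderiv_id]
  rfl

/-- The fibre coordinate given by the preferred trivialization at `x₀`. -/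
def fibreCoord (x₀ : B) (θ : TotalSpace F V) : F := (trivializationAt F V x₀ θ).2

/-- The restriction of `fibreCoord` to a fibre. -/
def fibreIso (x₀ : B) {x : B} (hx : x ∈ (trivializationAt F V x₀).baseSet) : V x ≃L[ℝ] F :=
  (trivializationAt F V x₀).continuousLinearEquivAt ℝ x hx

theorem fibreIso_apply {x₀ x : B} (hx : x ∈ (trivializationAt F V x₀).baseSet) (v : V x) :
    fibreIso x₀ hx v = fibreCoord x₀ (⟨x, v⟩ : TotalSpace F V) := rfl

theorem extend_eq_fibreIso_symm {x₀ x : B} (hx : x ∈ (trivializationAt F V x₀).baseSet) (v : V x₀) :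
    FiberBundle.extend F v x = (fibreIso x₀ hx).symm (fibreCoord x₀ (⟨x₀, v⟩ : TotalSpace F V)) :=
  rfl

theorem fibreCoord_extend {x₀ x : B} (hx : x ∈ (trivializationAt F V x₀).baseSet) (v : V x₀) :
    fibreCoord x₀ (⟨x, FiberBundle.extend F v x⟩ : TotalSpace F V) =
      fibreCoord x₀ (⟨x₀, v⟩ : TotalSpace F V) := by
  rw [extend_eq_fibreIso_symm hx, ← fibreIso_apply hx]
  simp

theorem eventually_mem_baseSet (x₀ : B) :
    ∀ᶠ x in 𝓝 x₀, x ∈ (trivializationAt F V x₀).baseSet :=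
  (trivializationAt F V x₀).open_baseSet.mem_nhds (mem_baseSet_trivializationAt F V x₀)

theorem mdifferentiableAt_fibreCoord {x₀ : B} {θ : TotalSpace F V}
    (hθ : θ.proj ∈ (trivializationAt F V x₀).baseSet) :
    MDifferentiableAt (𝓘(ℝ, E).prod 𝓘(ℝ, F)) 𝓘(ℝ, F) (fibreCoord x₀) θ :=
  (((trivializationAt F V x₀).mdifferentiableAt_totalSpace_iff 𝓘(ℝ, E) (fun θ => θ)
    ((trivializationAt F V x₀).mem_source.2 hθ)).1 mdifferentiableAt_id).2

theorem mvfderiv_fibreCoord_vLift {x₀ : B} {θ : TotalSpace F V}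
    (hθ : θ.proj ∈ (trivializationAt F V x₀).baseSet) (w : V θ.proj) :
    mvfderiv (𝓘(ℝ, E).prod 𝓘(ℝ, F)) (fibreCoord x₀) θ (vLift E θ w) = fibreIso x₀ hθ w := by
  apply mvfderiv_vLift (mdifferentiableAt_fibreCoord hθ)
  have h : (fun t : ℝ => fibreCoord x₀ (⟨θ.proj, θ.2 + t • w⟩ : TotalSpace F V)) =
      fun t : ℝ => fibreIso x₀ hθ θ.2 + t • fibreIso x₀ hθ w := by
    funext t
    rw [← fibreIso_apply hθ, map_add, map_smul]
  rw [h]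
  simpa using ((hasDerivAt_id (0 : ℝ)).smul_const (fibreIso x₀ hθ w)).const_add
    (fibreIso x₀ hθ θ.2)

/-- The derivative of the preferred chart of the total space. -/
theorem mvfderiv_extChartAt_totalSpace {θ₀ θ : TotalSpace F V}
    (hθ : θ ∈ (chartAt (ModelProd E F) θ₀).source) 
    (A : TangentSpace (𝓘(ℝ, E).prod 𝓘(ℝ, F)) θ) :
    mvfderiv (𝓘(ℝ, E).prod 𝓘(ℝ, F)) (extChartAt (𝓘(ℝ, E).prod 𝓘(ℝ, F)) θ₀) θ A =
      (mvfderiv 𝓘(ℝ, E) (extChartAt 𝓘(ℝ, E) θ₀.proj) θ.proj (dProj θ A),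
        mvfderiv (𝓘(ℝ, E).prod 𝓘(ℝ, F)) (fibreCoord θ₀.proj) θ A) := by
  have hs : θ.proj ∈ (trivializationAt F V θ₀.proj).baseSet ∧
      θ.proj ∈ (chartAt E θ₀.proj).source := by
    rw [FiberBundle.chartedSpace_chartAt] at hθ
    simp only [mfld_simps] at hθ
    have h1 := (Trivialization.mem_source _).1 hθ.1
    refine ⟨h1, ?_⟩
    have h2 := hθ.2
    rwa [Trivialization.coe_fst' _ h1] at h2
  have h1 : MDifferentiableAt 𝓘(ℝ, E) 𝓘(ℝ, E) (extChartAt 𝓘(ℝ, E) θ₀.proj) θ.proj :=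
    mdifferentiableAt_extChartAt hs.2
  have h2 := h1.comp θ (mdifferentiableAt_proj V)
  have h3 := mdifferentiableAt_fibreCoord (E := E) hs.1
  have h4 : (extChartAt (𝓘(ℝ, E).prod 𝓘(ℝ, F)) θ₀) =ᶠ[𝓝 θ]
      fun θ => (extChartAt 𝓘(ℝ, E) θ₀.proj θ.proj, fibreCoord θ₀.proj θ) := by
    have h5 : ∀ᶠ y : TotalSpace F V in 𝓝 θ, y.proj ∈ (trivializationAt F V θ₀.proj).baseSet :=
      (FiberBundle.continuous_proj F V).continuousAt.eventually_mem
        ((trivializationAt F V θ₀.proj).open_baseSet.mem_nhds hs.1)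
    filter_upwards [h5] with y hy
    rw [FiberBundle.extChartAt]
    simp only [mfld_simps]
    rw [Trivialization.coe_fst' _ hy]
    rfl
  have h6 : mvfderiv (𝓘(ℝ, E).prod 𝓘(ℝ, F)) (extChartAt (𝓘(ℝ, E).prod 𝓘(ℝ, F)) θ₀) θ =
    mvfderiv (𝓘(ℝ, E).prod 𝓘(ℝ, F))
      (fun θ => (extChartAt 𝓘(ℝ, E) θ₀.proj θ.proj, fibreCoord θ₀.proj θ)) θ := h4.mfderiv_eq
  rw [h6]
  have h7 : MDifferentiableAt (𝓘(ℝ, E).prod 𝓘(ℝ, F)) 𝓘(ℝ, E × F)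
    (fun θ => (extChartAt 𝓘(ℝ, E) θ₀.proj θ.proj, fibreCoord θ₀.proj θ)) θ := h2.prodMk_space h3
  have h8 := ((ContinuousLinearMap.fst ℝ E F).hasMFDerivAt.comp θ h7.hasMFDerivAt).mfderiv
  have h9 := ((ContinuousLinearMap.snd ℝ E F).hasMFDerivAt.comp θ h7.hasMFDerivAt).mfderiv
  have h10 := mfderiv_comp_apply θ h1 (mdifferentiableAt_proj V) A
  refine Prod.ext ?_ ?_
  · exact (congrArg (fun T => T A) h8).symm.trans h10
  · exact (congrArg (fun T => T A) h9).symm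

/-- The preferred chart at `θ` is the pair of the chart of the base after `π` and the fibre
coordinate, and its derivative at `θ` is the identity; the two components therefore determine a
vector. -/
theorem tangent_ext {θ : TotalSpace F V} {A C : TangentSpace (𝓘(ℝ, E).prod 𝓘(ℝ, F)) θ}
    (h1 : dProj θ A = dProj θ C)
    (h2 : mvfderiv (𝓘(ℝ, E).prod 𝓘(ℝ, F)) (fibreCoord θ.proj) θ A =
      mvfderiv (𝓘(ℝ, E).prod 𝓘(ℝ, F)) (fibreCoord θ.proj) θ C) : A = C := by
  have h := fun A => mvfderiv_extChartAt_totalSpace (E := E) (mem_chart_source (ModelProd E F) θ) A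
  have h3 : mvfderiv (𝓘(ℝ, E).prod 𝓘(ℝ, F)) (extChartAt (𝓘(ℝ, E).prod 𝓘(ℝ, F)) θ) θ A =
      mvfderiv (𝓘(ℝ, E).prod 𝓘(ℝ, F)) (extChartAt (𝓘(ℝ, E).prod 𝓘(ℝ, F)) θ) θ C := by
    rw [h, h, h1, h2]
  have h4 : mfderiv (𝓘(ℝ, E).prod 𝓘(ℝ, F)) 𝓘(ℝ, E × F)
      (extChartAt (𝓘(ℝ, E).prod 𝓘(ℝ, F)) θ) θ = ContinuousLinearMap.id ℝ _ :=
    mfderiv_extChartAt_self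
  have h5 : ∀ A : TangentSpace (𝓘(ℝ, E).prod 𝓘(ℝ, F)) θ,
      mvfderiv (𝓘(ℝ, E).prod 𝓘(ℝ, F)) (extChartAt (𝓘(ℝ, E).prod 𝓘(ℝ, F)) θ) θ A = A :=
    fun A => congrArg (fun T => T A) h4
  rw [← h5 A, ← h5 C, h3]

theorem vLift_smul (θ : TotalSpace F V) (c : ℝ) (w : V θ.proj) :
    vLift E θ (c • w) = c • vLift E θ w := by
  apply tangent_ext
  · simp [dProj_vLift]
  · simp [mvfderiv_fibreCoord_vLift (mem_baseSet_trivializationAt F V θ.proj)]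

theorem vLift_zero (θ : TotalSpace F V) : vLift E θ (0 : V θ.proj) = 0 := by
  simpa using vLift_smul (E := E) θ 0 0

theorem vLift_injective (θ : TotalSpace F V) : Function.Injective (vLift E θ) := by
  intro w w' h
  have h1 := mvfderiv_fibreCoord_vLift (E := E) (mem_baseSet_trivializationAt F V θ.proj) w
  rw [h, mvfderiv_fibreCoord_vLift (mem_baseSet_trivializationAt F V θ.proj)] at h1
  exact ((fibreIso θ.proj _).injective h1).symm

variable (D : (∀ x, V x) → ∀ x, TangentSpace 𝓘(ℝ, E) x →L[ℝ] V x)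

theorem mdifferentiableAt_extend_section {x : B} (v : V x) :
    MDifferentiableAt 𝓘(ℝ, E) (𝓘(ℝ, E).prod 𝓘(ℝ, F))
      (fun y => (⟨y, FiberBundle.extend F v y⟩ : TotalSpace F V)) x :=
  (FiberBundle.contMDiffAt_extend (k := 1) 𝓘(ℝ, E) F v).mdifferentiableAt one_ne_zero

theorem dProj_hLift (θ : TotalSpace F V) (u : TangentSpace 𝓘(ℝ, E) θ.proj) :
    dProj θ (hLift D θ u) = u := by
  have h := dProj_section (E := E) (FiberBundle.extend_apply_self F θ.2)
    (mdifferentiableAt_extend_section θ.2) u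
  rw [hLift]
  refine (map_sub (dProj θ) _ _).trans ?_
  rw [dProj_vLift, sub_zero]
  exact h

theorem mvfderiv_hLift {g : TotalSpace F V → G} {θ : TotalSpace F V}
    (hg : MDifferentiableAt (𝓘(ℝ, E).prod 𝓘(ℝ, F)) 𝓘(ℝ, G) g θ) 
    (u : TangentSpace 𝓘(ℝ, E) θ.proj) :
    mvfderiv (𝓘(ℝ, E).prod 𝓘(ℝ, F)) g θ (hLift D θ u) =
      mvfderiv 𝓘(ℝ, E) (fun x => g ⟨x, FiberBundle.extend F θ.2 x⟩) θ.proj u -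
      mvfderiv (𝓘(ℝ, E).prod 𝓘(ℝ, F)) g θ (vLift E θ (D (FiberBundle.extend F θ.2) θ.proj u)) := by
  rw [← mvfderiv_section (FiberBundle.extend_apply_self F θ.2) hg
    (mdifferentiableAt_extend_section θ.2) u]
  exact map_sub (mvfderiv (𝓘(ℝ, E).prod 𝓘(ℝ, F)) g θ) _ _

/-- The section used to define `hLift` has constant fibre coordinate near `θ.proj`, so only the
vertical correction contributes. -/
theorem mvfderiv_fibreCoord_hLift (θ : TotalSpace F V) (u : TangentSpace 𝓘(ℝ, E) θ.proj) :
    mvfderiv (𝓘(ℝ, E).prod 𝓘(ℝ, F)) (fibreCoord θ.proj) θ (hLift D θ u) =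
      -fibreIso θ.proj (mem_baseSet_trivializationAt F V θ.proj)
        (D (FiberBundle.extend F θ.2) θ.proj u) := by
  have hx := mem_baseSet_trivializationAt F V θ.proj
  rw [mvfderiv_hLift D (mdifferentiableAt_fibreCoord hx), mvfderiv_fibreCoord_vLift hx]
  have h1 : (fun x => fibreCoord θ.proj (⟨x, FiberBundle.extend F θ.2 x⟩ : TotalSpace F V))
      =ᶠ[𝓝 θ.proj] fun _ => fibreCoord θ.proj θ := by
    filter_upwards [eventually_mem_baseSet (F := F) (V := V) θ.proj] with x hx
    exact fibreCoord_extend hx θ.2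
  have h2 : mvfderiv 𝓘(ℝ, E)
      (fun x => fibreCoord θ.proj (⟨x, FiberBundle.extend F θ.2 x⟩ : TotalSpace F V)) θ.proj =
      mvfderiv 𝓘(ℝ, E) (fun _ => fibreCoord θ.proj θ) θ.proj := h1.mfderiv_eq
  rw [h2, mvfderiv_const]
  simp

/-- The value of `Function.invFun` is meaningful only once `A - (π_* A)^h` is known to be a vertical
lift. Its preimage can be written down in coordinates, and this expression makes the linearity of
`K` visible. -/
theorem connectionMap_eq (θ : TotalSpace F V) (A : TangentSpace (𝓘(ℝ, E).prod 𝓘(ℝ, F)) θ) :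
    connectionMap D θ A = (fibreIso θ.proj (mem_baseSet_trivializationAt F V θ.proj)).symm
      (mvfderiv (𝓘(ℝ, E).prod 𝓘(ℝ, F)) (fibreCoord θ.proj) θ A) +
        D (FiberBundle.extend F θ.2) θ.proj (dProj θ A) := by
  have hx := mem_baseSet_trivializationAt F V θ.proj
  have h : A - hLift D θ (dProj θ A) = vLift E θ
      ((fibreIso θ.proj hx).symm (mvfderiv (𝓘(ℝ, E).prod 𝓘(ℝ, F)) (fibreCoord θ.proj) θ A) +
        D (FiberBundle.extend F θ.2) θ.proj (dProj θ A)) := by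
    apply tangent_ext
    · rw [map_sub, dProj_hLift, dProj_vLift, sub_self]
    · rw [map_sub, mvfderiv_fibreCoord_hLift, mvfderiv_fibreCoord_vLift hx, map_add]
      simp
  rw [connectionMap, h]
  exact Function.leftInverse_invFun (vLift_injective θ) _

theorem hLift_add_vLift (θ : TotalSpace F V) (A : TangentSpace (𝓘(ℝ, E).prod 𝓘(ℝ, F)) θ) :
    hLift D θ (dProj θ A) + vLift E θ (connectionMap D θ A) = A := by
  have hx := mem_baseSet_trivializationAt F V θ.proj
  apply tangent_ext
  · rw [map_add, dProj_hLift, dProj_vLift, add_zero]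
  · rw [map_add, mvfderiv_fibreCoord_hLift, mvfderiv_fibreCoord_vLift hx, connectionMap_eq, map_add]
    simp

theorem connectionMap_vLift (θ : TotalSpace F V) (w : V θ.proj) :
    connectionMap D θ (vLift E θ w) = w := by
  rw [connectionMap_eq, dProj_vLift,
    mvfderiv_fibreCoord_vLift (mem_baseSet_trivializationAt F V θ.proj)]
  simp

theorem connectionMap_hLift (θ : TotalSpace F V) (u : TangentSpace 𝓘(ℝ, E) θ.proj) :
    connectionMap D θ (hLift D θ u) = 0 := by
  rw [connectionMap_eq, dProj_hLift, mvfderiv_fibreCoord_hLift]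
  simp

theorem connectionMap_add (θ : TotalSpace F V) (A C : TangentSpace (𝓘(ℝ, E).prod 𝓘(ℝ, F)) θ) :
    connectionMap D θ (A + C) = connectionMap D θ A + connectionMap D θ C := by
  simp only [connectionMap_eq, map_add]
  abel

theorem connectionMap_smul (θ : TotalSpace F V) (c : ℝ)
    (A : TangentSpace (𝓘(ℝ, E).prod 𝓘(ℝ, F)) θ) :
    connectionMap D θ (c • A) = c • connectionMap D θ A := by
  simp only [connectionMap_eq, map_smul, smul_add]

theorem connectionMap_sub (θ : TotalSpace F V) (A C : TangentSpace (𝓘(ℝ, E).prod 𝓘(ℝ, F)) θ) :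
    connectionMap D θ (A - C) = connectionMap D θ A - connectionMap D θ C := by
  simp only [connectionMap_eq, map_sub]
  abel

theorem eq_of_dProj_connectionMap {θ : TotalSpace F V}
    {A C : TangentSpace (𝓘(ℝ, E).prod 𝓘(ℝ, F)) θ} (h1 : dProj θ A = dProj θ C)
    (h2 : connectionMap D θ A = connectionMap D θ C) : A = C := by
  rw [← hLift_add_vLift D θ A, ← hLift_add_vLift D θ C, h1, h2]

end VerticalHorizontal

/-! ### Metric connections: test functions on the total space and regularity of lifts. -/

section MetricConnection

variable
  {E : Type*} [NormedAddCommGroup E] [NormedSpace ℝ E] [FiniteDimensional ℝ E]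
  {B : Type*} [TopologicalSpace B] [ChartedSpace E B] [IsManifold 𝓘(ℝ, E) ∞ B]
  {F : Type*} [NormedAddCommGroup F] [NormedSpace ℝ F] [FiniteDimensional ℝ F]
  {V : B → Type*} [TopologicalSpace (TotalSpace F V)]
  [∀ x, NormedAddCommGroup (V x)] [∀ x, InnerProductSpace ℝ (V x)] [FiberBundle F V]
  [VectorBundle ℝ F V] [ContMDiffVectorBundle ∞ F V 𝓘(ℝ, E)]


/-- `D` is a metric connection, whose values on the local sections which are constant in a
preferred trivialization are differentiable. -/
structure IsMetricConnection (D : (∀ x, V x) → ∀ x, TangentSpace 𝓘(ℝ, E) x →L[ℝ] V x) :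
    Prop where
  isCovariantDerivative : IsCovariantDerivativeOn F D univ
  metric : ∀ (ξ η : ∀ x, V x) (x : B) (u : TangentSpace 𝓘(ℝ, E) x),
    MDifferentiableAt 𝓘(ℝ, E) (𝓘(ℝ, E).prod 𝓘(ℝ, F)) (fun y => (⟨y, ξ y⟩ : TotalSpace F V)) x →
    MDifferentiableAt 𝓘(ℝ, E) (𝓘(ℝ, E).prod 𝓘(ℝ, F)) (fun y => (⟨y, η y⟩ : TotalSpace F V)) x →
    mvfderiv 𝓘(ℝ, E) (fun y => (inner ℝ (ξ y) (η y) : ℝ)) x u =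
      inner ℝ (D ξ x u) (η x) + inner ℝ (ξ x) (D η x u)
  smooth : ∀ (x : B) (w : V x) (X : ∀ y : B, TangentSpace 𝓘(ℝ, E) y),
    MDifferentiableAt 𝓘(ℝ, E) 𝓘(ℝ, E).tangent (fun y => (⟨y, X y⟩ : TangentBundle 𝓘(ℝ, E) B)) x →
    MDifferentiableAt 𝓘(ℝ, E) (𝓘(ℝ, E).prod 𝓘(ℝ, F))
      (fun y => (⟨y, D (FiberBundle.extend F w) y (X y)⟩ : TotalSpace F V)) x

variable [IsContMDiffRiemannianBundle 𝓘(ℝ, E) ∞ F V]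
  {D : (∀ x, V x) → ∀ x, TangentSpace 𝓘(ℝ, E) x →L[ℝ] V x}
  {G : Type*} [NormedAddCommGroup G] [NormedSpace ℝ G]

theorem eventually_contMDiffAt_extend {x : B} (v : V x) :
    ∀ᶠ y in 𝓝 x, ContMDiffAt 𝓘(ℝ, E) (𝓘(ℝ, E).prod 𝓘(ℝ, F)) ∞
      (fun y => (⟨y, FiberBundle.extend F v y⟩ : TotalSpace F V)) y := by
  obtain ⟨s, hs, h⟩ := FiberBundle.exists_contMDiffOn_extend (k := ∞) 𝓘(ℝ, E) F v
  filter_upwards [eventually_eventually_nhds.2 hs] with y hy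
  exact h.contMDiffAt hy

theorem eventually_mdifferentiableAt_extend {x : B} (v : V x) :
    ∀ᶠ y in 𝓝 x, MDifferentiableAt 𝓘(ℝ, E) (𝓘(ℝ, E).prod 𝓘(ℝ, F))
      (fun y => (⟨y, FiberBundle.extend F v y⟩ : TotalSpace F V)) y :=
  (eventually_contMDiffAt_extend v).mono fun _ h => h.mdifferentiableAt (by simp)

theorem eventually_proj {p : B → Prop} {θ : TotalSpace F V} (h : ∀ᶠ y in 𝓝 θ.proj, p y) :
    ∀ᶠ θ' in 𝓝 θ, p θ'.proj :=
  (FiberBundle.continuous_proj F V).continuousAt.eventually h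

theorem mdifferentiableAt_comp_proj {H' E' N : Type*} [NormedAddCommGroup E'] [NormedSpace ℝ E']
    [TopologicalSpace H'] {I' : ModelWithCorners ℝ E' H'} [TopologicalSpace N] [ChartedSpace H' N]
    {g : B → N} {θ : TotalSpace F V} (hg : MDifferentiableAt 𝓘(ℝ, E) I' g θ.proj) :
    MDifferentiableAt (𝓘(ℝ, E).prod 𝓘(ℝ, F)) I' (fun θ' : TotalSpace F V => g θ'.proj) θ :=
  hg.comp θ (mdifferentiableAt_proj V)

theorem mvfderiv_comp_proj {g : B → G} {θ : TotalSpace F V}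
    (hg : MDifferentiableAt 𝓘(ℝ, E) 𝓘(ℝ, G) g θ.proj)
    (A : TangentSpace (𝓘(ℝ, E).prod 𝓘(ℝ, F)) θ) :
    mvfderiv (𝓘(ℝ, E).prod 𝓘(ℝ, F)) (fun θ' : TotalSpace F V => g θ'.proj) θ A =
      mvfderiv 𝓘(ℝ, E) g θ.proj (dProj θ A) :=
  mfderiv_comp_apply θ hg (mdifferentiableAt_proj V) A

/-- The function on the total space which pairs with a section. -/
def pairing (ζ : ∀ x, V x) (θ : TotalSpace F V) : ℝ := inner ℝ (ζ θ.proj) θ.2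

theorem mdifferentiableAt_pairing {ζ : ∀ x, V x} {θ : TotalSpace F V}
    (hζ : MDifferentiableAt 𝓘(ℝ, E) (𝓘(ℝ, E).prod 𝓘(ℝ, F))
      (fun y => (⟨y, ζ y⟩ : TotalSpace F V)) θ.proj) :
    MDifferentiableAt (𝓘(ℝ, E).prod 𝓘(ℝ, F)) 𝓘(ℝ, ℝ) (pairing (F := F) ζ) θ :=
  MDifferentiableAt.inner_bundle (b := fun θ : TotalSpace F V => θ.proj)
    (v := fun θ => ζ θ.proj) (w := fun θ => θ.2)
    (mdifferentiableAt_comp_proj hζ) mdifferentiableAt_id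

theorem contMDiffAt_pairing {ζ : ∀ x, V x} {θ : TotalSpace F V}
    (hζ : ContMDiffAt 𝓘(ℝ, E) (𝓘(ℝ, E).prod 𝓘(ℝ, F)) ∞
      (fun y => (⟨y, ζ y⟩ : TotalSpace F V)) θ.proj) :
    ContMDiffAt (𝓘(ℝ, E).prod 𝓘(ℝ, F)) 𝓘(ℝ, ℝ) ∞ (pairing (F := F) ζ) θ :=
  ContMDiffAt.inner_bundle (b := fun θ : TotalSpace F V => θ.proj)
    (v := fun θ => ζ θ.proj) (w := fun θ => θ.2)
    (hζ.comp θ (contMDiffAt_proj V)) contMDiffAt_id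

theorem mdifferentiableAt_inner_self (θ : TotalSpace F V) :
    MDifferentiableAt (𝓘(ℝ, E).prod 𝓘(ℝ, F)) 𝓘(ℝ, ℝ)
      (fun θ' : TotalSpace F V => (inner ℝ θ'.2 θ'.2 : ℝ)) θ :=
  MDifferentiableAt.inner_bundle (b := fun θ : TotalSpace F V => θ.proj)
    (v := fun θ => θ.2) (w := fun θ => θ.2) mdifferentiableAt_id mdifferentiableAt_id

/-- These functions are the probes for `K`. Vertically they are affine in the curve parameter.
Horizontally, differentiating `⟨ζ, ξ⟩` for the section `ξ` that defines the lift produces `⟨ζ, D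
ξ⟩`, which the vertical correction removes, leaving only the derivative of `ζ`. -/
theorem mvfderiv_pairing (hD : IsMetricConnection (F := F) D) {ζ : ∀ x, V x} {θ : TotalSpace F V}
    (hζ : MDifferentiableAt 𝓘(ℝ, E) (𝓘(ℝ, E).prod 𝓘(ℝ, F))
      (fun y => (⟨y, ζ y⟩ : TotalSpace F V)) θ.proj)
    (A : TangentSpace (𝓘(ℝ, E).prod 𝓘(ℝ, F)) θ) :
    mvfderiv (𝓘(ℝ, E).prod 𝓘(ℝ, F)) (pairing ζ) θ A =
      inner ℝ (D ζ θ.proj (dProj θ A)) θ.2 + inner ℝ (ζ θ.proj) (connectionMap D θ A) := by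
  have hv : ∀ w, mvfderiv (𝓘(ℝ, E).prod 𝓘(ℝ, F)) (pairing ζ) θ (vLift E θ w) =
      inner ℝ (ζ θ.proj) w := by
    intro w
    apply mvfderiv_vLift (mdifferentiableAt_pairing hζ)
    have h : (fun t : ℝ => pairing ζ (⟨θ.proj, θ.2 + t • w⟩ : TotalSpace F V)) =
        fun t : ℝ => (inner ℝ (ζ θ.proj) θ.2 : ℝ) + t • (inner ℝ (ζ θ.proj) w : ℝ) := by
      funext t
      simp [pairing, inner_add_right, inner_smul_right]
    rw [h]
    simpa using ((hasDerivAt_id (0 : ℝ)).smul_const (inner ℝ (ζ θ.proj) w : ℝ)).const_add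
      (inner ℝ (ζ θ.proj) θ.2 : ℝ)
  conv_lhs => rw [← hLift_add_vLift D θ A, map_add, hv, mvfderiv_hLift D
    (mdifferentiableAt_pairing hζ), hv]
  have h := hD.metric ζ (FiberBundle.extend F θ.2) θ.proj (dProj θ A) hζ
    (mdifferentiableAt_extend_section θ.2)
  rw [FiberBundle.extend_apply_self] at h
  simp only [pairing]
  rw [h]
  ring

/-- Parallel transport of a metric connection preserves lengths: the horizontal derivative vanishes
and only the `K` part of `A` enters. -/
theorem mvfderiv_inner_self (hD : IsMetricConnection (F := F) D) (θ : TotalSpace F V)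
    (A : TangentSpace (𝓘(ℝ, E).prod 𝓘(ℝ, F)) θ) :
    mvfderiv (𝓘(ℝ, E).prod 𝓘(ℝ, F)) (fun θ' : TotalSpace F V => (inner ℝ θ'.2 θ'.2 : ℝ)) θ A =
      2 * inner ℝ (connectionMap D θ A) θ.2 := by
  have hv : ∀ w, mvfderiv (𝓘(ℝ, E).prod 𝓘(ℝ, F))
      (fun θ' : TotalSpace F V => (inner ℝ θ'.2 θ'.2 : ℝ)) θ (vLift E θ w) =
      2 * inner ℝ w θ.2 := by
    intro w
    apply mvfderiv_vLift (mdifferentiableAt_inner_self θ)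
    have h1 : HasDerivAt (fun t : ℝ => θ.2 + t • w) w 0 := by
      simpa using ((hasDerivAt_id (0 : ℝ)).smul_const w).const_add θ.2
    refine (h1.inner ℝ h1).congr_deriv ?_
    simp only [zero_smul, add_zero]
    rw [real_inner_comm w]
    ring
  conv_lhs => rw [← hLift_add_vLift D θ A, map_add, hv, mvfderiv_hLift D
    (mdifferentiableAt_inner_self θ), hv]
  have h := hD.metric (FiberBundle.extend F θ.2) (FiberBundle.extend F θ.2) θ.proj (dProj θ A)
    (mdifferentiableAt_extend_section θ.2) (mdifferentiableAt_extend_section θ.2)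
  rw [FiberBundle.extend_apply_self] at h
  rw [h, real_inner_comm θ.2]
  ring

/-- This is the defining property of `K` in the theorem. As `hLift` was built from one particular
section, its validity for all sections has to be proved; testing against pairings with extended
vectors reduces it to the metric property of `D`. -/
theorem connectionMap_section (hD : IsMetricConnection (F := F) D) {ξ : ∀ x, V x}
    {θ : TotalSpace F V} (hξ : ξ θ.proj = θ.2)
    (hd : MDifferentiableAt 𝓘(ℝ, E) (𝓘(ℝ, E).prod 𝓘(ℝ, F))
      (fun x => (⟨x, ξ x⟩ : TotalSpace F V)) θ.proj) (u : TangentSpace 𝓘(ℝ, E) θ.proj) :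
    connectionMap D θ (mfderiv 𝓘(ℝ, E) (𝓘(ℝ, E).prod 𝓘(ℝ, F))
      (fun x => (⟨x, ξ x⟩ : TotalSpace F V)) θ.proj u) = D ξ θ.proj u := by
  refine ext_inner_left ℝ fun w => ?_
  have h1 : MDifferentiableAt 𝓘(ℝ, E) (𝓘(ℝ, E).prod 𝓘(ℝ, F))
      (fun y => (⟨y, FiberBundle.extend F w y⟩ : TotalSpace F V)) θ.proj :=
    mdifferentiableAt_extend_section w
  have h2 := mvfderiv_pairing hD h1 (mfderiv 𝓘(ℝ, E) (𝓘(ℝ, E).prod 𝓘(ℝ, F))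
      (fun x => (⟨x, ξ x⟩ : TotalSpace F V)) θ.proj u)
  rw [mvfderiv_section hξ (mdifferentiableAt_pairing h1) hd, dProj_section hξ hd] at h2
  have h3 := hD.metric _ ξ θ.proj u h1 hd
  rw [FiberBundle.extend_apply_self, hξ] at h3
  rw [FiberBundle.extend_apply_self] at h2
  simp only [pairing] at h2
  rw [h3] at h2
  linarith

/-- Makes the horizontal lift independent of the chosen section through `θ`. At points near a fixed
fibre it allows sections extended from that fixed fibre in place of the section attached to each
point. -/
theorem mvfderiv_hLift_of_section (hD : IsMetricConnection (F := F) D) {ξ : ∀ x, V x}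
    {g : TotalSpace F V → G} {θ : TotalSpace F V}
    (hg : MDifferentiableAt (𝓘(ℝ, E).prod 𝓘(ℝ, F)) 𝓘(ℝ, G) g θ) (hξ : ξ θ.proj = θ.2)
    (hd : MDifferentiableAt 𝓘(ℝ, E) (𝓘(ℝ, E).prod 𝓘(ℝ, F))
      (fun x => (⟨x, ξ x⟩ : TotalSpace F V)) θ.proj) (u : TangentSpace 𝓘(ℝ, E) θ.proj) :
    mvfderiv (𝓘(ℝ, E).prod 𝓘(ℝ, F)) g θ (hLift D θ u) =
      mvfderiv 𝓘(ℝ, E) (fun x => g ⟨x, ξ x⟩) θ.proj u -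
      mvfderiv (𝓘(ℝ, E).prod 𝓘(ℝ, F)) g θ (vLift E θ (D ξ θ.proj u)) := by
  let A : TangentSpace (𝓘(ℝ, E).prod 𝓘(ℝ, F)) θ := mfderiv 𝓘(ℝ, E) (𝓘(ℝ, E).prod 𝓘(ℝ, F))
      (fun x => (⟨x, ξ x⟩ : TotalSpace F V)) θ.proj u
  have hA1 : dProj θ A = u := dProj_section hξ hd u
  have hA2 : connectionMap D θ A = D ξ θ.proj u := connectionMap_section hD hξ hd u
  have hA3 : mvfderiv (𝓘(ℝ, E).prod 𝓘(ℝ, F)) g θ A =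
    mvfderiv 𝓘(ℝ, E) (fun x => g ⟨x, ξ x⟩) θ.proj u := mvfderiv_section hξ hg hd u
  rw [← hA3, ← hA2, ← map_sub]
  congr 1
  have h := hLift_add_vLift D θ A
  rw [hA1] at h
  exact eq_sub_of_add_eq h

/-- A vector field on the total space is differentiable if its coordinates are. -/
theorem mdifferentiableAt_field {A : ∀ θ : TotalSpace F V, TangentSpace (𝓘(ℝ, E).prod 𝓘(ℝ, F)) θ}
    {θ : TotalSpace F V}
    (h1 : MDifferentiableAt (𝓘(ℝ, E).prod 𝓘(ℝ, F)) 𝓘(ℝ, E) (fun θ' => 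
      mvfderiv 𝓘(ℝ, E) (extChartAt 𝓘(ℝ, E) θ.proj) θ'.proj (dProj θ' (A θ'))) θ)
    (h2 : MDifferentiableAt (𝓘(ℝ, E).prod 𝓘(ℝ, F)) 𝓘(ℝ, F) (fun θ' => 
      mvfderiv (𝓘(ℝ, E).prod 𝓘(ℝ, F)) (fibreCoord θ.proj) θ' (A θ')) θ) :
    MDifferentiableAt (𝓘(ℝ, E).prod 𝓘(ℝ, F)) (𝓘(ℝ, E).prod 𝓘(ℝ, F)).tangent
      (fun θ' => (⟨θ', A θ'⟩ : TangentBundle (𝓘(ℝ, E).prod 𝓘(ℝ, F)) (TotalSpace F V))) θ := by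
  rw [mdifferentiableAt_section]
  refine (h1.prodMk_space h2).congr_of_eventuallyEq ?_
  filter_upwards [chart_source_mem_nhds (ModelProd E F) θ] with y hy
  have h3 := mvfderiv_extChartAt_totalSpace (E := E) hy (A y)
  refine Eq.trans ?_ h3
  have h4 := TangentBundle.continuousLinearMapAt_trivializationAt (𝕜 := ℝ)
    (I := 𝓘(ℝ, E).prod 𝓘(ℝ, F)) hy
  have h5 := congrArg (fun T => T (A y)) h4
  refine Eq.trans ?_ h5
  have h6 : y ∈ (trivializationAt (E × F) (TangentSpace (𝓘(ℝ, E).prod 𝓘(ℝ, F))) θ).baseSet := by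
    simpa using hy
  change _ = (Trivialization.continuousLinearMapAt ℝ _ _) _
  rw [Trivialization.continuousLinearMapAt_apply, Trivialization.coe_linearMapAt_of_mem _ h6]

theorem mdifferentiableAt_mvfderiv_extChartAt {X : ∀ y : B, TangentSpace 𝓘(ℝ, E) y} {x : B}
    (hX : MDifferentiableAt 𝓘(ℝ, E) 𝓘(ℝ, E).tangent
      (fun y => (⟨y, X y⟩ : TangentBundle 𝓘(ℝ, E) B)) x) :
    MDifferentiableAt 𝓘(ℝ, E) 𝓘(ℝ, E)
      (fun y => mvfderiv 𝓘(ℝ, E) (extChartAt 𝓘(ℝ, E) x) y (X y)) x := by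
  rw [mdifferentiableAt_section] at hX
  refine hX.congr_of_eventuallyEq ?_
  filter_upwards [chart_source_mem_nhds E x] with y hy
  have h5 := congrArg (fun T => T (X y))
    (TangentBundle.continuousLinearMapAt_trivializationAt (𝕜 := ℝ) (I := 𝓘(ℝ, E)) hy)
  refine h5.symm.trans ?_
  have h6 : y ∈ (trivializationAt E (TangentSpace 𝓘(ℝ, E)) x).baseSet := by
    simpa using hy
  change (Trivialization.continuousLinearMapAt ℝ _ _) _ = _
  rw [Trivialization.continuousLinearMapAt_apply, Trivialization.coe_linearMapAt_of_mem _ h6]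

theorem mdifferentiableAt_vLift {η : ∀ x, V x} {θ : TotalSpace F V}
    (hη : MDifferentiableAt 𝓘(ℝ, E) (𝓘(ℝ, E).prod 𝓘(ℝ, F))
      (fun y => (⟨y, η y⟩ : TotalSpace F V)) θ.proj) :
    MDifferentiableAt (𝓘(ℝ, E).prod 𝓘(ℝ, F)) (𝓘(ℝ, E).prod 𝓘(ℝ, F)).tangent
      (fun θ' => (⟨θ', vLift E θ' (η θ'.proj)⟩ :
        TangentBundle (𝓘(ℝ, E).prod 𝓘(ℝ, F)) (TotalSpace F V))) θ := by
  apply mdifferentiableAt_field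
  · simp only [dProj_vLift, map_zero]
    exact mdifferentiableAt_const
  · have h := mdifferentiableAt_comp_proj (F := F) (V := V) ((mdifferentiableAt_section 𝓘(ℝ, E) η).1 hη)
    refine h.congr_of_eventuallyEq ?_
    filter_upwards [eventually_proj (eventually_mem_baseSet (F := F) (V := V) θ.proj)] with y hy
    exact mvfderiv_fibreCoord_vLift hy _

theorem mvfderiv_fibreCoord_hLift_of_mem (hD : IsMetricConnection (F := F) D) {x₀ : B}
    {θ : TotalSpace F V} {v : V x₀} (hθ : θ.proj ∈ (trivializationAt F V x₀).baseSet)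
    (hv : FiberBundle.extend F v θ.proj = θ.2)
    (hd : MDifferentiableAt 𝓘(ℝ, E) (𝓘(ℝ, E).prod 𝓘(ℝ, F))
      (fun x => (⟨x, FiberBundle.extend F v x⟩ : TotalSpace F V)) θ.proj)
    (u : TangentSpace 𝓘(ℝ, E) θ.proj) :
    mvfderiv (𝓘(ℝ, E).prod 𝓘(ℝ, F)) (fibreCoord x₀) θ (hLift D θ u) =
      -fibreIso x₀ hθ (D (FiberBundle.extend F v) θ.proj u) := by
  rw [mvfderiv_hLift_of_section hD (mdifferentiableAt_fibreCoord hθ) hv hd,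
    mvfderiv_fibreCoord_vLift hθ]
  have h1 : (fun x => fibreCoord x₀ (⟨x, FiberBundle.extend F v x⟩ : TotalSpace F V))
      =ᶠ[𝓝 θ.proj] fun _ => fibreCoord x₀ (⟨x₀, v⟩ : TotalSpace F V) := by
    filter_upwards [(trivializationAt F V x₀).open_baseSet.mem_nhds hθ] with x hx
    exact fibreCoord_extend hx v
  have h2 : mvfderiv 𝓘(ℝ, E)
      (fun x => fibreCoord x₀ (⟨x, FiberBundle.extend F v x⟩ : TotalSpace F V)) θ.proj =
      mvfderiv 𝓘(ℝ, E) (fun _ => fibreCoord x₀ (⟨x₀, v⟩ : TotalSpace F V)) θ.proj := h1.mfderiv_eq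
  rw [h2, mvfderiv_const]
  simp

theorem extend_add {x₀ x : B} (hx : x ∈ (trivializationAt F V x₀).baseSet) (v w : V x₀) :
    FiberBundle.extend F (v + w) x = FiberBundle.extend F v x + FiberBundle.extend F w x := by
  have h := mem_baseSet_trivializationAt F V x₀
  simp only [extend_eq_fibreIso_symm hx, ← fibreIso_apply h, map_add]

theorem extend_smul {x₀ x : B} (hx : x ∈ (trivializationAt F V x₀).baseSet) (c : ℝ) (v : V x₀) :
    FiberBundle.extend F (c • v) x = c • FiberBundle.extend F v x := by
  have h := mem_baseSet_trivializationAt F V x₀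
  simp only [extend_eq_fibreIso_symm hx, ← fibreIso_apply h, map_smul]

theorem mdifferentiableAt_extend_of_mem {x₀ x : B}
    (hx : x ∈ (trivializationAt F V x₀).baseSet) (v : V x₀) :
    MDifferentiableAt 𝓘(ℝ, E) (𝓘(ℝ, E).prod 𝓘(ℝ, F))
      (fun y => (⟨y, FiberBundle.extend F v y⟩ : TotalSpace F V)) x := by
  rw [(trivializationAt F V x₀).mdifferentiableAt_section_iff 𝓘(ℝ, E) _ hx]
  refine (mdifferentiableAt_const
    (c := fibreCoord x₀ (⟨x₀, v⟩ : TotalSpace F V))).congr_of_eventuallyEq ?_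
  filter_upwards [(trivializationAt F V x₀).open_baseSet.mem_nhds hx] with y hy
  exact fibreCoord_extend hy v

/-- The derivative of an extended section depends linearly on its initial value. -/
def extendDerivative (hD : IsCovariantDerivativeOn F D univ) (x₀ : B) {x : B}
    (hx : x ∈ (trivializationAt F V x₀).baseSet) : V x₀ →ₗ[ℝ] TangentSpace 𝓘(ℝ, E) x →L[ℝ] V x where
  toFun v := D (FiberBundle.extend F v) x
  map_add' v w := by
    have h := fun v : V x₀ => mdifferentiableAt_extend_of_mem (E := E) hx v
    rw [← hD.add (h v) (h w)]
    refine hD.congr_of_eventuallyEq (h _) (mdifferentiableAt_add_section (h v) (h w)) univ_mem ?_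
    filter_upwards [(trivializationAt F V x₀).open_baseSet.mem_nhds hx] with y hy
    exact extend_add hy v w
  map_smul' c v := by
    have h := fun v : V x₀ => mdifferentiableAt_extend_of_mem (E := E) hx v
    rw [RingHom.id_apply, ← hD.smul_const c (h v)]
    refine hD.congr_of_eventuallyEq (h _) (mdifferentiableAt_const.smul_section (h v)) univ_mem ?_
    filter_upwards [(trivializationAt F V x₀).open_baseSet.mem_nhds hx] with y hy
    exact extend_smul hy c v

/-- The lift at `θ'` is defined by a section that varies with `θ'`, which hides its regularity.
Written in the frame extended from the single fibre over `θ.proj`, its fibre coordinate becomes `-∑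
c_j d_j`, where `c_j` are the coordinates of `θ'` and `d_j` those of the derivatives of the frame;
the latter are differentiable by `IsMetricConnection.smooth`. -/
theorem mdifferentiableAt_hLift (hD : IsMetricConnection (F := F) D)
    {X : ∀ y : B, TangentSpace 𝓘(ℝ, E) y} {θ : TotalSpace F V}
    (hX : MDifferentiableAt 𝓘(ℝ, E) 𝓘(ℝ, E).tangent
      (fun y => (⟨y, X y⟩ : TangentBundle 𝓘(ℝ, E) B)) θ.proj) :
    MDifferentiableAt (𝓘(ℝ, E).prod 𝓘(ℝ, F)) (𝓘(ℝ, E).prod 𝓘(ℝ, F)).tangent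
      (fun θ' => (⟨θ', hLift D θ' (X θ'.proj)⟩ :
        TangentBundle (𝓘(ℝ, E).prod 𝓘(ℝ, F)) (TotalSpace F V))) θ := by
  have h0 := mem_baseSet_trivializationAt F V θ.proj
  apply mdifferentiableAt_field
  · simp only [dProj_hLift]
    exact mdifferentiableAt_comp_proj (mdifferentiableAt_mvfderiv_extChartAt hX)
  · let b := Module.finBasis ℝ F
    let v (j) : V θ.proj := (fibreIso θ.proj h0).symm (b j)
    let c (j) (y : TotalSpace F V) : ℝ := b.coord j (fibreCoord θ.proj y)
    let d (j) (y : TotalSpace F V) : F := fibreCoord θ.proj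
      (⟨y.proj, D (FiberBundle.extend F (v j)) y.proj (X y.proj)⟩ : TotalSpace F V)
    have hc : ∀ j, MDifferentiableAt (𝓘(ℝ, E).prod 𝓘(ℝ, F)) 𝓘(ℝ, ℝ) (c j) θ := by
      intro j
      exact (LinearMap.toContinuousLinearMap (b.coord j)).mdifferentiableAt.comp θ
        (mdifferentiableAt_fibreCoord h0)
    have hd : ∀ j, MDifferentiableAt (𝓘(ℝ, E).prod 𝓘(ℝ, F)) 𝓘(ℝ, F) (d j) θ := by
      intro j
      exact mdifferentiableAt_comp_proj ((mdifferentiableAt_section 𝓘(ℝ, E) _).1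
        (hD.smooth θ.proj (v j) X hX))
    have hsum : MDifferentiableAt (𝓘(ℝ, E).prod 𝓘(ℝ, F)) 𝓘(ℝ, F)
        (fun y => -∑ j, c j y • d j y) θ := by
      have h := (MDifferentiableAt.sum (t := Finset.univ)
        fun j _ => (hc j).smul (hd j)).neg
      refine h.congr_of_eventuallyEq (Eventually.of_forall fun y => ?_)
      simp
    refine hsum.congr_of_eventuallyEq ?_
    filter_upwards [eventually_proj (eventually_mem_baseSet (F := F) (V := V) θ.proj)] with y hy
    -- The point `y` lies on the extension of the vector over `θ.proj` that has the same fibre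
    -- coordinates.
    have hv : FiberBundle.extend F ((fibreIso θ.proj h0).symm (fibreCoord θ.proj y)) y.proj =
        y.2 := by
      rw [extend_eq_fibreIso_symm hy, ← fibreIso_apply h0, ContinuousLinearEquiv.apply_symm_apply]
      exact (fibreIso θ.proj hy).symm_apply_apply y.2
    rw [mvfderiv_fibreCoord_hLift_of_mem hD hy hv (mdifferentiableAt_extend_of_mem hy _)]
    congr 1
    change fibreIso θ.proj hy (extendDerivative hD.isCovariantDerivative θ.proj hy
      ((fibreIso θ.proj h0).symm (fibreCoord θ.proj y)) (X y.proj)) = _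
    conv_lhs => rw [← b.sum_repr (fibreCoord θ.proj y)]
    simp only [map_sum, map_smul, sum_apply, smul_apply]
    rfl

end MetricConnection

/-! ### Curvature of the connection and brackets of lifts. -/

section Brackets

variable
  {E : Type*} [NormedAddCommGroup E] [NormedSpace ℝ E] [FiniteDimensional ℝ E]
  {B : Type*} [TopologicalSpace B] [ChartedSpace E B] [IsManifold 𝓘(ℝ, E) ∞ B]
  {F : Type*} [NormedAddCommGroup F] [NormedSpace ℝ F] [FiniteDimensional ℝ F]
  {V : B → Type*} [TopologicalSpace (TotalSpace F V)]
  [∀ x, NormedAddCommGroup (V x)] [∀ x, InnerProductSpace ℝ (V x)] [FiberBundle F V]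
  [VectorBundle ℝ F V] [ContMDiffVectorBundle ∞ F V 𝓘(ℝ, E)]

  [IsContMDiffRiemannianBundle 𝓘(ℝ, E) ∞ F V]
  {D : (∀ x, V x) → ∀ x, TangentSpace 𝓘(ℝ, E) x →L[ℝ] V x}
  {X Y : ∀ y : B, TangentSpace 𝓘(ℝ, E) y} {x : B}

/-- The expression `D_X D_Y ζ - D_Y D_X ζ - D_[X, Y] ζ`. -/
def fieldCurvature (D : (∀ x, V x) → ∀ x, TangentSpace 𝓘(ℝ, E) x →L[ℝ] V x) (ζ : ∀ y, V y) (x : B)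
    (X Y : ∀ y : B, TangentSpace 𝓘(ℝ, E) y) : V x :=
  D (fun y => D ζ y (Y y)) x (X x) - D (fun y => D ζ y (X y)) x (Y x) -
    D ζ x (VectorField.mlieBracket 𝓘(ℝ, E) X Y x)

theorem fieldCurvature_swap (ζ : ∀ y, V y) (x : B) (X Y : ∀ y : B, TangentSpace 𝓘(ℝ, E) y) :
    fieldCurvature D ζ x X Y = -fieldCurvature D ζ x Y X := by
  rw [fieldCurvature, fieldCurvature, VectorField.mlieBracket_swap_apply, map_neg]
  abel

/-- The terms of the Leibniz rule that differentiate the coefficient function cancel against those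
of the bracket. The section is kept to be an extended vector: that is the case in which `D ζ` is
known to be differentiable, and the one occurring in `curvature`. -/
theorem tensorialAt_fieldCurvature_left (hD : IsMetricConnection (F := F) D) (w : V x) :
    TensorialAt 𝓘(ℝ, E) E (fun X => fieldCurvature D (FiberBundle.extend F w) x X Y) x where
  smul {g X} hg hX := by
    have h1 : D (fun y => D (FiberBundle.extend F w) y ((g • X) y)) x =
        D (g • fun y => D (FiberBundle.extend F w) y (X y)) x := by
      congr 1
      funext y
      simp
    simp only [fieldCurvature]
    rw [h1, hD.isCovariantDerivative.leibniz (hD.smooth x w X hX) hg,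
      VectorField.mlieBracket_smul_left hg hX]
    simp
    module
  add {X X'} hX hX' := by
    have h1 : D (fun y => D (FiberBundle.extend F w) y ((X + X') y)) x =
        D ((fun y => D (FiberBundle.extend F w) y (X y)) +
          fun y => D (FiberBundle.extend F w) y (X' y)) x := by
      congr 1
      funext y
      simp
    simp only [fieldCurvature]
    rw [h1, hD.isCovariantDerivative.add (hD.smooth x w X hX) (hD.smooth x w X' hX'),
      VectorField.mlieBracket_add_left hX hX']
    simp
    abel

theorem tensorialAt_fieldCurvature_right (hD : IsMetricConnection (F := F) D) (w : V x) :
    TensorialAt 𝓘(ℝ, E) E (fun Y => fieldCurvature D (FiberBundle.extend F w) x X Y) x where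
  smul hg hY := by
    rw [fieldCurvature_swap, (tensorialAt_fieldCurvature_left hD w).smul hg hY,
      fieldCurvature_swap _ x X, smul_neg]
  add hY hY' := by
    rw [fieldCurvature_swap, (tensorialAt_fieldCurvature_left hD w).add hY hY',
      fieldCurvature_swap _ x X, fieldCurvature_swap _ x X, neg_add]

theorem mdifferentiableAt_extend_field (u : TangentSpace 𝓘(ℝ, E) x) :
    MDifferentiableAt 𝓘(ℝ, E) 𝓘(ℝ, E).tangent
      (fun y => (⟨y, FiberBundle.extend E u y⟩ : TangentBundle 𝓘(ℝ, E) B)) x :=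
  FiberBundle.mdifferentiableAt_extend 𝓘(ℝ, E) E u

theorem fieldCurvature_eq_curvature (hD : IsMetricConnection (F := F) D) (w : V x)
    (hX : MDifferentiableAt 𝓘(ℝ, E) 𝓘(ℝ, E).tangent
      (fun y => (⟨y, X y⟩ : TangentBundle 𝓘(ℝ, E) B)) x)
    (hY : MDifferentiableAt 𝓘(ℝ, E) 𝓘(ℝ, E).tangent
      (fun y => (⟨y, Y y⟩ : TangentBundle 𝓘(ℝ, E) B)) x) :
    fieldCurvature D (FiberBundle.extend F w) x X Y = curvature (F := F) D x (X x) (Y x) w := by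
  have h := TensorialAt.pointwise₂
    (Φ := fun X Y => fieldCurvature D (FiberBundle.extend F w) x X Y)
    (fun _ _ => tensorialAt_fieldCurvature_left hD w)
    (fun _ _ => tensorialAt_fieldCurvature_right hD w)
    hX (mdifferentiableAt_extend_field _) hY (mdifferentiableAt_extend_field _)
    (FiberBundle.extend_apply_self E _).symm (FiberBundle.extend_apply_self E _).symm
  refine h.trans ?_
  simp only [fieldCurvature, curvature, FiberBundle.extend_apply_self]

theorem curvature_eq_mkHom (hD : IsMetricConnection (F := F) D) (u v : TangentSpace 𝓘(ℝ, E) x)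
    (w : V x) :
    curvature (F := F) D x u v w = TensorialAt.mkHom _ x
      (tensorialAt_fieldCurvature_right (X := FiberBundle.extend E u) hD w) v := by
  rw [TensorialAt.mkHom_apply_eq_extend]
  simp only [fieldCurvature, curvature, FiberBundle.extend_apply_self]

/-- The operator `XY - YX - [X, Y]` annihilates the function `⟨w, w'⟩` of the extended vectors.
Expanding by metricity, the mixed products of first derivatives are symmetric in `X` and `Y` and
cancel, leaving the two curvature terms. -/
theorem inner_curvature_skew (hD : IsMetricConnection (F := F) D) (u v : TangentSpace 𝓘(ℝ, E) x)
    (w w' : V x) :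
    (inner ℝ (curvature (F := F) D x u v w) w' : ℝ) =
      -inner ℝ w (curvature (F := F) D x u v w') := by
  have hX := mdifferentiableAt_extend_field u
  have hY := mdifferentiableAt_extend_field v
  have hR := fun w : V x => fieldCurvature_eq_curvature hD w hX hY
  simp only [FiberBundle.extend_apply_self] at hR
  have hg : ContMDiffAt 𝓘(ℝ, E) 𝓘(ℝ, ℝ) 2
      (fun y => (inner ℝ (FiberBundle.extend F w y) (FiberBundle.extend F w' y) : ℝ)) x :=
    ContMDiffAt.inner_bundle (FiberBundle.contMDiffAt_extend 𝓘(ℝ, E) F w)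
      (FiberBundle.contMDiffAt_extend 𝓘(ℝ, E) F w')
  have hs := fun w : V x => mdifferentiableAt_extend_section (E := E) (F := F) w
  have key : ∀ Z U : ∀ y : B, TangentSpace 𝓘(ℝ, E) y,
      MDifferentiableAt 𝓘(ℝ, E) 𝓘(ℝ, E).tangent
        (fun y => (⟨y, Z y⟩ : TangentBundle 𝓘(ℝ, E) B)) x →
      mvfderiv 𝓘(ℝ, E) (fun y => mvfderiv 𝓘(ℝ, E) (fun y => (inner ℝ (FiberBundle.extend F w y)
        (FiberBundle.extend F w' y) : ℝ)) y (Z y)) x (U x) =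
      inner ℝ (D (fun y => D (FiberBundle.extend F w) y (Z y)) x (U x)) w' +
        inner ℝ (D (FiberBundle.extend F w) x (Z x)) (D (FiberBundle.extend F w') x (U x)) +
      (inner ℝ (D (FiberBundle.extend F w) x (U x)) (D (FiberBundle.extend F w') x (Z x)) +
        inner ℝ w (D (fun y => D (FiberBundle.extend F w') y (Z y)) x (U x))) := by
    intro Z U hZ
    have h1 : (fun y => mvfderiv 𝓘(ℝ, E) (fun y => (inner ℝ (FiberBundle.extend F w y)
        (FiberBundle.extend F w' y) : ℝ)) y (Z y)) =ᶠ[𝓝 x]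
        (fun y => (inner ℝ (D (FiberBundle.extend F w) y (Z y)) (FiberBundle.extend F w' y) : ℝ)) +
          fun y => (inner ℝ (FiberBundle.extend F w y) (D (FiberBundle.extend F w') y (Z y)) : ℝ) := by
      filter_upwards [eventually_mdifferentiableAt_extend (E := E) (F := F) w,
        eventually_mdifferentiableAt_extend (E := E) (F := F) w'] with y h2 h3
      exact hD.metric _ _ y (Z y) h2 h3
    have h2 : mvfderiv 𝓘(ℝ, E) (fun y => mvfderiv 𝓘(ℝ, E) (fun y => (inner ℝ
        (FiberBundle.extend F w y) (FiberBundle.extend F w' y) : ℝ)) y (Z y)) x =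
        mvfderiv 𝓘(ℝ, E) _ x := h1.mfderiv_eq
    have hw := hD.smooth x w Z hZ
    have hw' := hD.smooth x w' Z hZ
    rw [h2, mvfderiv_add (MDifferentiableAt.inner_bundle hw (hs w'))
      (MDifferentiableAt.inner_bundle (hs w) hw'), add_apply, hD.metric _ _ x _ hw (hs w'),
      hD.metric _ _ x _ (hs w) hw']
    simp only [FiberBundle.extend_apply_self]
  have h1 := mvfderiv_mlieBracket hg hX hY
  rw [key _ _ hX, key _ _ hY, hD.metric _ _ x _ (hs w) (hs w')] at h1
  rw [← hR, ← hR, fieldCurvature, fieldCurvature]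
  simp only [inner_sub_left, inner_sub_right, FiberBundle.extend_apply_self] at h1 ⊢
  linarith

/-- Naturality of the bracket for `π`-related fields, seen on the test function `φ ∘ π` with `φ` a
chart of the base. Vertical fields are covered by taking the zero field downstairs. -/
theorem dProj_mlieBracket {A C : ∀ θ : TotalSpace F V, TangentSpace (𝓘(ℝ, E).prod 𝓘(ℝ, F)) θ}
    {θ : TotalSpace F V}
    (hA : MDifferentiableAt (𝓘(ℝ, E).prod 𝓘(ℝ, F)) (𝓘(ℝ, E).prod 𝓘(ℝ, F)).tangent
      (fun θ' => (⟨θ', A θ'⟩ : TangentBundle (𝓘(ℝ, E).prod 𝓘(ℝ, F)) (TotalSpace F V))) θ)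
    (hC : MDifferentiableAt (𝓘(ℝ, E).prod 𝓘(ℝ, F)) (𝓘(ℝ, E).prod 𝓘(ℝ, F)).tangent
      (fun θ' => (⟨θ', C θ'⟩ : TangentBundle (𝓘(ℝ, E).prod 𝓘(ℝ, F)) (TotalSpace F V))) θ)
    (hX : MDifferentiableAt 𝓘(ℝ, E) 𝓘(ℝ, E).tangent
      (fun y => (⟨y, X y⟩ : TangentBundle 𝓘(ℝ, E) B)) θ.proj)
    (hY : MDifferentiableAt 𝓘(ℝ, E) 𝓘(ℝ, E).tangent
      (fun y => (⟨y, Y y⟩ : TangentBundle 𝓘(ℝ, E) B)) θ.proj)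
    (hAX : ∀ θ', dProj θ' (A θ') = X θ'.proj) (hCY : ∀ θ', dProj θ' (C θ') = Y θ'.proj) :
    dProj θ (VectorField.mlieBracket (𝓘(ℝ, E).prod 𝓘(ℝ, F)) A C θ) =
      VectorField.mlieBracket 𝓘(ℝ, E) X Y θ.proj := by
  let φ := extChartAt 𝓘(ℝ, E) θ.proj
  have hφ : ContMDiffAt 𝓘(ℝ, E) 𝓘(ℝ, E) 2 φ θ.proj := contMDiffAt_extChartAt
  have hφπ : ContMDiffAt (𝓘(ℝ, E).prod 𝓘(ℝ, F)) 𝓘(ℝ, E) 2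
      (fun θ' : TotalSpace F V => φ θ'.proj) θ := hφ.comp θ (contMDiffAt_proj V)
  have hφn : ∀ᶠ y in 𝓝 θ.proj, MDifferentiableAt 𝓘(ℝ, E) 𝓘(ℝ, E) φ y := by
    filter_upwards [chart_source_mem_nhds E θ.proj] with y hy
    exact mdifferentiableAt_extChartAt hy
  have key : ∀ (C : ∀ θ : TotalSpace F V, TangentSpace (𝓘(ℝ, E).prod 𝓘(ℝ, F)) θ)
      (Y : ∀ y : B, TangentSpace 𝓘(ℝ, E) y), MDifferentiableAt 𝓘(ℝ, E) 𝓘(ℝ, E).tangent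
      (fun y => (⟨y, Y y⟩ : TangentBundle 𝓘(ℝ, E) B)) θ.proj →
      (∀ θ', dProj θ' (C θ') = Y θ'.proj) → ∀ a : TangentSpace (𝓘(ℝ, E).prod 𝓘(ℝ, F)) θ,
      mvfderiv (𝓘(ℝ, E).prod 𝓘(ℝ, F)) (fun θ' => mvfderiv (𝓘(ℝ, E).prod 𝓘(ℝ, F))
        (fun θ' : TotalSpace F V => φ θ'.proj) θ' (C θ')) θ a =
      mvfderiv 𝓘(ℝ, E) (fun y => mvfderiv 𝓘(ℝ, E) φ y (Y y)) θ.proj (dProj θ a) := by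
    intro C Y hY hCY a
    rw [← mvfderiv_comp_proj (mdifferentiableAt_mvfderiv_extChartAt hY)]
    congr 1
    refine Filter.EventuallyEq.mfderiv_eq ?_
    filter_upwards [eventually_proj hφn] with θ' h
    rw [mvfderiv_comp_proj h, hCY]
  have h1 := mvfderiv_mlieBracket hφπ hA hC
  rw [key A X hX hAX, key C Y hY hCY, mvfderiv_comp_proj (hφn.self_of_nhds), hAX, hCY,
    ← mvfderiv_mlieBracket hφ hX hY] at h1
  have h2 : ∀ u : TangentSpace 𝓘(ℝ, E) θ.proj, mvfderiv 𝓘(ℝ, E) φ θ.proj u = u := fun u =>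
    congrArg (fun T => T u) (mfderiv_extChartAt_self (I := 𝓘(ℝ, E)) (x := θ.proj))
  rwa [h2, h2] at h1

/-- The bracket, as a commutator of derivations, acts on the pairing with an extension of `w`;
`mvfderiv_pairing` then isolates `⟨w, K ·⟩` up to a horizontal term that is already known. -/
theorem inner_connectionMap_mlieBracket (hD : IsMetricConnection (F := F) D)
    {A C : ∀ θ : TotalSpace F V, TangentSpace (𝓘(ℝ, E).prod 𝓘(ℝ, F)) θ}
    {θ : TotalSpace F V} (w : V θ.proj)
    (hA : MDifferentiableAt (𝓘(ℝ, E).prod 𝓘(ℝ, F)) (𝓘(ℝ, E).prod 𝓘(ℝ, F)).tangent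
      (fun θ' => (⟨θ', A θ'⟩ : TangentBundle (𝓘(ℝ, E).prod 𝓘(ℝ, F)) (TotalSpace F V))) θ)
    (hC : MDifferentiableAt (𝓘(ℝ, E).prod 𝓘(ℝ, F)) (𝓘(ℝ, E).prod 𝓘(ℝ, F)).tangent
      (fun θ' => (⟨θ', C θ'⟩ : TangentBundle (𝓘(ℝ, E).prod 𝓘(ℝ, F)) (TotalSpace F V))) θ) :
    (inner ℝ w (connectionMap D θ (VectorField.mlieBracket (𝓘(ℝ, E).prod 𝓘(ℝ, F)) A C θ)) : ℝ) =
      mvfderiv (𝓘(ℝ, E).prod 𝓘(ℝ, F)) (fun θ' => mvfderiv (𝓘(ℝ, E).prod 𝓘(ℝ, F))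
        (pairing (FiberBundle.extend F w)) θ' (C θ')) θ (A θ) -
      mvfderiv (𝓘(ℝ, E).prod 𝓘(ℝ, F)) (fun θ' => mvfderiv (𝓘(ℝ, E).prod 𝓘(ℝ, F))
        (pairing (FiberBundle.extend F w)) θ' (A θ')) θ (C θ) -
      inner ℝ (D (FiberBundle.extend F w) θ.proj
        (dProj θ (VectorField.mlieBracket (𝓘(ℝ, E).prod 𝓘(ℝ, F)) A C θ))) θ.2 := by
  have h1 := mvfderiv_mlieBracket ((contMDiffAt_pairing
    (FiberBundle.contMDiffAt_extend 𝓘(ℝ, E) F w)).of_le ENat.LEInfty.out) hA hC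
  rw [← h1, mvfderiv_pairing hD (mdifferentiableAt_extend_section w),
    FiberBundle.extend_apply_self]
  ring

variable {ξ η : ∀ x, V x} {θ : TotalSpace F V}

/-- The derivative in the direction `a` of the derivative of `pairing (extend w)` along a
horizontal lift. -/
theorem mvfderiv_mvfderiv_pairing_hLift (hD : IsMetricConnection (F := F) D) (w : V θ.proj)
    (hY : MDifferentiableAt 𝓘(ℝ, E) 𝓘(ℝ, E).tangent
      (fun y => (⟨y, Y y⟩ : TangentBundle 𝓘(ℝ, E) B)) θ.proj)
    (a : TangentSpace (𝓘(ℝ, E).prod 𝓘(ℝ, F)) θ) :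
    mvfderiv (𝓘(ℝ, E).prod 𝓘(ℝ, F)) (fun θ' => mvfderiv (𝓘(ℝ, E).prod 𝓘(ℝ, F))
        (pairing (FiberBundle.extend F w)) θ' (hLift D θ' (Y θ'.proj))) θ a =
      inner ℝ (D (fun y => D (FiberBundle.extend F w) y (Y y)) θ.proj (dProj θ a)) θ.2 +
        inner ℝ (D (FiberBundle.extend F w) θ.proj (Y θ.proj)) (connectionMap D θ a) := by
  rw [← mvfderiv_pairing hD (hD.smooth _ w Y hY)]
  congr 1
  refine Filter.EventuallyEq.mfderiv_eq ?_
  filter_upwards [eventually_proj (eventually_mdifferentiableAt_extend (E := E) (F := F) w)]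
    with θ' h
  rw [mvfderiv_pairing hD h, dProj_hLift, connectionMap_hLift, inner_zero_right, add_zero]
  rfl

/-- The derivative in the direction `a` of the derivative of `pairing (extend w)` along a
vertical lift. -/
theorem mvfderiv_mvfderiv_pairing_vLift (hD : IsMetricConnection (F := F) D) (w : V θ.proj)
    (hη : MDifferentiableAt 𝓘(ℝ, E) (𝓘(ℝ, E).prod 𝓘(ℝ, F))
      (fun y => (⟨y, η y⟩ : TotalSpace F V)) θ.proj)
    (a : TangentSpace (𝓘(ℝ, E).prod 𝓘(ℝ, F)) θ) :
    mvfderiv (𝓘(ℝ, E).prod 𝓘(ℝ, F)) (fun θ' => mvfderiv (𝓘(ℝ, E).prod 𝓘(ℝ, F))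
        (pairing (FiberBundle.extend F w)) θ' (vLift E θ' (η θ'.proj))) θ a =
      inner ℝ (D (FiberBundle.extend F w) θ.proj (dProj θ a)) (η θ.proj) +
        inner ℝ w (D η θ.proj (dProj θ a)) := by
  have h1 := hD.metric _ η θ.proj (dProj θ a) (mdifferentiableAt_extend_section w) hη
  rw [FiberBundle.extend_apply_self] at h1
  rw [← h1, ← mvfderiv_comp_proj (MDifferentiableAt.inner_bundle
    (mdifferentiableAt_extend_section w) hη)]
  congr 1
  refine Filter.EventuallyEq.mfderiv_eq ?_
  filter_upwards [eventually_proj (eventually_mdifferentiableAt_extend (E := E) (F := F) w)]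
    with θ' h
  rw [mvfderiv_pairing hD h, dProj_vLift, connectionMap_vLift, map_zero, inner_zero_left, zero_add]

theorem mdifferentiableAt_zero_field (x : B) :
    MDifferentiableAt 𝓘(ℝ, E) 𝓘(ℝ, E).tangent
      (fun y => (⟨y, (0 : ∀ y : B, TangentSpace 𝓘(ℝ, E) y) y⟩ : TangentBundle 𝓘(ℝ, E) B)) x :=
  mdifferentiableAt_zeroSection ..

/-- Along `Y^h` the pairing with `ζ` differentiates to the pairing with `D_Y ζ`. Commuting two such
derivatives gives `⟨R(X, Y) w, θ⟩`, and skewness moves the curvature onto `θ`; this is the source of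
the minus sign. -/
theorem mlieBracket_hLift_hLift (hD : IsMetricConnection (F := F) D)
    (hX : MDifferentiableAt 𝓘(ℝ, E) 𝓘(ℝ, E).tangent
      (fun y => (⟨y, X y⟩ : TangentBundle 𝓘(ℝ, E) B)) θ.proj)
    (hY : MDifferentiableAt 𝓘(ℝ, E) 𝓘(ℝ, E).tangent
      (fun y => (⟨y, Y y⟩ : TangentBundle 𝓘(ℝ, E) B)) θ.proj) :
    VectorField.mlieBracket (𝓘(ℝ, E).prod 𝓘(ℝ, F)) (fun θ => hLift D θ (X θ.proj))
      (fun θ => hLift D θ (Y θ.proj)) θ = hLift D θ (VectorField.mlieBracket 𝓘(ℝ, E) X Y θ.proj) -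
        vLift E θ (curvature (F := F) D θ.proj (X θ.proj) (Y θ.proj) θ.2) := by
  have h1 := mdifferentiableAt_hLift hD hX
  have h2 := mdifferentiableAt_hLift hD hY
  have h3 := dProj_mlieBracket h1 h2 hX hY (fun _ => dProj_hLift D _ _) (fun _ => dProj_hLift D _ _)
  apply eq_of_dProj_connectionMap D
  · rw [h3, map_sub, dProj_hLift, dProj_vLift, sub_zero]
  · rw [connectionMap_sub, connectionMap_hLift, connectionMap_vLift, zero_sub]
    refine ext_inner_left ℝ fun w => ?_
    rw [inner_connectionMap_mlieBracket hD w h1 h2, h3, mvfderiv_mvfderiv_pairing_hLift hD w hX,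
      mvfderiv_mvfderiv_pairing_hLift hD w hY, inner_neg_right, ← inner_curvature_skew hD,
      ← fieldCurvature_eq_curvature hD w hX hY, fieldCurvature]
    simp only [dProj_hLift, connectionMap_hLift, inner_zero_right, inner_sub_left, add_zero]

theorem mlieBracket_hLift_vLift (hD : IsMetricConnection (F := F) D)
    (hX : MDifferentiableAt 𝓘(ℝ, E) 𝓘(ℝ, E).tangent
      (fun y => (⟨y, X y⟩ : TangentBundle 𝓘(ℝ, E) B)) θ.proj)
    (hη : MDifferentiableAt 𝓘(ℝ, E) (𝓘(ℝ, E).prod 𝓘(ℝ, F))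
      (fun y => (⟨y, η y⟩ : TotalSpace F V)) θ.proj) :
    VectorField.mlieBracket (𝓘(ℝ, E).prod 𝓘(ℝ, F)) (fun θ => hLift D θ (X θ.proj))
      (fun θ => vLift E θ (η θ.proj)) θ = vLift E θ (D η θ.proj (X θ.proj)) := by
  have h1 := mdifferentiableAt_hLift hD hX
  have h2 := mdifferentiableAt_vLift hη
  have h3 := dProj_mlieBracket h1 h2 hX (mdifferentiableAt_zero_field _)
    (fun _ => dProj_hLift D _ _) (fun _ => dProj_vLift _ _)
  rw [VectorField.mlieBracket_zero_right] at h3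
  apply eq_of_dProj_connectionMap D
  · rw [h3, dProj_vLift]
    rfl
  · rw [connectionMap_vLift]
    refine ext_inner_left ℝ fun w => ?_
    rw [inner_connectionMap_mlieBracket hD w h1 h2, h3, mvfderiv_mvfderiv_pairing_hLift hD w hX,
      mvfderiv_mvfderiv_pairing_vLift hD w hη]
    simp [dProj_hLift, dProj_vLift, connectionMap_vLift]

theorem mlieBracket_vLift_vLift (hD : IsMetricConnection (F := F) D)
    (hξ : MDifferentiableAt 𝓘(ℝ, E) (𝓘(ℝ, E).prod 𝓘(ℝ, F))
      (fun y => (⟨y, ξ y⟩ : TotalSpace F V)) θ.proj)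
    (hη : MDifferentiableAt 𝓘(ℝ, E) (𝓘(ℝ, E).prod 𝓘(ℝ, F))
      (fun y => (⟨y, η y⟩ : TotalSpace F V)) θ.proj) :
    VectorField.mlieBracket (𝓘(ℝ, E).prod 𝓘(ℝ, F)) (fun θ => vLift E θ (ξ θ.proj))
      (fun θ => vLift E θ (η θ.proj)) θ = 0 := by
  have h1 := mdifferentiableAt_vLift hξ
  have h2 := mdifferentiableAt_vLift hη
  have h3 := dProj_mlieBracket h1 h2 (mdifferentiableAt_zero_field _)
    (mdifferentiableAt_zero_field _) (fun _ => dProj_vLift _ _) (fun _ => dProj_vLift _ _)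
  rw [VectorField.mlieBracket_zero_right] at h3
  rw [← vLift_zero]
  apply eq_of_dProj_connectionMap D
  · rw [h3, dProj_vLift]
    rfl
  · rw [connectionMap_vLift]
    refine ext_inner_left ℝ fun w => ?_
    rw [inner_connectionMap_mlieBracket hD w h1 h2, h3, mvfderiv_mvfderiv_pairing_vLift hD w hξ,
      mvfderiv_mvfderiv_pairing_vLift hD w hη]
    simp [dProj_vLift]

end Brackets

/-! ### The metric `h_{p,q}`: nondegeneracy and derivatives of its products. -/

section CheegerGromoll

variable
  {E : Type*} [NormedAddCommGroup E] [NormedSpace ℝ E] [FiniteDimensional ℝ E]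
  {B : Type*} [TopologicalSpace B] [ChartedSpace E B] [IsManifold 𝓘(ℝ, E) ∞ B]
  {F : Type*} [NormedAddCommGroup F] [NormedSpace ℝ F] [FiniteDimensional ℝ F]
  {V : B → Type*} [TopologicalSpace (TotalSpace F V)]
  [∀ x, NormedAddCommGroup (V x)] [∀ x, InnerProductSpace ℝ (V x)] [FiberBundle F V]
  [VectorBundle ℝ F V] [ContMDiffVectorBundle ∞ F V 𝓘(ℝ, E)]

  [IsContMDiffRiemannianBundle 𝓘(ℝ, E) ∞ F V]
  [RiemannianBundle (fun x : B => TangentSpace 𝓘(ℝ, E) x)]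
  {D : (∀ x, V x) → ∀ x, TangentSpace 𝓘(ℝ, E) x →L[ℝ] V x} {p q : ℝ}
  {X Y Z : ∀ y : B, TangentSpace 𝓘(ℝ, E) y} {ξ η ζ : ∀ x, V x} {θ : TotalSpace F V}

/-- Expanding `v` in the orthonormal basis requires linearity of the curvature in that argument,
which its tensoriality supplies. -/
theorem inner_curvatureAdjoint (hD : IsMetricConnection (F := F) D) {x : B} (ξ η : V x)
    (u v : TangentSpace 𝓘(ℝ, E) x) :
    (inner ℝ (curvatureAdjoint (F := F) D x ξ η u) v : ℝ) =
      inner ℝ (curvature (F := F) D x u v ξ) η := by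
  have h := (stdOrthonormalBasis ℝ (TangentSpace 𝓘(ℝ, E) x)).sum_repr' v
  conv_rhs => rw [← h, curvature_eq_mkHom hD, map_sum, sum_inner]
  rw [curvatureAdjoint, sum_inner]
  refine Finset.sum_congr rfl fun i _ => ?_
  rw [map_smul, inner_smul_left, inner_smul_left, ← curvature_eq_mkHom hD]
  simp
  ring

theorem omega_pos (θ : TotalSpace F V) : 0 < omega θ := by
  have : 0 ≤ (inner ℝ θ.2 θ.2 : ℝ) := real_inner_self_nonneg
  rw [omega]
  positivity

theorem cheegerGromoll_sub (A A' C : TangentSpace (𝓘(ℝ, E).prod 𝓘(ℝ, F)) θ) :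
    cheegerGromoll D p q θ (A - A') C = cheegerGromoll D p q θ A C - cheegerGromoll D p q θ A' C := by
  simp only [cheegerGromoll, map_sub, connectionMap_sub, inner_sub_left]
  ring

theorem cheegerGromoll_comm (A C : TangentSpace (𝓘(ℝ, E).prod 𝓘(ℝ, F)) θ) :
    cheegerGromoll D p q θ A C = cheegerGromoll D p q θ C A := by
  simp only [cheegerGromoll, real_inner_comm (dProj θ A), real_inner_comm (connectionMap D θ A)]
  ring

theorem cheegerGromoll_hLift (A : TangentSpace (𝓘(ℝ, E).prod 𝓘(ℝ, F)) θ)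
    (u : TangentSpace 𝓘(ℝ, E) θ.proj) :
    cheegerGromoll D p q θ A (hLift D θ u) = inner ℝ (dProj θ A) u := by
  simp [cheegerGromoll, dProj_hLift, connectionMap_hLift]

theorem cheegerGromoll_vLift (A : TangentSpace (𝓘(ℝ, E).prod 𝓘(ℝ, F)) θ) (w : V θ.proj) :
    cheegerGromoll D p q θ A (vLift E θ w) = omega θ ^ p * (inner ℝ (connectionMap D θ A) w +
      q * inner ℝ (connectionMap D θ A) θ.2 * inner ℝ w θ.2) := by
  simp [cheegerGromoll, dProj_vLift, connectionMap_vLift]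

/-- Nondegeneracy of `h_{p,q}`; it reduces each formula for the connection to its products with
lifts of single vectors. -/
theorem eq_of_cheegerGromoll (hq : 0 ≤ q) {A C : TangentSpace (𝓘(ℝ, E).prod 𝓘(ℝ, F)) θ}
    (h1 : ∀ u, cheegerGromoll D p q θ A (hLift D θ u) = cheegerGromoll D p q θ C (hLift D θ u))
    (h2 : ∀ w, cheegerGromoll D p q θ A (vLift E θ w) = cheegerGromoll D p q θ C (vLift E θ w)) :
    A = C := by
  apply eq_of_dProj_connectionMap D
  · refine ext_inner_right ℝ fun u => ?_
    have := h1 u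
    rwa [cheegerGromoll_hLift, cheegerGromoll_hLift] at this
  -- Testing on the difference `δ = K A - K C` itself and cancelling `ω^p > 0` gives `|δ|² + q⟨δ,
  -- θ⟩² = 0`, which forces `δ = 0` because `q ≥ 0`.
  · have h3 := h2 (connectionMap D θ A - connectionMap D θ C)
    rw [cheegerGromoll_vLift, cheegerGromoll_vLift] at h3
    have h4 := mul_left_cancel₀ (Real.rpow_pos_of_pos (omega_pos θ) p).ne' h3
    have h5 : (inner ℝ (connectionMap D θ A - connectionMap D θ C)
        (connectionMap D θ A - connectionMap D θ C) : ℝ) +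
        q * (inner ℝ (connectionMap D θ A - connectionMap D θ C) θ.2 : ℝ) ^ 2 = 0 := by
      have h6 := inner_sub_left (𝕜 := ℝ) (connectionMap D θ A) (connectionMap D θ C)
        (connectionMap D θ A - connectionMap D θ C)
      have h7 := inner_sub_left (𝕜 := ℝ) (connectionMap D θ A) (connectionMap D θ C) θ.2
      linear_combination h4 + h6 +
        q * (inner ℝ (connectionMap D θ A - connectionMap D θ C) θ.2 : ℝ) * h7
    have h6 : 0 ≤ q * (inner ℝ (connectionMap D θ A - connectionMap D θ C) θ.2 : ℝ) ^ 2 := by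
      positivity
    have h7 := real_inner_self_nonneg (x := connectionMap D θ A - connectionMap D θ C)
    exact sub_eq_zero.1 (inner_self_eq_zero.1 (by linarith : (inner ℝ _ _ : ℝ) = 0))

theorem mvfderiv_comp_real {E' H' N : Type*} [NormedAddCommGroup E'] [NormedSpace ℝ E']
    [TopologicalSpace H'] {I' : ModelWithCorners ℝ E' H'} [TopologicalSpace N] [ChartedSpace H' N]
    {r : ℝ → ℝ} {r' : ℝ} {g : N → ℝ} {x : N} (hr : HasDerivAt r r' (g x))
    (hg : MDifferentiableAt I' 𝓘(ℝ, ℝ) g x) (v : TangentSpace I' x) :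
    mvfderiv I' (fun y => r (g y)) x v = r' * mvfderiv I' g x v := by
  have h := mvfderiv_comp_apply x hr.differentiableAt.mdifferentiableAt hg v
  refine h.trans ?_
  have h2 : mvfderiv 𝓘(ℝ, ℝ) r (g x) = fderiv ℝ r (g x) := mfderiv_eq_fderiv
  rw [h2, hr.hasFDerivAt.fderiv]
  change mvfderiv I' g x v • r' = _
  rw [smul_eq_mul, mul_comm]

/-- With `s = ⟨θ, θ⟩` this reads `d(ω^p)/ds = -p ω^p ω`; keeping the factor `ω^p` apart lets it be
factored out of the whole derivative of the metric. -/
theorem hasDerivAt_one_div_one_add_rpow {s : ℝ} (hs : 0 ≤ s) (p : ℝ) :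
    HasDerivAt (fun s : ℝ => (1 / (1 + s)) ^ p) (-(p * (1 / (1 + s)) ^ p * (1 / (1 + s)))) s := by
  have h0 : (1 + s) ≠ 0 := by positivity
  have h1 : HasDerivAt (fun s : ℝ => 1 / (1 + s)) (-1 / (1 + s) ^ 2) s := by
    simp only [one_div]
    exact ((hasDerivAt_id s).const_add 1).inv h0
  have h2 := h1.rpow_const (p := p) (Or.inl (by positivity))
  refine h2.congr_deriv ?_
  rw [Real.rpow_sub_one (by positivity)]
  field_simp

theorem mdifferentiableAt_omega_rpow (θ : TotalSpace F V) (p : ℝ) :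
    MDifferentiableAt (𝓘(ℝ, E).prod 𝓘(ℝ, F)) 𝓘(ℝ, ℝ)
      (fun θ' : TotalSpace F V => omega θ' ^ p) θ :=
  MDifferentiableAt.comp θ
    ((hasDerivAt_one_div_one_add_rpow (s := (inner ℝ θ.2 θ.2 : ℝ)) real_inner_self_nonneg
      p).differentiableAt.mdifferentiableAt) (mdifferentiableAt_inner_self θ)

theorem mvfderiv_omega_rpow (hD : IsMetricConnection (F := F) D)
    (A : TangentSpace (𝓘(ℝ, E).prod 𝓘(ℝ, F)) θ) :
    mvfderiv (𝓘(ℝ, E).prod 𝓘(ℝ, F)) (fun θ' : TotalSpace F V => omega θ' ^ p) θ A =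
      -(2 * p * omega θ ^ p * omega θ * inner ℝ (connectionMap D θ A) θ.2) := by
  have h := mvfderiv_comp_real (g := fun θ' : TotalSpace F V => (inner ℝ θ'.2 θ'.2 : ℝ))
    (x := θ) (hasDerivAt_one_div_one_add_rpow
    (s := (inner ℝ θ.2 θ.2 : ℝ)) real_inner_self_nonneg p) (mdifferentiableAt_inner_self (E := E) θ) A
  rw [mvfderiv_inner_self hD] at h
  refine h.trans ?_
  rw [omega]
  ring

/-- The derivative of `h_{p,q}(η^v, ζ^v)`. -/
theorem mvfderiv_cheegerGromoll_vLift (hD : IsMetricConnection (F := F) D)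
    (hη : MDifferentiableAt 𝓘(ℝ, E) (𝓘(ℝ, E).prod 𝓘(ℝ, F))
      (fun y => (⟨y, η y⟩ : TotalSpace F V)) θ.proj)
    (hζ : MDifferentiableAt 𝓘(ℝ, E) (𝓘(ℝ, E).prod 𝓘(ℝ, F))
      (fun y => (⟨y, ζ y⟩ : TotalSpace F V)) θ.proj)
    (A : TangentSpace (𝓘(ℝ, E).prod 𝓘(ℝ, F)) θ) :
    mvfderiv (𝓘(ℝ, E).prod 𝓘(ℝ, F)) (fun θ' : TotalSpace F V =>
      cheegerGromoll D p q θ' (vLift E θ' (η θ'.proj)) (vLift E θ' (ζ θ'.proj))) θ A =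
    omega θ ^ p * (-(2 * p * omega θ * inner ℝ (connectionMap D θ A) θ.2) *
        (inner ℝ (η θ.proj) (ζ θ.proj) + q * inner ℝ (η θ.proj) θ.2 * inner ℝ (ζ θ.proj) θ.2) +
      (inner ℝ (D η θ.proj (dProj θ A)) (ζ θ.proj) + inner ℝ (η θ.proj) (D ζ θ.proj (dProj θ A))) +
      q * ((inner ℝ (D η θ.proj (dProj θ A)) θ.2 + inner ℝ (η θ.proj) (connectionMap D θ A)) *
        inner ℝ (ζ θ.proj) θ.2 + inner ℝ (η θ.proj) θ.2 *
        (inner ℝ (D ζ θ.proj (dProj θ A)) θ.2 + inner ℝ (ζ θ.proj) (connectionMap D θ A)))) := by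
  -- The product of two vertical lifts is `ω^p` times a function of the base point plus `q` times a
  -- product of two pairings, so the product rule applies to factors whose derivatives are known.
  have h0 : (fun θ' : TotalSpace F V => cheegerGromoll D p q θ' (vLift E θ' (η θ'.proj))
      (vLift E θ' (ζ θ'.proj))) = (fun θ' : TotalSpace F V => omega θ' ^ p) *
      ((fun θ' : TotalSpace F V => (inner ℝ (η θ'.proj) (ζ θ'.proj) : ℝ)) +
        (fun _ : TotalSpace F V => q) * (pairing η * pairing ζ)) := by
    funext θ'
    simp only [cheegerGromoll_vLift, connectionMap_vLift, Pi.mul_apply, Pi.add_apply, pairing]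
    ring
  have hηζ := MDifferentiableAt.inner_bundle hη hζ
  have h1 := mdifferentiableAt_omega_rpow (E := E) θ p
  have h2 := mdifferentiableAt_comp_proj (F := F) (V := V) hηζ
  have h3 := mdifferentiableAt_pairing hη
  have h4 := mdifferentiableAt_pairing hζ
  have h5 : MDifferentiableAt (𝓘(ℝ, E).prod 𝓘(ℝ, F)) 𝓘(ℝ, ℝ) (fun _ : TotalSpace F V => q) θ :=
    mdifferentiableAt_const
  rw [h0, mvfderiv_mul h1 (h2.add (h5.mul (h3.mul h4))), mvfderiv_add h2 (h5.mul (h3.mul h4)),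
    mvfderiv_mul h5 (h3.mul h4), mvfderiv_mul h3 h4, mvfderiv_const]
  simp only [add_apply, smul_apply, smul_eq_mul, Pi.mul_apply, Pi.add_apply, mvfderiv_pairing hD hη,
    mvfderiv_pairing hD hζ, mvfderiv_omega_rpow hD, mvfderiv_comp_proj hηζ,
    hD.metric η ζ θ.proj _ hη hζ, smul_zero, zero_apply, pairing]
  ring

end CheegerGromoll

/-! ### The four formulas for the connection and the geometry of the fibres. -/

section Formulas

variable
  {E : Type*} [NormedAddCommGroup E] [NormedSpace ℝ E] [FiniteDimensional ℝ E]
  {B : Type*} [TopologicalSpace B] [ChartedSpace E B] [IsManifold 𝓘(ℝ, E) ∞ B]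
  {F : Type*} [NormedAddCommGroup F] [NormedSpace ℝ F] [FiniteDimensional ℝ F]
  {V : B → Type*} [TopologicalSpace (TotalSpace F V)]
  [∀ x, NormedAddCommGroup (V x)] [∀ x, InnerProductSpace ℝ (V x)] [FiberBundle F V]
  [VectorBundle ℝ F V] [ContMDiffVectorBundle ∞ F V 𝓘(ℝ, E)]
  [IsContMDiffRiemannianBundle 𝓘(ℝ, E) ∞ F V]
  [RiemannianBundle (fun x : B => TangentSpace 𝓘(ℝ, E) x)]
  [IsContMDiffRiemannianBundle 𝓘(ℝ, E) ∞ E (fun x : B => TangentSpace 𝓘(ℝ, E) x)]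
  {D : (∀ x, V x) → ∀ x, TangentSpace 𝓘(ℝ, E) x →L[ℝ] V x} {p q : ℝ}
  {X Y Z : ∀ y : B, TangentSpace 𝓘(ℝ, E) y} {ξ η ζ : ∀ x, V x} {θ : TotalSpace F V}
  {covB : CovariantDerivative 𝓘(ℝ, E) E (TangentSpace 𝓘(ℝ, E) : B → Type _)}
  {cov : CovariantDerivative (𝓘(ℝ, E).prod 𝓘(ℝ, F)) (E × F)
    (TangentSpace (𝓘(ℝ, E).prod 𝓘(ℝ, F)) : TotalSpace F V → Type _)}

theorem mvfderiv_cheegerGromoll_hLift_hLift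
    (hX : MDifferentiableAt 𝓘(ℝ, E) 𝓘(ℝ, E).tangent
      (fun y => (⟨y, X y⟩ : TangentBundle 𝓘(ℝ, E) B)) θ.proj)
    (hY : MDifferentiableAt 𝓘(ℝ, E) 𝓘(ℝ, E).tangent
      (fun y => (⟨y, Y y⟩ : TangentBundle 𝓘(ℝ, E) B)) θ.proj)
    (A : TangentSpace (𝓘(ℝ, E).prod 𝓘(ℝ, F)) θ) :
    mvfderiv (𝓘(ℝ, E).prod 𝓘(ℝ, F)) (fun θ' : TotalSpace F V =>
      cheegerGromoll D p q θ' (hLift D θ' (X θ'.proj)) (hLift D θ' (Y θ'.proj))) θ A =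
    mvfderiv 𝓘(ℝ, E) (fun y => (inner ℝ (X y) (Y y) : ℝ)) θ.proj (dProj θ A) := by
  simp only [cheegerGromoll_hLift, dProj_hLift]
  exact mvfderiv_comp_proj (MDifferentiableAt.inner_bundle (IB := 𝓘(ℝ, E)) (F := E)
    (E := fun x : B => TangentSpace 𝓘(ℝ, E) x) (b := fun y => y) hX hY) A

theorem cheegerGromoll_hLift_vLift (u : TangentSpace 𝓘(ℝ, E) θ.proj) (w : V θ.proj) :
    cheegerGromoll D p q θ (hLift D θ u) (vLift E θ w) = 0 := by
  simp [cheegerGromoll_vLift, connectionMap_hLift]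

theorem cheegerGromoll_vLift_hLift (u : TangentSpace 𝓘(ℝ, E) θ.proj) (w : V θ.proj) :
    cheegerGromoll D p q θ (vLift E θ w) (hLift D θ u) = 0 := by
  simp [cheegerGromoll_hLift, dProj_vLift]

theorem cheegerGromoll_hLift_hLift (u v : TangentSpace 𝓘(ℝ, E) θ.proj) :
    cheegerGromoll D p q θ (hLift D θ u) (hLift D θ v) = inner ℝ u v := by
  rw [cheegerGromoll_hLift, dProj_hLift]

theorem cheegerGromoll_vLift_vLift (w w' : V θ.proj) :
    cheegerGromoll D p q θ (vLift E θ w) (vLift E θ w') = omega θ ^ p * (inner ℝ w w' +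
      q * inner ℝ w θ.2 * inner ℝ w' θ.2) := by
  rw [cheegerGromoll_vLift, connectionMap_vLift]

theorem cheegerGromoll_add (A A' C : TangentSpace (𝓘(ℝ, E).prod 𝓘(ℝ, F)) θ) :
    cheegerGromoll D p q θ (A + A') C = cheegerGromoll D p q θ A C + cheegerGromoll D p q θ A' C := by
  simp only [cheegerGromoll, map_add, connectionMap_add, inner_add_left]
  ring

theorem cheegerGromoll_smul (c : ℝ) (A C : TangentSpace (𝓘(ℝ, E).prod 𝓘(ℝ, F)) θ) :
    cheegerGromoll D p q θ (c • A) C = c * cheegerGromoll D p q θ A C := by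
  simp only [cheegerGromoll, map_smul, connectionMap_smul, real_inner_smul_left]
  ring

theorem cheegerGromoll_neg (A C : TangentSpace (𝓘(ℝ, E).prod 𝓘(ℝ, F)) θ) :
    cheegerGromoll D p q θ (-A) C = -cheegerGromoll D p q θ A C := by
  simpa using cheegerGromoll_smul (D := D) (p := p) (q := q) (-1) A C

theorem cheegerGromoll_zero (C : TangentSpace (𝓘(ℝ, E).prod 𝓘(ℝ, F)) θ) :
    cheegerGromoll D p q θ 0 C = 0 := by
  simpa using cheegerGromoll_smul (D := D) (p := p) (q := q) 0 0 C

theorem inner_curvature_self (hD : IsMetricConnection (F := F) D) {x : B}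
    (u v : TangentSpace 𝓘(ℝ, E) x) (w : V x) :
    (inner ℝ (curvature (F := F) D x u v w) w : ℝ) = 0 := by
  have h := inner_curvature_skew hD u v w w
  have h' := real_inner_comm w (curvature (F := F) D x u v w)
  linarith

theorem mvfderiv_zero_apply (A : TangentSpace (𝓘(ℝ, E).prod 𝓘(ℝ, F)) θ) :
    mvfderiv (𝓘(ℝ, E).prod 𝓘(ℝ, F)) (fun _ : TotalSpace F V => (0 : ℝ)) θ A = 0 := by
  rw [mvfderiv_const]
  rfl

variable (hq : 0 ≤ q) (hD : IsMetricConnection (F := F) D)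
  (hB : IsLeviCivita (fun _ u v => inner ℝ u v) covB)
  (hcov : IsLeviCivita (cheegerGromoll D p q) cov)

include hq hD hB hcov in
-- Against `Z^h`, the products are functions of the base and the vertical parts of the brackets are
-- orthogonal to horizontal lifts, so the Koszul formula is that of the base. Against `w^v`, the
-- function `⟨X, Y⟩` is constant on fibres and the mixed products vanish, leaving only the vertical
-- part of `[X^h, Y^h]`, halved.
theorem cov_hLift_hLift
    (hX : MDifferentiableAt 𝓘(ℝ, E) 𝓘(ℝ, E).tangent
      (fun y => (⟨y, X y⟩ : TangentBundle 𝓘(ℝ, E) B)) θ.proj)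
    (hY : MDifferentiableAt 𝓘(ℝ, E) 𝓘(ℝ, E).tangent
      (fun y => (⟨y, Y y⟩ : TangentBundle 𝓘(ℝ, E) B)) θ.proj) :
    cov (fun θ => hLift D θ (Y θ.proj)) θ (hLift D θ (X θ.proj)) =
      hLift D θ (covB Y θ.proj (X θ.proj)) -
        (1 / 2 : ℝ) • vLift E θ (curvature (F := F) D θ.proj (X θ.proj) (Y θ.proj) θ.2) := by
  have hXh := mdifferentiableAt_hLift hD hX
  have hYh := mdifferentiableAt_hLift hD hY
  apply eq_of_cheegerGromoll (D := D) (p := p) hq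
  · intro u
    have hZ := mdifferentiableAt_extend_field u
    have h1 := hcov.koszul cheegerGromoll_sub cheegerGromoll_comm hXh hYh
      (mdifferentiableAt_hLift hD hZ)
    have h2 := hB.koszul (fun _ _ _ => inner_sub_left _ _ _) (fun _ _ => real_inner_comm _ _)
      hX hY hZ
    rw [mvfderiv_cheegerGromoll_hLift_hLift hX hY, mvfderiv_cheegerGromoll_hLift_hLift hX hZ,
      mvfderiv_cheegerGromoll_hLift_hLift hY hZ] at h1
    simp only [mlieBracket_hLift_hLift hD hX hY,
      mlieBracket_hLift_hLift hD hX hZ, mlieBracket_hLift_hLift hD hY hZ, cheegerGromoll_sub,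
      cheegerGromoll_hLift_hLift, cheegerGromoll_vLift_hLift, dProj_hLift,
      FiberBundle.extend_apply_self] at h1 h2
    rw [cheegerGromoll_sub, cheegerGromoll_smul, cheegerGromoll_hLift_hLift,
      cheegerGromoll_vLift_hLift]
    linarith
  · intro w
    have hζ := mdifferentiableAt_extend_section (E := E) (F := F) w
    have h1 := hcov.koszul cheegerGromoll_sub cheegerGromoll_comm hXh hYh
      (mdifferentiableAt_vLift hζ)
    rw [mvfderiv_cheegerGromoll_hLift_hLift hX hY] at h1
    simp only [cheegerGromoll_hLift_vLift,
      mvfderiv_zero_apply, dProj_vLift, map_zero, mlieBracket_hLift_hLift hD hX hY,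
      mlieBracket_hLift_vLift hD hX hζ, mlieBracket_hLift_vLift hD hY hζ, cheegerGromoll_sub,
      cheegerGromoll_vLift_hLift, FiberBundle.extend_apply_self] at h1
    rw [cheegerGromoll_sub, cheegerGromoll_smul, cheegerGromoll_hLift_vLift]
    linarith

include hq hD hB hcov in
-- Against `Z^h` only `-h([X^h, Z^h], η^v)` survives, which is `ω^p⟨R(X, Z)θ, η⟩` plus a multiple of
-- `q⟨R(X, Z)θ, θ⟩`. The latter is zero by skewness, so `q` does not enter. Against `w^v` the factor
-- `ω^p` is constant along `X^h`, and the derivative and bracket terms combine to twice the product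
-- with `(D_X η)^v`.
theorem cov_hLift_vLift
    (hX : MDifferentiableAt 𝓘(ℝ, E) 𝓘(ℝ, E).tangent
      (fun y => (⟨y, X y⟩ : TangentBundle 𝓘(ℝ, E) B)) θ.proj)
    (hη : MDifferentiableAt 𝓘(ℝ, E) (𝓘(ℝ, E).prod 𝓘(ℝ, F))
      (fun y => (⟨y, η y⟩ : TotalSpace F V)) θ.proj) :
    cov (fun θ => vLift E θ (η θ.proj)) θ (hLift D θ (X θ.proj)) =
      ((1 / 2 : ℝ) * omega θ ^ p) •
        hLift D θ (curvatureAdjoint (F := F) D θ.proj θ.2 (η θ.proj) (X θ.proj)) +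
      vLift E θ (D η θ.proj (X θ.proj)) := by
  have hXh := mdifferentiableAt_hLift hD hX
  have hηv := mdifferentiableAt_vLift hη
  apply eq_of_cheegerGromoll (D := D) (p := p) hq
  · intro u
    have hZ := mdifferentiableAt_extend_field u
    have h1 := hcov.koszul cheegerGromoll_sub cheegerGromoll_comm hXh hηv
      (mdifferentiableAt_hLift hD hZ)
    rw [mvfderiv_cheegerGromoll_hLift_hLift hX hZ] at h1
    simp only [cheegerGromoll_vLift_hLift,
      cheegerGromoll_hLift_vLift, VectorField.mlieBracket_swap_apply (V := fun θ => vLift E θ (η θ.proj)),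
      mvfderiv_zero_apply, dProj_vLift, map_zero, mlieBracket_hLift_vLift hD hX hη,
      mlieBracket_hLift_vLift hD hZ hη, mlieBracket_hLift_hLift hD hX hZ,
      cheegerGromoll_sub, cheegerGromoll_neg, cheegerGromoll_vLift_vLift,
      inner_curvature_self hD,
      FiberBundle.extend_apply_self] at h1
    rw [cheegerGromoll_add, cheegerGromoll_smul, cheegerGromoll_hLift_hLift,
      cheegerGromoll_vLift_hLift, inner_curvatureAdjoint hD]
    linarith
  · intro w
    have hζ := mdifferentiableAt_extend_section (E := E) (F := F) w
    have h1 := hcov.koszul cheegerGromoll_sub cheegerGromoll_comm hXh hηv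
      (mdifferentiableAt_vLift hζ)
    rw [mvfderiv_cheegerGromoll_vLift hD hη hζ] at h1
    simp only [cheegerGromoll_hLift_vLift, mvfderiv_zero_apply, dProj_hLift, connectionMap_hLift,
      mlieBracket_hLift_vLift hD hX hη, mlieBracket_hLift_vLift hD hX hζ,
      mlieBracket_vLift_vLift hD hη hζ, cheegerGromoll_vLift_vLift, cheegerGromoll_zero,
      inner_zero_left, inner_zero_right,
      FiberBundle.extend_apply_self] at h1
    rw [cheegerGromoll_add, cheegerGromoll_smul, cheegerGromoll_hLift_vLift,
      cheegerGromoll_vLift_vLift]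
    have h2 := real_inner_comm (η θ.proj) (D (FiberBundle.extend F w) θ.proj (X θ.proj))
    linear_combination h1 / 2 - omega θ ^ p * h2 / 2

include hq hD hB hcov in
-- By vanishing torsion this differs from the previous formula by `[Y^h, η^v] = (D_Y η)^v`, which is
-- exactly its vertical term.
theorem cov_vLift_hLift
    (hY : MDifferentiableAt 𝓘(ℝ, E) 𝓘(ℝ, E).tangent
      (fun y => (⟨y, Y y⟩ : TangentBundle 𝓘(ℝ, E) B)) θ.proj)
    (hη : MDifferentiableAt 𝓘(ℝ, E) (𝓘(ℝ, E).prod 𝓘(ℝ, F))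
      (fun y => (⟨y, η y⟩ : TotalSpace F V)) θ.proj) :
    cov (fun θ => hLift D θ (Y θ.proj)) θ (vLift E θ (η θ.proj)) =
      ((1 / 2 : ℝ) * omega θ ^ p) •
        hLift D θ (curvatureAdjoint (F := F) D θ.proj θ.2 (η θ.proj) (Y θ.proj)) := by
  have h1 := hcov.torsion_free _ _ θ (mdifferentiableAt_hLift hD hY) (mdifferentiableAt_vLift hη)
  rw [mlieBracket_hLift_vLift hD hY hη, cov_hLift_vLift hq hD hB hcov hY hη] at h1
  rw [sub_eq_iff_eq_add, add_comm _ (vLift E θ _)] at h1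
  exact (add_left_cancel h1).symm

include hq hD hcov in
-- Against `Z^h` the derivative of `h(ξ^v, η^v)` is cancelled by the brackets, as `D` is metric.
-- Against `w^v` all brackets vanish. The multiples of `ξ^v` and `η^v` are read off from the
-- derivatives of `ω^p`; what is left is a multiple of `⟨θ, w⟩`, and since `h(Θ, w^v) = ω^p (1 +
-- q⟨θ, θ⟩)⟨θ, w⟩`, division by `1 + q⟨θ, θ⟩` gives `ν` and `μ`.
theorem cov_vLift_vLift
    (hξ : MDifferentiableAt 𝓘(ℝ, E) (𝓘(ℝ, E).prod 𝓘(ℝ, F))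
      (fun y => (⟨y, ξ y⟩ : TotalSpace F V)) θ.proj)
    (hη : MDifferentiableAt 𝓘(ℝ, E) (𝓘(ℝ, E).prod 𝓘(ℝ, F))
      (fun y => (⟨y, η y⟩ : TotalSpace F V)) θ.proj) :
    cov (fun θ => vLift E θ (η θ.proj)) θ (vLift E θ (ξ θ.proj)) =
      -(p * omega θ) • (inner ℝ (ξ θ.proj) θ.2 • vLift E θ (η θ.proj) +
        inner ℝ (η θ.proj) θ.2 • vLift E θ (ξ θ.proj)) +
      (p * q * omega θ / (q * inner ℝ θ.2 θ.2 + 1) * inner ℝ (ξ θ.proj) θ.2 *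
          inner ℝ (η θ.proj) θ.2 +
        (q + p * omega θ) / (q * inner ℝ θ.2 θ.2 + 1) * inner ℝ (ξ θ.proj) (η θ.proj)) •
          canonicalField θ := by
  have hξv := mdifferentiableAt_vLift hξ
  have hηv := mdifferentiableAt_vLift hη
  apply eq_of_cheegerGromoll (D := D) (p := p) hq
  · intro u
    have hZ := mdifferentiableAt_extend_field u
    have h1 := hcov.koszul cheegerGromoll_sub cheegerGromoll_comm hξv hηv
      (mdifferentiableAt_hLift hD hZ)
    rw [mvfderiv_cheegerGromoll_vLift hD hξ hη] at h1
    simp only [cheegerGromoll_vLift_hLift,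
      VectorField.mlieBracket_swap_apply (V := fun θ => vLift E θ (η θ.proj))
        (W := fun θ : TotalSpace F V => hLift D θ (FiberBundle.extend E u θ.proj)),
      VectorField.mlieBracket_swap_apply (V := fun θ => vLift E θ (ξ θ.proj))
        (W := fun θ : TotalSpace F V => hLift D θ (FiberBundle.extend E u θ.proj)),
      mvfderiv_zero_apply, dProj_hLift, 
      connectionMap_hLift, mlieBracket_vLift_vLift hD hξ hη,
      mlieBracket_hLift_vLift hD hZ hη, mlieBracket_hLift_vLift hD hZ hξ,
      cheegerGromoll_neg, cheegerGromoll_vLift_vLift, cheegerGromoll_zero, inner_zero_left,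
      inner_zero_right, FiberBundle.extend_apply_self] at h1
    simp only [canonicalField, cheegerGromoll_add, cheegerGromoll_smul, cheegerGromoll_vLift_hLift]
    have h2 := real_inner_comm (ξ θ.proj) (D η θ.proj u)
    linear_combination h1 / 2 + omega θ ^ p * h2 / 2
  · intro w
    have hζ := mdifferentiableAt_extend_section (E := E) (F := F) w
    have h1 := hcov.koszul cheegerGromoll_sub cheegerGromoll_comm hξv hηv
      (mdifferentiableAt_vLift hζ)
    rw [mvfderiv_cheegerGromoll_vLift hD hη hζ, mvfderiv_cheegerGromoll_vLift hD hξ hζ,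
      mvfderiv_cheegerGromoll_vLift hD hξ hη] at h1
    simp only [dProj_vLift, connectionMap_vLift, map_zero,
      mlieBracket_vLift_vLift hD hη hζ, mlieBracket_vLift_vLift hD hξ hζ,
      mlieBracket_vLift_vLift hD hξ hη, cheegerGromoll_zero,
      inner_zero_left, inner_zero_right, FiberBundle.extend_apply_self] at h1
    simp only [canonicalField, cheegerGromoll_add, cheegerGromoll_smul, cheegerGromoll_vLift_vLift]
    have ht : 0 ≤ (inner ℝ θ.2 θ.2 : ℝ) := real_inner_self_nonneg
    have ht' : q * (inner ℝ θ.2 θ.2 : ℝ) + 1 ≠ 0 := by positivity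
    rw [real_inner_comm (ξ θ.proj) w,
      real_inner_comm (η θ.proj) w, real_inner_comm (ξ θ.proj) (η θ.proj)] at h1
    rw [real_inner_comm w θ.2]
    -- From here on the identity is rational in independent quantities; the relation between `ω` and
    -- `⟨θ, θ⟩` is not used.
    generalize omega θ ^ p = W at *
    generalize (inner ℝ θ.2 θ.2 : ℝ) = t at *
    field_simp
    -- The factor `q t + 1` clears the denominators of `ν` and `μ`, and `1 / 2` undoes the factor
    -- `2` of the Koszul formula.
    linear_combination (q * t + 1) / 2 * h1

include hq hD hB hcov in
-- The given field is vertical only along the fibre and need not be a vertical lift, so the formula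
-- for `∇_{ξ^v} η^v` does not apply to it directly. Instead `h(A, Y^h) = 0` is differentiated along
-- the fibre: as `∇_{w^v} Y^h` is horizontal and `A` is vertical at the point, `∇_{w^v} A` is
-- orthogonal to every horizontal vector.
theorem isTotallyGeodesic_fibre (x : B) :
    IsTotallyGeodesic cov ((TotalSpace.proj : TotalSpace F V → B) ⁻¹' {x})
      (fun θ => LinearMap.ker (dProj θ).toLinearMap) := by
  intro n hn a ha A hA hAn
  have hker : ∀ {m : TotalSpace F V} {c : TangentSpace (𝓘(ℝ, E).prod 𝓘(ℝ, F)) m},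
      c ∈ LinearMap.ker (dProj m).toLinearMap ↔ dProj m c = 0 := Iff.rfl
  simp only [hker] at ha hAn ⊢
  have ha' : vLift E n (connectionMap D n a) = a := by
    have h := hLift_add_vLift D n a
    rw [ha] at h
    have h0 : hLift D n 0 = 0 := by
      apply eq_of_dProj_connectionMap D
      · rw [dProj_hLift, map_zero]
      · rw [connectionMap_hLift, ← vLift_zero, connectionMap_vLift]
    rwa [h0, zero_add] at h
  generalize connectionMap D n a = w at ha'
  subst ha'
  refine ext_inner_right ℝ fun u => ?_
  rw [inner_zero_left]
  have hY := mdifferentiableAt_extend_field u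
  have hYh := mdifferentiableAt_hLift hD hY
  have h1 := hcov.metric A _ n (vLift E n w) hA hYh
  have h2 := cov_vLift_hLift hq hD hB hcov hY
    (mdifferentiableAt_extend_section (E := E) (F := F) w)
  rw [FiberBundle.extend_apply_self] at h2
  rw [h2, cheegerGromoll_comm (A n), cheegerGromoll_smul, cheegerGromoll_comm _ (A n)] at h1
  simp only [cheegerGromoll_hLift, FiberBundle.extend_apply_self, hAn.self_of_nhdsWithin hn,
    inner_zero_left, mul_zero, add_zero] at h1
  rw [← h1]
  set g : TotalSpace F V → ℝ := fun m => inner ℝ (dProj m (A m)) (FiberBundle.extend E u m.proj)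
  -- Outside the fibre nothing is known about `g`. Where it is differentiable, its vertical
  -- derivative is taken along a line in the fibre, on which `g` vanishes near `n`; otherwise the
  -- derivative is zero by convention.
  by_cases hg : MDifferentiableAt (𝓘(ℝ, E).prod 𝓘(ℝ, F)) 𝓘(ℝ, ℝ) g n
  · refine mvfderiv_vLift hg ((hasDerivAt_const (0 : ℝ) (0 : ℝ)).congr_of_eventuallyEq ?_)
    have hc : Tendsto (fun t : ℝ => (⟨n.proj, n.2 + t • w⟩ : TotalSpace F V)) (𝓝 0)
        (𝓝[TotalSpace.proj ⁻¹' {x}] n) := by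
      refine tendsto_nhdsWithin_iff.2 ⟨?_, .of_forall fun _ => hn⟩
      have h3 := (mdifferentiableAt_fibre_line (E := E) n w 0).continuousAt
      have h4 : (⟨n.proj, n.2 + (0 : ℝ) • w⟩ : TotalSpace F V) = n := by simp
      rwa [ContinuousAt, h4] at h3
    filter_upwards [hc.eventually hAn] with t ht
    simp only [g, ht, inner_zero_left]
  · exact congrArg (fun T => T (vLift E n w)) (mfderiv_zero_of_not_mdifferentiableAt hg)

end Formulas

/-! ### Regularity of the image of a vector field under a differential. -/

section DerivativeOfFields

variable {E : Type*} [NormedAddCommGroup E] [NormedSpace ℝ E]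
  {H : Type*} [TopologicalSpace H] {I : ModelWithCorners ℝ E H}
  {N : Type*} [TopologicalSpace N] [ChartedSpace H N] [IsManifold I ∞ N]
  {E' : Type*} [NormedAddCommGroup E'] [NormedSpace ℝ E']
  {H' : Type*} [TopologicalSpace H'] {I' : ModelWithCorners ℝ E' H'}
  {N' : Type*} [TopologicalSpace N'] [ChartedSpace H' N'] [IsManifold I' ∞ N']
  {G : Type*} [NormedAddCommGroup G] [NormedSpace ℝ G]

theorem mdifferentiableAt_mfderiv_apply {φ : N → N'} {x : N} (hφ : ContMDiffAt I I' ∞ φ x)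
    {X : ∀ y : N, TangentSpace I y}
    (hX : MDifferentiableAt I I.tangent (fun y => (⟨y, X y⟩ : TangentBundle I N)) x) :
    MDifferentiableAt I I'.tangent
      (fun y => (⟨φ y, mfderiv I I' φ y (X y)⟩ : TangentBundle I' N')) x := by
  have h1 : ContMDiffAt I 𝓘(ℝ, E →L[ℝ] E') 1
      (inTangentCoordinates I I' id φ (mfderiv I I' φ) x) x :=
    hφ.mfderiv_const (by rw [one_add_one_eq_two]; exact ENat.LEInfty.out)
  exact MDifferentiableAt.clm_apply_of_inCoordinates (b₁ := fun y : N => y) (b₂ := φ)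
    (h1.mdifferentiableAt one_ne_zero) hX (hφ.mdifferentiableAt (by simp))

theorem mdifferentiableAt_mvfderiv_apply {g : N → G} {x : N} (hg : ContMDiffAt I 𝓘(ℝ, G) ∞ g x)
    {X : ∀ y : N, TangentSpace I y}
    (hX : MDifferentiableAt I I.tangent (fun y => (⟨y, X y⟩ : TangentBundle I N)) x) :
    MDifferentiableAt I 𝓘(ℝ, G) (fun y => mvfderiv I g y (X y)) x := by
  have h := mdifferentiableAt_mfderiv_apply hg hX
  rw [mdifferentiableAt_totalSpace] at h
  refine h.2.congr_of_eventuallyEq (.of_forall fun y => ?_)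
  simp
  rfl

end DerivativeOfFields

/-! ### Covariant derivatives of sections along a map. -/

section DerivAlong

variable
  {E : Type*} [NormedAddCommGroup E] [NormedSpace ℝ E] [FiniteDimensional ℝ E]
  {B : Type*} [TopologicalSpace B] [ChartedSpace E B] [IsManifold 𝓘(ℝ, E) ∞ B]
  {F : Type*} [NormedAddCommGroup F] [NormedSpace ℝ F] [FiniteDimensional ℝ F]
  {V : B → Type*} [TopologicalSpace (TotalSpace F V)]
  [∀ x, NormedAddCommGroup (V x)] [∀ x, InnerProductSpace ℝ (V x)] [FiberBundle F V]
  [VectorBundle ℝ F V] [ContMDiffVectorBundle ∞ F V 𝓘(ℝ, E)]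
  {E' : Type*} [NormedAddCommGroup E'] [NormedSpace ℝ E']
  {N : Type*} [TopologicalSpace N] [ChartedSpace E' N] [IsManifold 𝓘(ℝ, E') ∞ N]
  {D : (∀ x, V x) → ∀ x, TangentSpace 𝓘(ℝ, E) x →L[ℝ] V x}
  {φ : N → B} {s t : ∀ y, V (φ y)} {x : N}

variable (D) (φ) in
/-- The covariant derivative of a section `s` along a map `φ`. -/
def derivAlong (s : ∀ y, V (φ y)) (x : N) : TangentSpace 𝓘(ℝ, E') x →L[ℝ] V (φ x) :=
  ((trivializationAt F V (φ x)).symmL ℝ (φ x)).comp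
      (mvfderiv 𝓘(ℝ, E') (fun y => fibreCoord (φ x) (⟨φ y, s y⟩ : TotalSpace F V)) x) +
    (D (FiberBundle.extend F (s x)) (φ x)).comp (mfderiv 𝓘(ℝ, E') 𝓘(ℝ, E) φ x)

theorem mdifferentiableAt_fibreCoord_comp {x₀ : B}
    (hx : φ x ∈ (trivializationAt F V x₀).baseSet)
    (hs : MDifferentiableAt 𝓘(ℝ, E') (𝓘(ℝ, E).prod 𝓘(ℝ, F))
      (fun y => (⟨φ y, s y⟩ : TotalSpace F V)) x) :
    MDifferentiableAt 𝓘(ℝ, E') 𝓘(ℝ, F)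
      (fun y => fibreCoord x₀ (⟨φ y, s y⟩ : TotalSpace F V)) x :=
  MDifferentiableAt.comp (I' := 𝓘(ℝ, E).prod 𝓘(ℝ, F)) (g := fibreCoord x₀) x
    (mdifferentiableAt_fibreCoord (θ := (⟨φ x, s x⟩ : TotalSpace F V)) hx) hs

theorem contMDiffAt_fibreCoord_comp {x₀ : B}
    (hx : φ x ∈ (trivializationAt F V x₀).baseSet)
    (hs : ContMDiffAt 𝓘(ℝ, E') (𝓘(ℝ, E).prod 𝓘(ℝ, F)) ∞
      (fun y => (⟨φ y, s y⟩ : TotalSpace F V)) x) :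
    ContMDiffAt 𝓘(ℝ, E') 𝓘(ℝ, F) ∞
      (fun y => fibreCoord x₀ (⟨φ y, s y⟩ : TotalSpace F V)) x :=
  ((Trivialization.contMDiffAt_iff (e := trivializationAt F V x₀)
    ((trivializationAt F V x₀).mem_source.2 hx)).1 hs).2

theorem mdifferentiableAt_base (hs : MDifferentiableAt 𝓘(ℝ, E') (𝓘(ℝ, E).prod 𝓘(ℝ, F))
      (fun y => (⟨φ y, s y⟩ : TotalSpace F V)) x) :
    MDifferentiableAt 𝓘(ℝ, E') 𝓘(ℝ, E) φ x :=
  ((mdifferentiableAt_totalSpace ..).1 hs).1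

theorem derivAlong_apply (u : TangentSpace 𝓘(ℝ, E') x) :
    derivAlong (F := F) D φ s x u =
      (fibreIso (φ x) (mem_baseSet_trivializationAt F V (φ x))).symm
        (mvfderiv 𝓘(ℝ, E') (fun y => fibreCoord (φ x) (⟨φ y, s y⟩ : TotalSpace F V)) x u) +
      D (FiberBundle.extend F (s x)) (φ x) (mfderiv 𝓘(ℝ, E') 𝓘(ℝ, E) φ x u) := by
  rw [derivAlong, add_apply, ContinuousLinearMap.comp_apply, ContinuousLinearMap.comp_apply]
  congr 1
  exact Trivialization.symmL_apply (R := ℝ) _ (mem_baseSet_trivializationAt F V (φ x)) _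

/-- The derivative along `φ` is the connection map applied to the differential. -/
theorem derivAlong_eq_connectionMap
    (hs : MDifferentiableAt 𝓘(ℝ, E') (𝓘(ℝ, E).prod 𝓘(ℝ, F))
      (fun y => (⟨φ y, s y⟩ : TotalSpace F V)) x) (u : TangentSpace 𝓘(ℝ, E') x) :
    derivAlong (F := F) D φ s x u = connectionMap D (⟨φ x, s x⟩ : TotalSpace F V)
      (mfderiv 𝓘(ℝ, E') (𝓘(ℝ, E).prod 𝓘(ℝ, F)) (fun y => (⟨φ y, s y⟩ : TotalSpace F V)) x u) := by
  have h1 := mfderiv_comp_apply x (mdifferentiableAt_fibreCoord (E := E) (x₀ := φ x)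
    (θ := (⟨φ x, s x⟩ : TotalSpace F V)) (mem_baseSet_trivializationAt F V (φ x))) hs u
  have h2 := mfderiv_comp_apply x (mdifferentiableAt_proj (IB := 𝓘(ℝ, E)) V
    (p := (⟨φ x, s x⟩ : TotalSpace F V))) hs u
  rw [derivAlong_apply, connectionMap_eq]
  congr 1
  · exact congrArg (fibreIso (φ x) (mem_baseSet_trivializationAt F V (φ x))).symm h1
  · exact congrArg (D (FiberBundle.extend F (s x)) (φ x)) h2

theorem derivAlong_add [IsContMDiffRiemannianBundle 𝓘(ℝ, E) ∞ F V]
    (hD : IsMetricConnection (F := F) D)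
    (hs : MDifferentiableAt 𝓘(ℝ, E') (𝓘(ℝ, E).prod 𝓘(ℝ, F))
      (fun y => (⟨φ y, s y⟩ : TotalSpace F V)) x)
    (ht : MDifferentiableAt 𝓘(ℝ, E') (𝓘(ℝ, E).prod 𝓘(ℝ, F))
      (fun y => (⟨φ y, t y⟩ : TotalSpace F V)) x) :
    derivAlong (F := F) (E' := E') D φ (fun y => s y + t y) x =
      derivAlong (F := F) D φ s x + derivAlong (F := F) D φ t x := by
  have hx := mem_baseSet_trivializationAt F V (φ x)
  have h1 : mvfderiv 𝓘(ℝ, E') (fun y => fibreCoord (φ x) (⟨φ y, s y + t y⟩ : TotalSpace F V)) x =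
      mvfderiv 𝓘(ℝ, E') ((fun y => fibreCoord (φ x) (⟨φ y, s y⟩ : TotalSpace F V)) +
        fun y => fibreCoord (φ x) (⟨φ y, t y⟩ : TotalSpace F V)) x := by
    refine EventuallyEq.mfderiv_eq ?_
    filter_upwards [(mdifferentiableAt_base hs).continuousAt.eventually
      (eventually_mem_baseSet (F := F) (V := V) (φ x))] with y hy
    simp only [Pi.add_apply, ← fibreIso_apply hy, map_add]
  have h2 : D (FiberBundle.extend F (s x + t x)) (φ x) = D (FiberBundle.extend F (s x)) (φ x) +
      D (FiberBundle.extend F (t x)) (φ x) := map_add (extendDerivative hD.isCovariantDerivative (φ x) hx) (s x) (t x)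
  ext u
  simp only [add_apply, derivAlong_apply, h1, h2, mvfderiv_add
    (mdifferentiableAt_fibreCoord_comp hx hs) (mdifferentiableAt_fibreCoord_comp hx ht), map_add]
  abel

theorem derivAlong_smul [IsContMDiffRiemannianBundle 𝓘(ℝ, E) ∞ F V]
    (hD : IsMetricConnection (F := F) D) {g : N → ℝ}
    (hs : MDifferentiableAt 𝓘(ℝ, E') (𝓘(ℝ, E).prod 𝓘(ℝ, F))
      (fun y => (⟨φ y, s y⟩ : TotalSpace F V)) x)
    (hg : MDifferentiableAt 𝓘(ℝ, E') 𝓘(ℝ, ℝ) g x) (u : TangentSpace 𝓘(ℝ, E') x) :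
    derivAlong (F := F) D φ (fun y => g y • s y) x u =
      g x • derivAlong (F := F) D φ s x u + mvfderiv 𝓘(ℝ, E') g x u • s x := by
  have hx := mem_baseSet_trivializationAt F V (φ x)
  have h1 : mvfderiv 𝓘(ℝ, E') (fun y => fibreCoord (φ x) (⟨φ y, g y • s y⟩ : TotalSpace F V)) x =
      mvfderiv 𝓘(ℝ, E') (g • (fun y => fibreCoord (φ x) (⟨φ y, s y⟩ : TotalSpace F V))) x := by
    refine EventuallyEq.mfderiv_eq ?_
    filter_upwards [(mdifferentiableAt_base hs).continuousAt.eventually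
      (eventually_mem_baseSet (F := F) (V := V) (φ x))] with y hy
    simp only [Pi.smul_apply', ← fibreIso_apply hy, map_smul]
  have h2 : D (FiberBundle.extend F (g x • s x)) (φ x) = g x • D (FiberBundle.extend F (s x)) (φ x) :=
    map_smul (extendDerivative hD.isCovariantDerivative (φ x) hx) (g x) (s x)
  simp only [derivAlong_apply, h1, h2, mvfderiv_smul hg (mdifferentiableAt_fibreCoord_comp hx hs),
    add_apply, smul_apply, map_add, map_smul, ContinuousLinearMap.smulRight_apply, smul_add]
  rw [← fibreIso_apply hx, ContinuousLinearEquiv.symm_apply_apply]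
  abel

theorem mdifferentiableAt_add_along
    (hs : MDifferentiableAt 𝓘(ℝ, E') (𝓘(ℝ, E).prod 𝓘(ℝ, F))
      (fun y => (⟨φ y, s y⟩ : TotalSpace F V)) x)
    (ht : MDifferentiableAt 𝓘(ℝ, E') (𝓘(ℝ, E).prod 𝓘(ℝ, F))
      (fun y => (⟨φ y, t y⟩ : TotalSpace F V)) x) :
    MDifferentiableAt 𝓘(ℝ, E') (𝓘(ℝ, E).prod 𝓘(ℝ, F))
      (fun y => (⟨φ y, s y + t y⟩ : TotalSpace F V)) x := by
  have hx := mem_baseSet_trivializationAt F V (φ x)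
  refine (mdifferentiableAt_totalSpace ..).2 ⟨mdifferentiableAt_base hs, ?_⟩
  refine ((mdifferentiableAt_fibreCoord_comp hx hs).add
    (mdifferentiableAt_fibreCoord_comp hx ht)).congr_of_eventuallyEq ?_
  filter_upwards [(mdifferentiableAt_base hs).continuousAt.eventually
    (eventually_mem_baseSet (F := F) (V := V) (φ x))] with y hy
  change fibreCoord (φ x) (⟨φ y, s y + t y⟩ : TotalSpace F V) = _
  simp only [Pi.add_apply, ← fibreIso_apply hy, map_add]

/-- For `s = t` this is the chain rule applied to `θ ↦ ⟨θ, θ⟩` on the total space, the derivative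
along `φ` being `K` of the differential. The general case follows by polarization from `s + t`. -/
theorem derivAlong_metric [IsContMDiffRiemannianBundle 𝓘(ℝ, E) ∞ F V]
    (hD : IsMetricConnection (F := F) D)
    (hs : MDifferentiableAt 𝓘(ℝ, E') (𝓘(ℝ, E).prod 𝓘(ℝ, F))
      (fun y => (⟨φ y, s y⟩ : TotalSpace F V)) x)
    (ht : MDifferentiableAt 𝓘(ℝ, E') (𝓘(ℝ, E).prod 𝓘(ℝ, F))
      (fun y => (⟨φ y, t y⟩ : TotalSpace F V)) x) (u : TangentSpace 𝓘(ℝ, E') x) :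
    mvfderiv 𝓘(ℝ, E') (fun y => (inner ℝ (s y) (t y) : ℝ)) x u =
      inner ℝ (derivAlong (F := F) D φ s x u) (t x) +
        inner ℝ (s x) (derivAlong (F := F) D φ t x u) := by
  have hdiff : ∀ {s : ∀ y, V (φ y)}, MDifferentiableAt 𝓘(ℝ, E') (𝓘(ℝ, E).prod 𝓘(ℝ, F))
      (fun y => (⟨φ y, s y⟩ : TotalSpace F V)) x →
      MDifferentiableAt 𝓘(ℝ, E') 𝓘(ℝ, ℝ) (fun y => (inner ℝ (s y) (s y) : ℝ)) x :=
    fun hs => MDifferentiableAt.inner_bundle hs hs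
  have hself : ∀ {s : ∀ y, V (φ y)}, MDifferentiableAt 𝓘(ℝ, E') (𝓘(ℝ, E).prod 𝓘(ℝ, F))
      (fun y => (⟨φ y, s y⟩ : TotalSpace F V)) x →
      mvfderiv 𝓘(ℝ, E') (fun y => (inner ℝ (s y) (s y) : ℝ)) x u =
        2 * inner ℝ (derivAlong (F := F) D φ s x u) (s x) := by
    intro s hs
    rw [derivAlong_eq_connectionMap hs]
    refine Eq.trans ?_ (mvfderiv_inner_self hD (⟨φ x, s x⟩ : TotalSpace F V) _)
    exact mfderiv_comp_apply x (mdifferentiableAt_inner_self (⟨φ x, s x⟩ : TotalSpace F V)) hs u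
  have hst := mdifferentiableAt_add_along hs ht
  have h1 : (fun y => (inner ℝ (s y + t y) (s y + t y) : ℝ)) =
      (fun y => (inner ℝ (s y) (s y) : ℝ)) + ((fun y => (inner ℝ (t y) (t y) : ℝ)) +
        ((fun y => (inner ℝ (s y) (t y) : ℝ)) + fun y => (inner ℝ (s y) (t y) : ℝ))) := by
    funext y
    simp only [Pi.add_apply, real_inner_add_add_self]
    ring
  have h2 : MDifferentiableAt 𝓘(ℝ, E') 𝓘(ℝ, ℝ) (fun y => (inner ℝ (s y) (t y) : ℝ)) x :=
    MDifferentiableAt.inner_bundle hs ht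
  have h3 := hself hst
  rw [h1, mvfderiv_add (hdiff hs) ((hdiff ht).add (h2.add h2)),
    mvfderiv_add (hdiff ht) (h2.add h2), mvfderiv_add h2 h2, add_apply, add_apply, add_apply,
    hself hs, hself ht, derivAlong_add hD hs ht, add_apply, inner_add_left,
    inner_add_right, inner_add_right] at h3
  have h4 := real_inner_comm (s x) (derivAlong (F := F) D φ t x u)
  linarith

/-- The definition at `y` uses the trivialization at `φ y`, which moves with `y`. Through `K` the
derivative is rewritten in the fixed trivialization at `φ x`, where its coordinate is `dσ(X) + ∑ σ_j
d_j`, with `σ` the coordinate of `s` and `d_j` those of the derivatives of the extended frame. -/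
theorem mdifferentiableAt_derivAlong [IsContMDiffRiemannianBundle 𝓘(ℝ, E) ∞ F V]
    (hD : IsMetricConnection (F := F) D)
    (hs : ContMDiffAt 𝓘(ℝ, E') (𝓘(ℝ, E).prod 𝓘(ℝ, F)) ∞
      (fun y => (⟨φ y, s y⟩ : TotalSpace F V)) x)
    {X : ∀ y : N, TangentSpace 𝓘(ℝ, E') y}
    (hX : MDifferentiableAt 𝓘(ℝ, E') 𝓘(ℝ, E').tangent
      (fun y => (⟨y, X y⟩ : TangentBundle 𝓘(ℝ, E') N)) x)
    (h : ∀ v : V (φ x), MDifferentiableAt 𝓘(ℝ, E') (𝓘(ℝ, E).prod 𝓘(ℝ, F))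
      (fun y => (⟨φ y, D (FiberBundle.extend F v) (φ y) (mfderiv 𝓘(ℝ, E') 𝓘(ℝ, E) φ y (X y))⟩ :
        TotalSpace F V)) x) :
    MDifferentiableAt 𝓘(ℝ, E') (𝓘(ℝ, E).prod 𝓘(ℝ, F))
      (fun y => (⟨φ y, derivAlong (F := F) D φ s y (X y)⟩ : TotalSpace F V)) x := by
  have h0 := mem_baseSet_trivializationAt F V (φ x)
  let b := Module.finBasis ℝ F
  let v (j) : V (φ x) := (fibreIso (φ x) h0).symm (b j)
  let σ (y : N) : F := fibreCoord (φ x) (⟨φ y, s y⟩ : TotalSpace F V)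
  let d (j) (y : N) : F := fibreCoord (φ x) (⟨φ y, D (FiberBundle.extend F (v j)) (φ y)
    (mfderiv 𝓘(ℝ, E') 𝓘(ℝ, E) φ y (X y))⟩ : TotalSpace F V)
  have hs' : ContMDiffAt 𝓘(ℝ, E') 𝓘(ℝ, F) ∞ σ x := contMDiffAt_fibreCoord_comp h0 hs
  have hσ : ∀ j, MDifferentiableAt 𝓘(ℝ, E') 𝓘(ℝ, ℝ) (fun y => b.coord j (σ y)) x := fun j =>
    (LinearMap.toContinuousLinearMap (b.coord j)).mdifferentiableAt.comp x
      (hs'.mdifferentiableAt (by simp))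
  have hd : ∀ j, MDifferentiableAt 𝓘(ℝ, E') 𝓘(ℝ, F) (d j) x := fun j =>
    mdifferentiableAt_fibreCoord_comp h0 (h (v j))
  have hsum : MDifferentiableAt 𝓘(ℝ, E') 𝓘(ℝ, F)
      (fun y => mvfderiv 𝓘(ℝ, E') σ y (X y) + ∑ j, b.coord j (σ y) • d j y) x := by
    have h := (mdifferentiableAt_mvfderiv_apply hs' hX).add
      (MDifferentiableAt.sum (t := Finset.univ) fun j _ => (hσ j).smul (hd j))
    refine h.congr_of_eventuallyEq (Eventually.of_forall fun y => ?_)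
    simp
  have hsd : MDifferentiableAt 𝓘(ℝ, E') (𝓘(ℝ, E).prod 𝓘(ℝ, F))
      (fun y => (⟨φ y, s y⟩ : TotalSpace F V)) x := hs.mdifferentiableAt (by simp)
  have hφ := mdifferentiableAt_base hsd
  refine (mdifferentiableAt_totalSpace ..).2 ⟨hφ, hsum.congr_of_eventuallyEq ?_⟩
  have hs'' : ∀ᶠ y in 𝓝 x, ContMDiffAt 𝓘(ℝ, E') (𝓘(ℝ, E).prod 𝓘(ℝ, F)) 1
      (fun y => (⟨φ y, s y⟩ : TotalSpace F V)) y :=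
    (contMDiffAt_iff_contMDiffAt_nhds (by simp)).1 (hs.of_le (mod_cast le_top))
  filter_upwards [hφ.continuousAt.eventually (eventually_mem_baseSet (F := F) (V := V) (φ x)), hs'']
    with y hy hsy
  have hsy' := hsy.mdifferentiableAt one_ne_zero
  change fibreCoord (φ x) (⟨φ y, derivAlong (F := F) D φ s y (X y)⟩ : TotalSpace F V) = _
  have hv : FiberBundle.extend F ((fibreIso (φ x) h0).symm (σ y)) (φ y) = s y := by
    rw [extend_eq_fibreIso_symm hy, ← fibreIso_apply h0, ContinuousLinearEquiv.apply_symm_apply]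
    exact (fibreIso (φ x) hy).symm_apply_apply (s y)
  have h5 : D (FiberBundle.extend F ((fibreIso (φ x) h0).symm (σ y))) (φ y)
      (mfderiv 𝓘(ℝ, E') 𝓘(ℝ, E) φ y (X y)) = ∑ j, b.coord j (σ y) •
        D (FiberBundle.extend F (v j)) (φ y) (mfderiv 𝓘(ℝ, E') 𝓘(ℝ, E) φ y (X y)) := by
    change extendDerivative hD.isCovariantDerivative (φ x) hy
      ((fibreIso (φ x) h0).symm (σ y)) (mfderiv 𝓘(ℝ, E') 𝓘(ℝ, E) φ y (X y)) = _
    conv_lhs => rw [← b.sum_repr (σ y)]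
    simp only [map_sum, map_smul, sum_apply, smul_apply]
    rfl
  let A := mfderiv 𝓘(ℝ, E') (𝓘(ℝ, E).prod 𝓘(ℝ, F)) (fun y => (⟨φ y, s y⟩ : TotalSpace F V)) y (X y)
  have h6 : dProj (⟨φ y, s y⟩ : TotalSpace F V) A = mfderiv 𝓘(ℝ, E') 𝓘(ℝ, E) φ y (X y) :=
    (mfderiv_comp_apply y (mdifferentiableAt_proj (IB := 𝓘(ℝ, E)) V
      (p := (⟨φ y, s y⟩ : TotalSpace F V))) hsy' (X y)).symm
  have h7 : mvfderiv 𝓘(ℝ, E') σ y (X y) = mvfderiv (𝓘(ℝ, E).prod 𝓘(ℝ, F)) (fibreCoord (φ x))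
      (⟨φ y, s y⟩ : TotalSpace F V) A :=
    mfderiv_comp_apply (I' := 𝓘(ℝ, E).prod 𝓘(ℝ, F)) (g := fibreCoord (φ x)) y
      (mdifferentiableAt_fibreCoord (E := E) (x₀ := φ x) (θ := (⟨φ y, s y⟩ : TotalSpace F V)) hy) hsy' (X y)
  -- Taking the fibre coordinate of `A = (π_* A)^h + (K A)^v` expresses `K A` in the fixed
  -- trivialization.
  have h8 := congrArg (mvfderiv (𝓘(ℝ, E).prod 𝓘(ℝ, F)) (fibreCoord (φ x))
    (⟨φ y, s y⟩ : TotalSpace F V)) (hLift_add_vLift D (⟨φ y, s y⟩ : TotalSpace F V) A)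
  rw [map_add, mvfderiv_fibreCoord_vLift hy, mvfderiv_fibreCoord_hLift_of_mem hD hy hv
    (mdifferentiableAt_extend_of_mem hy _), h6, ← h7, h5] at h8
  rw [derivAlong_eq_connectionMap hsy', ← h8, ← fibreIso_apply hy, map_sum]
  simp only [map_smul]
  change _ = -_ + _ + ∑ j, b.coord j (σ y) • fibreIso (φ x) hy _
  abel

end DerivAlong

/-! ### The Levi-Civita connection as a metric connection on the tangent bundle. -/

section CovTangent
variable
  {EM : Type*} [NormedAddCommGroup EM] [NormedSpace ℝ EM] [FiniteDimensional ℝ EM]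
  {M : Type*} [TopologicalSpace M] [T2Space M] [ChartedSpace EM M] [IsManifold 𝓘(ℝ, EM) ∞ M]
  [RiemannianBundle (fun x : M => TangentSpace 𝓘(ℝ, EM) x)]
  [IsContMDiffRiemannianBundle 𝓘(ℝ, EM) ∞ EM (fun x : M => TangentSpace 𝓘(ℝ, EM) x)]
  {cov : CovariantDerivative 𝓘(ℝ, EM) EM (TangentSpace 𝓘(ℝ, EM) : M → Type _)}

/-- Smoothness of `cov` speaks of globally smooth fields, whereas an extended vector is smooth only
near its base point. Multiplying by a bump function equal to `1` near that point gives a global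
field, and locality of `cov` shows that the derivative is unchanged there. -/
theorem mdifferentiableAt_cov_extend
  {EL : Type*} [NormedAddCommGroup EL] [NormedSpace ℝ EL] 
  {L : Type*} [TopologicalSpace L] [ChartedSpace EL L]
    (hcov : CovariantDerivative.ContMDiffCovariantDerivative cov ∞) 
    {φ : L → M} {x : L} (hφ : MDifferentiableAt 𝓘(ℝ, EL) 𝓘(ℝ, EM) φ x)
    (v : TangentSpace 𝓘(ℝ, EM) (φ x)) {s : ∀ y : L, TangentSpace 𝓘(ℝ, EM) (φ y)}
    (hs : MDifferentiableAt 𝓘(ℝ, EL) 𝓘(ℝ, EM).tangent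
      (fun y => (⟨φ y, s y⟩ : TangentBundle 𝓘(ℝ, EM) M)) x) :
    MDifferentiableAt 𝓘(ℝ, EL) 𝓘(ℝ, EM).tangent
      (fun y => (⟨φ y, cov (FiberBundle.extend EM v) (φ y) (s y)⟩ : TangentBundle 𝓘(ℝ, EM) M)) x := by
  let S : ∀ z : M, TangentSpace 𝓘(ℝ, EM) z := FiberBundle.extend EM v
  obtain ⟨U, hU, hS⟩ := FiberBundle.exists_contMDiffOn_extend (k := ∞) 𝓘(ℝ, EM) EM v
  obtain ⟨ρ, -, hρ⟩ := (SmoothBumpFunction.nhds_basis_tsupport (I := 𝓘(ℝ, EM)) (φ x)).mem_iff.1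
    (interior_mem_nhds.2 hU)
  let σ : ∀ z : M, TangentSpace 𝓘(ℝ, EM) z := fun z => ρ z • S z
  have hσ : ContMDiff 𝓘(ℝ, EM) 𝓘(ℝ, EM).tangent ∞
      (fun z => (⟨z, σ z⟩ : TangentBundle 𝓘(ℝ, EM) M)) :=
    ContMDiffOn.smul_section_of_tsupport ρ.contMDiff.contMDiffOn isOpen_interior hρ
      (hS.mono interior_subset)
  have h1 := (hcov.contMDiff.contMDiff (σ := σ) (hσ.contMDiffOn.of_le (by simp))).contMDiffAt
    (x := φ x) univ_mem
  have h2 := MDifferentiableAt.clm_bundle_apply (b := φ)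
    (E₁ := (TangentSpace 𝓘(ℝ, EM) : M → Type _)) (E₂ := (TangentSpace 𝓘(ℝ, EM) : M → Type _))
    ((h1.mdifferentiableAt (by simp)).comp x hφ) hs
  refine h2.congr_of_eventuallyEq ?_
  have h3 := hφ.continuousAt.eventually (eventually_eventually_nhds.2 ρ.eventuallyEq_one)
  filter_upwards [h3, hφ.continuousAt.eventually (eventually_eventually_nhds.2 hU)] with y hy hy'
  have hS' : MDifferentiableAt 𝓘(ℝ, EM) 𝓘(ℝ, EM).tangent
      (fun z => (⟨z, S z⟩ : TangentBundle 𝓘(ℝ, EM) M)) (φ y) :=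
    (hS.contMDiffAt hy').mdifferentiableAt (by simp)
  have h4 := cov.isCovariantDerivativeOnUniv.congr_of_eventuallyEq hS'
    (hσ.contMDiffAt.mdifferentiableAt (by simp)) univ_mem (hy.mono fun z hz => by simp [σ, hz])
  exact congrArg (fun T => (⟨φ y, T (s y)⟩ : TangentBundle 𝓘(ℝ, EM) M)) h4

theorem IsLeviCivita.isMetricConnection (h : IsLeviCivita (fun _ u v => inner ℝ u v) cov) :
    IsMetricConnection (F := EM) (V := fun x : M => TangentSpace 𝓘(ℝ, EM) x)
      (fun s => cov s) where
  isCovariantDerivative := cov.isCovariantDerivativeOnUniv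
  metric ξ η x u hξ hη := h.metric ξ η x u hξ hη
  smooth _ w _ hX := mdifferentiableAt_cov_extend h.smooth mdifferentiableAt_id w hX

end CovTangent

/-! ### The normal bundle and its metric connection. -/

section NormalBundle

variable
  {EL : Type*} [NormedAddCommGroup EL] [NormedSpace ℝ EL] [FiniteDimensional ℝ EL]
  {L : Type*} [TopologicalSpace L] [ChartedSpace EL L] [IsManifold 𝓘(ℝ, EL) ∞ L]
  [RiemannianBundle (fun x : L => TangentSpace 𝓘(ℝ, EL) x)]
  {EM : Type*} [NormedAddCommGroup EM] [NormedSpace ℝ EM] [FiniteDimensional ℝ EM]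
  {M : Type*} [TopologicalSpace M] [ChartedSpace EM M] [IsManifold 𝓘(ℝ, EM) ∞ M]
  [RiemannianBundle (fun x : M => TangentSpace 𝓘(ℝ, EM) x)]
  [IsContMDiffRiemannianBundle 𝓘(ℝ, EM) ∞ EM (fun x : M => TangentSpace 𝓘(ℝ, EM) x)]
  {f : IsometricImmersion EL L EM M}

namespace IsometricImmersion

variable (f) in
/-- The inclusion of the normal bundle into the pullback of `TM`, in coordinates. -/
def inclCoord (x₀ x : L) : NormalModel EL EM →L[ℝ] EM :=
  (f.projCoord x₀ x).comp ((f.ofModel x₀).comp (Ring.inverse (f.fibreEndo x₀ x)))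

variable (f) in
theorem contMDiffAt_inclCoord (x : L) :
    ContMDiffAt 𝓘(ℝ, EL) 𝓘(ℝ, NormalModel EL EM →L[ℝ] EM) ∞ (f.inclCoord x) x := by
  obtain ⟨hx, u, hu⟩ := f.mem_trivDomain x
  have h3 := contDiffAt_ringInverse ℝ (n := ∞) u
  rw [hu] at h3
  exact (f.contMDiffAt_projCoord x hx).clm_comp (contMDiffAt_const.clm_comp
    (h3.contMDiffAt.comp x (f.contMDiffAt_fibreEndo x hx)))

/-- A normal vector is recovered from its coordinates by `fibreInv`, which is built from the
projection and an inverse; both are smooth in coordinates, and so is the inclusion into `TM`. -/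
theorem triv_incl {x₀ x : L} (hx : x ∈ f.trivDomain x₀) (v : f.NormalSpace x) :
    (f.triv x₀ ⟨f.toFun x, f.incl x v⟩).2 =
      f.inclCoord x₀ x (fibreCoord x₀ (⟨x, v⟩ : f.NormalBundle)) := by
  change _ = f.inclCoord x₀ x (f.fibreMap x₀ x v)
  conv_lhs => rw [← f.fibreInv_fibreMap hx v]
  exact (Trivialization.continuousLinearMapAt_apply_of_mem (R := ℝ) (f.triv x₀) hx.1 _).symm

theorem eventually_mem_trivDomain (x : L) : ∀ᶠ y in 𝓝 x, y ∈ f.trivDomain x :=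
  (f.isOpen_trivDomain x).mem_nhds (f.mem_trivDomain x)

theorem contMDiffAt_incl {ξ : ∀ y, f.NormalSpace y} {x : L}
    (hξ : ContMDiffAt 𝓘(ℝ, EL) (𝓘(ℝ, EL).prod 𝓘(ℝ, NormalModel EL EM)) ∞
      (fun y => (⟨y, ξ y⟩ : f.NormalBundle)) x) :
    ContMDiffAt 𝓘(ℝ, EL) 𝓘(ℝ, EM).tangent ∞
      (fun y => (⟨f.toFun y, f.incl y (ξ y)⟩ : TangentBundle 𝓘(ℝ, EM) M)) x := by
  refine contMDiffAt_totalSpace.2 ⟨f.contMDiff.contMDiffAt, ?_⟩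
  refine ((f.contMDiffAt_inclCoord x).clm_apply
    (contMDiffAt_totalSpace.1 hξ).2).congr_of_eventuallyEq ?_
  filter_upwards [f.eventually_mem_trivDomain x] with y hy
  exact triv_incl hy (ξ y)

theorem mdifferentiableAt_incl {ξ : ∀ y, f.NormalSpace y} {x : L}
    (hξ : MDifferentiableAt 𝓘(ℝ, EL) (𝓘(ℝ, EL).prod 𝓘(ℝ, NormalModel EL EM))
      (fun y => (⟨y, ξ y⟩ : f.NormalBundle)) x) :
    MDifferentiableAt 𝓘(ℝ, EL) 𝓘(ℝ, EM).tangent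
      (fun y => (⟨f.toFun y, f.incl y (ξ y)⟩ : TangentBundle 𝓘(ℝ, EM) M)) x := by
  refine (mdifferentiableAt_totalSpace ..).2 ⟨f.contMDiff.mdifferentiableAt (by simp), ?_⟩
  refine (((f.contMDiffAt_inclCoord x).mdifferentiableAt (by simp)).clm_apply
    ((mdifferentiableAt_totalSpace ..).1 hξ).2).congr_of_eventuallyEq ?_
  filter_upwards [f.eventually_mem_trivDomain x] with y hy
  exact triv_incl hy (ξ y)

theorem mdifferentiableAt_normalProj {s : ∀ y, TangentSpace 𝓘(ℝ, EM) (f.toFun y)} {x : L}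
    (hs : MDifferentiableAt 𝓘(ℝ, EL) 𝓘(ℝ, EM).tangent
      (fun y => (⟨f.toFun y, s y⟩ : TangentBundle 𝓘(ℝ, EM) M)) x) :
    MDifferentiableAt 𝓘(ℝ, EL) (𝓘(ℝ, EL).prod 𝓘(ℝ, NormalModel EL EM))
      (fun y => (⟨y, f.proj y (s y)⟩ : f.NormalBundle)) x := by
  refine (mdifferentiableAt_totalSpace ..).2 ⟨mdifferentiableAt_id, ?_⟩
  have h1 : MDifferentiableAt 𝓘(ℝ, EL) 𝓘(ℝ, EM →L[ℝ] NormalModel EL EM)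
      (fun y => (f.toModel x).comp (f.projCoord x y)) x :=
    (contMDiffAt_const.clm_comp
      (f.contMDiffAt_projCoord x (f.mem_trivDomain x).1)).mdifferentiableAt (n := ∞) (by simp)
  refine (h1.clm_apply ((mdifferentiableAt_totalSpace ..).1 hs).2).congr_of_eventuallyEq ?_
  filter_upwards [f.eventually_mem_trivDomain x] with y hy
  have h2 := (f.triv x).symmL_continuousLinearMapAt (R := ℝ) hy.1 (s y)
  rw [Trivialization.continuousLinearMapAt_apply_of_mem (R := ℝ) (f.triv x) hy.1] at h2
  change f.fibreMap x y (f.proj y (s y)) = f.toModel x (f.projCoord x y (f.triv x ⟨_, s y⟩).2)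
  conv_lhs => rw [← h2]
  rfl

instance : IsContMDiffRiemannianBundle 𝓘(ℝ, EL) ∞ (NormalModel EL EM) f.NormalSpace where
  exists_contMDiff := by
    refine ⟨fun x => innerSL ℝ, fun x => ?_, fun x v w => rfl⟩
    rw [contMDiffAt_section]
    -- The fibre metric is the restriction of the metric of `M`, so its smoothness follows from that
    -- of the local frame viewed in `TM` along `f`.
    have key : ∀ v w : NormalModel EL EM, ContMDiffAt 𝓘(ℝ, EL) 𝓘(ℝ, ℝ) ∞
        (fun y => (inner ℝ (f.fibreInv x y v) (f.fibreInv x y w) : ℝ)) x := by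
      intro v w
      have h (v : NormalModel EL EM) : ContMDiffAt 𝓘(ℝ, EL)
          (𝓘(ℝ, EL).prod 𝓘(ℝ, NormalModel EL EM)) ∞
          (fun y => (⟨y, f.fibreInv x y v⟩ : f.NormalBundle)) x := by
        refine contMDiffAt_totalSpace.2 ⟨contMDiffAt_id, ?_⟩
        refine (contMDiffAt_const (c := v)).congr_of_eventuallyEq ?_
        filter_upwards [f.eventually_mem_trivDomain x] with y hy
        exact f.fibreMap_fibreInv hy v
      exact ContMDiffAt.inner_bundle (E := fun x : M => TangentSpace 𝓘(ℝ, EM) x) (b := f.toFun)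
        (contMDiffAt_incl (h v)) (contMDiffAt_incl (h w))
    refine contMDiffAt_clm_of_apply fun v => contMDiffAt_clm_of_apply fun w => ?_
    refine (key v w).congr_of_eventuallyEq ?_
    filter_upwards [f.eventually_mem_trivDomain x] with y hy
    have hsymm (v : NormalModel EL EM) :
        (trivializationAt (NormalModel EL EM) f.NormalSpace x).symm y v = f.fibreInv x y v := by
      have hy' : y ∈ (trivializationAt (NormalModel EL EM) f.NormalSpace x).baseSet := hy
      apply f.fibreMap_injective hy
      rw [f.fibreMap_fibreInv hy]
      exact congrArg Prod.snd (Trivialization.apply_mk_symm _ hy' v)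
    rw [hom_trivializationAt_apply]
    dsimp only
    rw [inCoordinates_apply_eq₂ hy hy (mem_univ _), hsymm, hsymm,
      Trivialization.coe_linearMapAt_of_mem _ (mem_univ _)]
    rfl

theorem inner_incl (x : L) (v : f.NormalSpace x) (w : TangentSpace 𝓘(ℝ, EM) (f.toFun x)) :
    (inner ℝ w (f.incl x v) : ℝ) = inner ℝ (f.proj x w) v :=
  (Submodule.inner_orthogonalProjectionOnto_eq_of_mem_right (K := f.normalSubmodule x) v w).symm

variable {covM : CovariantDerivative 𝓘(ℝ, EM) EM (TangentSpace 𝓘(ℝ, EM) : M → Type _)}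

/-- For the tangent bundle of `M`, `pullbackDerivative` unfolds to `derivAlong`, which gives access
to the results about derivatives along a map. -/
theorem normalConnection_apply (ξ : ∀ y, f.NormalSpace y) (x : L) (u : TangentSpace 𝓘(ℝ, EL) x) :
    f.normalConnection covM ξ x u = f.proj x (derivAlong (F := EM)
      (V := fun x : M => TangentSpace 𝓘(ℝ, EM) x) (fun s => covM s) f.toFun
      (fun y => f.incl y (ξ y)) x u) := rfl

/-- Additivity and the Leibniz rule descend from `derivAlong`, since the projection fixes normal
vectors. The tangential part dropped by the projection is orthogonal to all normal vectors, so it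
does not affect the metric identity. -/
theorem isMetricConnection_normalConnection [T2Space M]
    (hM : IsLeviCivita (fun _ u v => inner ℝ u v) covM) :
    IsMetricConnection (F := NormalModel EL EM) (f.normalConnection covM) where
  isCovariantDerivative :=
    { add := by
        intro ξ η x hξ hη _
        ext1 u
        simp only [normalConnection_apply, add_apply, Pi.add_apply, map_add]
        rw [derivAlong_add hM.isMetricConnection
          (mdifferentiableAt_incl hξ) (mdifferentiableAt_incl hη), add_apply, map_add]
      leibniz := by
        intro ξ g x hξ hg _
        ext1 u
        simp only [normalConnection_apply, add_apply, smul_apply, Pi.smul_apply', map_smul]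
        rw [derivAlong_smul hM.isMetricConnection
          (mdifferentiableAt_incl hξ) hg, map_add, map_smul, map_smul, proj_incl]
        rfl }
  metric ξ η x u hξ hη := by
    have h := derivAlong_metric hM.isMetricConnection (mdifferentiableAt_incl hξ)
      (mdifferentiableAt_incl hη) u
    rw [inner_incl, real_inner_comm _ (f.incl x (ξ x)), inner_incl, real_inner_comm (ξ x)] at h
    exact h
  smooth x w X hX := by
    refine mdifferentiableAt_normalProj ?_
    refine mdifferentiableAt_derivAlong hM.isMetricConnection
      (contMDiffAt_incl (FiberBundle.contMDiffAt_extend 𝓘(ℝ, EL) (NormalModel EL EM) w)) hX ?_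
    intro v
    exact mdifferentiableAt_cov_extend hM.smooth (f.contMDiff.mdifferentiableAt (by simp)) v
      (mdifferentiableAt_mfderiv_apply f.contMDiff.contMDiffAt hX)

end IsometricImmersion

end NormalBundle

end NormalBundleGeometry

end

/-! ### The theorem for the normal bundle of an immersion. -/

theorem mainTheorem6
    {EL : Type*} [NormedAddCommGroup EL] [NormedSpace ℝ EL] [FiniteDimensional ℝ EL]
    {L : Type*} [TopologicalSpace L] [T2Space L] [ChartedSpace EL L] [IsManifold 𝓘(ℝ, EL) ∞ L]
    [RiemannianBundle (fun x : L => TangentSpace 𝓘(ℝ, EL) x)]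
    [IsContMDiffRiemannianBundle 𝓘(ℝ, EL) ∞ EL (fun x : L => TangentSpace 𝓘(ℝ, EL) x)]
    {EM : Type*} [NormedAddCommGroup EM] [NormedSpace ℝ EM] [FiniteDimensional ℝ EM]
    {M : Type*} [TopologicalSpace M] [T2Space M] [ChartedSpace EM M] [IsManifold 𝓘(ℝ, EM) ∞ M]
    [RiemannianBundle (fun x : M => TangentSpace 𝓘(ℝ, EM) x)]
    [IsContMDiffRiemannianBundle 𝓘(ℝ, EM) ∞ EM (fun x : M => TangentSpace 𝓘(ℝ, EM) x)]
    (f : IsometricImmersion EL L EM M)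
    (covM : CovariantDerivative 𝓘(ℝ, EM) EM (TangentSpace 𝓘(ℝ, EM) : M → Type _))
    (hM : IsLeviCivita (fun x u v => inner ℝ u v) covM)
    (covL : CovariantDerivative 𝓘(ℝ, EL) EL (TangentSpace 𝓘(ℝ, EL) : L → Type _))
    (hL : IsLeviCivita (fun x u v => inner ℝ u v) covL)
    (p q : ℝ) (hq : 0 ≤ q)
    (cov : CovariantDerivative (𝓘(ℝ, EL).prod 𝓘(ℝ, NormalModel EL EM)) (EL × NormalModel EL EM)
      (TangentSpace (𝓘(ℝ, EL).prod 𝓘(ℝ, NormalModel EL EM)) :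
        f.NormalBundle → Type _))
    (hcov : IsLeviCivita (cheegerGromoll (f.normalConnection covM) p q) cov) :
    (∀ (X Y : ∀ x : L, TangentSpace 𝓘(ℝ, EL) x) (ξ η : ∀ x : L, f.NormalSpace x),
      ContMDiff 𝓘(ℝ, EL) 𝓘(ℝ, EL).tangent ∞ (fun x => (⟨x, X x⟩ : TangentBundle 𝓘(ℝ, EL) L)) →
      ContMDiff 𝓘(ℝ, EL) 𝓘(ℝ, EL).tangent ∞ (fun x => (⟨x, Y x⟩ : TangentBundle 𝓘(ℝ, EL) L)) →
      ContMDiff 𝓘(ℝ, EL) (𝓘(ℝ, EL).prod 𝓘(ℝ, NormalModel EL EM)) ∞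
        (fun x => (⟨x, ξ x⟩ : f.NormalBundle)) →
      ContMDiff 𝓘(ℝ, EL) (𝓘(ℝ, EL).prod 𝓘(ℝ, NormalModel EL EM)) ∞
        (fun x => (⟨x, η x⟩ : f.NormalBundle)) →
      let D := f.normalConnection covM
      let Xh := fun θ : f.NormalBundle => hLift D θ (X θ.proj)
      let Yh := fun θ : f.NormalBundle => hLift D θ (Y θ.proj)
      let ξv := fun θ : f.NormalBundle => vLift EL θ (ξ θ.proj)
      let ηv := fun θ : f.NormalBundle => vLift EL θ (η θ.proj)
      ∀ θ : f.NormalBundle,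
        let x := θ.proj
        cov Yh θ (Xh θ) = hLift D θ (covL Y x (X x)) -
            (1 / 2 : ℝ) • vLift EL θ
              (curvature (F := NormalModel EL EM) D x (X x) (Y x) θ.2) ∧
        cov ηv θ (Xh θ) = ((1 / 2 : ℝ) * omega θ ^ p) •
            hLift D θ (curvatureAdjoint (F := NormalModel EL EM) D x θ.2 (η x) (X x)) +
              vLift EL θ (D η x (X x)) ∧
        cov Yh θ (ηv θ) = ((1 / 2 : ℝ) * omega θ ^ p) •
            hLift D θ (curvatureAdjoint (F := NormalModel EL EM) D x θ.2 (η x) (Y x)) ∧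
        cov ηv θ (ξv θ) =
          -(p * omega θ) • (inner ℝ (ξ x) θ.2 • ηv θ + inner ℝ (η x) θ.2 • ξv θ) +
          (p * q * omega θ / (q * inner ℝ θ.2 θ.2 + 1) * inner ℝ (ξ x) θ.2 * inner ℝ (η x) θ.2 +
            (q + p * omega θ) / (q * inner ℝ θ.2 θ.2 + 1) * inner ℝ (ξ x) (η x)) •
              canonicalField θ) ∧
    (∀ x : L, IsTotallyGeodesic cov
      ((TotalSpace.proj : f.NormalBundle → L) ⁻¹' {x})
      (fun θ => LinearMap.ker (dProj θ).toLinearMap)) := by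
  have hD := IsometricImmersion.isMetricConnection_normalConnection (f := f) hM
  refine ⟨fun X Y ξ η hX hY hξ hη => ?_, fun x => isTotallyGeodesic_fibre hq hD hL hcov x⟩
  intro D Xh Yh ξv ηv θ x
  have hX' := hX.contMDiffAt (x := θ.proj) |>.mdifferentiableAt (by simp)
  have hY' := hY.contMDiffAt (x := θ.proj) |>.mdifferentiableAt (by simp)
  have hξ' := hξ.contMDiffAt (x := θ.proj) |>.mdifferentiableAt (by simp)
  have hη' := hη.contMDiffAt (x := θ.proj) |>.mdifferentiableAt (by simp)
  exact ⟨cov_hLift_hLift hq hD hL hcov hX' hY', cov_hLift_vLift hq hD hL hcov hX' hη',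
    cov_vLift_hLift hq hD hL hcov hY' hη', cov_vLift_vLift hq hD hcov hξ' hη'⟩
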